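/- Let $R=\mathbb{Q}[y]$ with $y=x_1-x_2$ in degree $2$, let $R_1=\mathbb{Q}[y^2]\subset R$ and $B_1=R\otimes_{R_1}R$, a graded $R$-bimodule; $\{k\}$ denotes the grading shift up by $k$. For the generator $\sigma_1$ of the $2$-strand braid group let $F(\sigma_1)$ be the complex of graded $R$-bimodules $0\to R\{2\}\to B_1\to 0$, $1\mapsto y\otimes 1+1\otimes y$, with $B_1$ in cohomological degree $0$, and let $F(\sigma_1^n)=F(\sigma_1)\otimes_R\cdots\otimes_R F(\sigma_1)$ ($n$ factors; $F=R$ in degree $0$ for $n=0$). Let $\mathrm{HHH}(\sigma_1^n)$ be the triply graded $\mathbb{Q}$-vector space obtained by applying the Hochschild homology $\mathrm{HH}_*(R,-)$ to each term of $F(\sigma_1^n)$ and taking cohomology of the resulting complex. (1) For every $n\ge 0$, the complex $F(\sigma_1^n)$ is isomorphic to the direct sum of a contractible complex and the complex $$F_{\min}:\quad 0\to R\{2n\}\xrightarrow{d^0}B_1\{2n-2\}\xrightarrow{d^1}B_1\{2n-4\}\xrightarrow{d^2}\cdots\xrightarrow{d^{n-1}}B_1\to 0,$$ whose $n+1$ terms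 (in cohomological degrees $-n,\dots,0$) are indecomposable graded bimodules and which has no nonzero contractible direct summand, with $$d^0(1)=1\otimes y+y\otimes 1,\qquad d^i(1\otimes 1)=\begin{cases}1\otimes y-y\otimes 1,& i>0\text{ odd},\\ 1\otimes y+y\otimes 1,& i>0\text{ even}.\end{cases}$$ (2) Applying $\mathrm{HH}_0$ and $\mathrm{HH}_1$ to the terms of $F_{\min}$ gives, up to isomorphism, the following complexes of graded $R$-modules, each with $n+1$ terms: $$0\to R\{2n\}\xrightarrow{2y}R\{2n-2\}\xrightarrow{0}R\{2n-4\}\xrightarrow{2y}R\{2n-6\}\xrightarrow{0}\cdots,$$ $$0\to R\{2n+2\}\xrightarrow{1}R\{2n+2\}\xrightarrow{0}R\{2n\}\xrightarrow{2y}R\{2n-2\}\xrightarrow{0}R\{2n-4\}\xrightarrow{2y}\cdots.$$ (3) Let $n$ be odd, so that the closure of $\sigma_1^n$ is the $(2,n)$-torus knot. Count cohomological degrees from the leftmost term, i.e. shift them up by $n$. Then the part of $\mathrm{HHH}(\sigma_1^n)$ of Hochschild degree $0$ is one-dimensional in the bidegrees (degree in the variables, cohomological degree) $(2n-2,1),(2n-6,3),\dots,(0,n)$,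 the part of Hochschild degree $1$ is one-dimensional in the bidegrees $(2n-2,3),(2n-6,5),\dots,(4,n)$, and $\mathrm{HHH}(\sigma_1^n)$ vanishes in all other tridegrees. Hence $\mathrm{HHH}$ of the $(2,n)$-torus knot has total rank $n$. -/

import Mathlib

open CategoryTheory CategoryTheory.Limits Polynomial
open scoped TensorProduct DirectSum

namespace RouquierHHH

noncomputable section

/-! ### Graded modules and bimodules over `R = ℚ[y]` -/

/-- The ring `R = ℚ[y]`, `y = x₁ - x₂`; the variable `y` is `Polynomial.X`. -/
abbrev R : Type := ℚ[X]

/-- The homogeneous part of degree `j` of `R`, where `y` has degree `2`. -/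
def R.deg (j : ℤ) : Submodule ℚ R :=
  Submodule.span ℚ {f | ∃ k : ℕ, 2 * (k : ℤ) = j ∧ f = X ^ k}

/-- A criterion for a family of subspaces to be a grading. -/
lemma isInternal_of {M Q : Type} [AddCommGroup M] [Module ℚ M] [AddCommGroup Q] [Module ℚ Q]
    (gr : ℤ → Submodule ℚ M) (ι : M →ₗ[ℚ] Q) (hι : Function.Injective ι)
    (δ : M →ₗ[ℚ] (ℤ →₀ Q)) (hδ : ∀ i, ∀ x ∈ gr i, δ x = Finsupp.single i (ι x))
    (htop : ∀ x, x ∈ ⨆ i, gr i) : DirectSum.IsInternal gr := by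
  refine DirectSum.isInternal_submodule_of_iSupIndep_of_iSup_eq_top ?_
    (eq_top_iff.2 fun x _ => htop x)
  refine iSupIndep_of_dfinsupp_lsum_injective _ ?_
  have key : ∀ (m : Π₀ i, gr i) (j : ℤ),
      δ (DFinsupp.lsum ℕ (fun i => (gr i).subtype) m) j = ι (m j) := by
    intro m j
    induction m using DFinsupp.induction with
    | h0 => simp
    | ha i b f hf hb ih =>
      rw [map_add, map_add, Finsupp.add_apply, ih]
      simp only [DFinsupp.lsum_single, DFinsupp.add_apply, Submodule.coe_add, map_add]
      congr 1
      rw [Submodule.subtype_apply, hδ i _ b.2]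
      by_cases hij : i = j
      · subst hij; simp
      · simp [hij, DFinsupp.single_apply]
  intro m m' h
  ext j
  have := congrArg (fun t => δ t j) h
  simp only [key] at this
  exact hι this

/-- A `ℤ`-graded `ℚ`-vector space with pairwise commuting graded actions of `R`, one for each
element of `S`. For `S = Unit` this is a graded `R`-module; for `S = Side` it is a graded
`R`-bimodule on which `ℚ` acts centrally (`R` being commutative, a right action is also a
homomorphism from `R`). -/
structure GrMod (S : Type) where
  carrier : Type
  [addCommGroup : AddCommGroup carrier]
  [module : Module ℚ carrier]
  act : S → R →ₐ[ℚ] Module.End ℚ carrier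
  act_comm : ∀ (s t : S) (a b : R) (x : carrier),
    act s a (act t b x) = act t b (act s a x)
  gr : ℤ → Submodule ℚ carrier
  isInternal : DirectSum.IsInternal gr
  act_mem : ∀ (s : S) {i j : ℤ} {a : R} {x : carrier},
    a ∈ R.deg i → x ∈ gr j → act s a x ∈ gr (i + j)

/-- The two sides of a bimodule. -/
inductive Side : Type
  | left
  | right

/-- Graded `R`-modules. -/
abbrev GrModule : Type 1 := GrMod Unit

/-- Graded `R`-bimodules. -/
abbrev Bimod : Type 1 := GrMod Side

namespace GrMod

variable {S : Type}

instance : CoeSort (GrMod S) Type := ⟨GrMod.carrier⟩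

instance (M : GrMod S) : AddCommGroup M := M.addCommGroup
instance (M : GrMod S) : Module ℚ M := M.module

/-- The degree-preserving `R`-linear maps, as a subspace of all `ℚ`-linear maps. -/
def homs (M N : GrMod S) : Submodule ℚ (M →ₗ[ℚ] N) where
  carrier := {f | (∀ s a x, f (M.act s a x) = N.act s a (f x)) ∧ ∀ i, ∀ x ∈ M.gr i, f x ∈ N.gr i}
  add_mem' := fun hf hg => ⟨fun s a x => by simp [hf.1, hg.1],
    fun i x hx => (N.gr i).add_mem (hf.2 i x hx) (hg.2 i x hx)⟩
  zero_mem' := ⟨by simp, fun i x _ => (N.gr i).zero_mem⟩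
  smul_mem' := fun c f hf => ⟨fun s a x => by simp [hf.1],
    fun i x hx => (N.gr i).smul_mem c (hf.2 i x hx)⟩

instance : Category (GrMod S) where
  Hom M N := homs M N
  id M := ⟨LinearMap.id, fun _ _ _ => rfl, fun _ _ h => h⟩
  comp f g := ⟨g.1 ∘ₗ f.1, fun s a x => by simp [f.2.1, g.2.1],
    fun i x hx => g.2.2 i _ (f.2.2 i x hx)⟩

/-- The underlying linear map of a morphism. -/
def Hom.lin {M N : GrMod S} (f : M ⟶ N) : M →ₗ[ℚ] N := Subtype.val f

/-- A degree-preserving `R`-linear map as a morphism. -/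
def ofLin {M N : GrMod S} (f : M →ₗ[ℚ] N) (h₁ : ∀ s a x, f (M.act s a x) = N.act s a (f x))
    (h₂ : ∀ i, ∀ x ∈ M.gr i, f x ∈ N.gr i) : M ⟶ N := ⟨f, h₁, h₂⟩

lemma Hom.lin_act {M N : GrMod S} (f : M ⟶ N) (s : S) (a : R) (x : M) :
    Hom.lin f (M.act s a x) = N.act s a (Hom.lin f x) := f.2.1 s a x

lemma Hom.lin_mem {M N : GrMod S} (f : M ⟶ N) {i : ℤ} {x : M} (hx : x ∈ M.gr i) :
    Hom.lin f x ∈ N.gr i := f.2.2 i x hx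

@[ext] lemma hom_ext {M N : GrMod S} {f g : M ⟶ N} (h : ∀ x, Hom.lin f x = Hom.lin g x) :
    f = g := Subtype.ext (LinearMap.ext h)

@[simp] lemma lin_ofLin {M N : GrMod S} (f : M →ₗ[ℚ] N) (h₁ h₂) :
    Hom.lin (ofLin f h₁ h₂ : M ⟶ N) = f := rfl

@[simp] lemma lin_id (M : GrMod S) : Hom.lin (𝟙 M) = LinearMap.id := rfl

@[simp] lemma lin_comp {M N P : GrMod S} (f : M ⟶ N) (g : N ⟶ P) :
    Hom.lin (f ≫ g) = Hom.lin g ∘ₗ Hom.lin f := rfl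

instance (M N : GrMod S) : AddCommGroup (M ⟶ N) := inferInstanceAs (AddCommGroup (homs M N))

@[simp] lemma lin_add {M N : GrMod S} (f g : M ⟶ N) :
    Hom.lin (f + g) = Hom.lin f + Hom.lin g := rfl

@[simp] lemma lin_zero (M N : GrMod S) : Hom.lin (0 : M ⟶ N) = 0 := rfl

instance : Preadditive (GrMod S) where
  add_comp := by intros; ext; simp
  comp_add := by intros; ext; simp

/-! #### Homogeneous components -/

lemma bijective (M : GrMod S) : Function.Bijective (DirectSum.coeLinearMap M.gr) := M.isInternal

/-- The map sending an element to the family of its homogeneous components. -/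
def comps (M : GrMod S) : M →ₗ[ℚ] (ℤ →₀ M) :=
  (DirectSum.toModule ℚ ℤ (ℤ →₀ M) fun i => Finsupp.lsingle i ∘ₗ (M.gr i).subtype) ∘ₗ
    (LinearEquiv.ofBijective (DirectSum.coeLinearMap M.gr) M.bijective).symm.toLinearMap

lemma comps_of_mem (M : GrMod S) {i : ℤ} {x : M} (hx : x ∈ M.gr i) :
    M.comps x = Finsupp.single i x := by
  have : (LinearEquiv.ofBijective (DirectSum.coeLinearMap M.gr) M.bijective).symm x
      = DirectSum.lof ℚ ℤ (fun i => M.gr i) i ⟨x, hx⟩ := by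
    rw [LinearEquiv.symm_apply_eq]
    simp
  simp [comps, this]

/-- Elements can be treated one homogeneous component at a time. -/
@[elab_as_elim]
lemma hom_induction (M : GrMod S) {p : M → Prop} (x : M)
    (mem : ∀ i, ∀ x ∈ M.gr i, p x) (add : ∀ x y, p x → p y → p (x + y)) : p x := by
  have : x ∈ ⨆ i, M.gr i := by rw [M.isInternal.submodule_iSup_eq_top]; trivial
  exact Submodule.iSup_induction _ (motive := p) this mem (mem 0 0 (M.gr 0).zero_mem) add

lemma sum_comps (M : GrMod S) (x : M) : (M.comps x).sum (fun _ y => y) = x := by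
  induction x using M.hom_induction with
  | mem i x hx => simp [M.comps_of_mem hx]
  | add x y hx hy => rw [map_add, Finsupp.sum_add_index' (by simp) (by simp), hx, hy]

lemma comps_mem (M : GrMod S) (x : M) (i : ℤ) : M.comps x i ∈ M.gr i := by
  induction x using M.hom_induction with
  | mem j x hx =>
    rw [M.comps_of_mem hx]
    by_cases h : j = i
    · subst h; simpa using hx
    · simp [h]
  | add x y hx hy => simpa using (M.gr i).add_mem hx hy

/-! #### Grading shifts -/

/-- `M{k}`, the grading of `M` shifted up by `k`. -/
abbrev shift (M : GrMod S) (k : ℤ) : GrMod S where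
  carrier := M
  act := M.act
  act_comm := M.act_comm
  gr j := M.gr (j - k)
  isInternal := by
    refine isInternal_of _ LinearMap.id Function.injective_id
      (Finsupp.lmapDomain M ℚ (fun i => i + k) ∘ₗ M.comps) ?_ ?_
    · intro i x hx
      simp [M.comps_of_mem hx]
    · intro x
      induction x using M.hom_induction with
      | mem i x hx => exact Submodule.mem_iSup_of_mem (i + k) (by simpa using hx)
      | add x y hx hy => exact Submodule.add_mem _ hx hy
  act_mem := fun s i j a x ha hx => by
    have := M.act_mem s ha hx
    rwa [← add_sub_assoc] at this

/-! #### Direct sums -/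

/-- The direct sum of a family of graded modules. -/
abbrev sum {J : Type} (f : J → GrMod S) : GrMod S where
  carrier := ⨁ j, f j
  act s := AlgHom.ofLinearMap
    { toFun := fun a => DirectSum.lmap (fun j => (f j).act s a)
      map_add' := fun a b => by ext; simp
      map_smul' := fun c a => by ext; simp; rfl }
    (by ext; simp) (fun a b => by ext; simp)
  act_comm s t a b x := by
    ext j
    simp [(f j).act_comm s t a b]
  gr i :=
    { carrier := {x | ∀ j, x j ∈ (f j).gr i}
      add_mem' := fun hx hy j => (f j).gr i |>.add_mem (hx j) (hy j)
      zero_mem' := fun j => ((f j).gr i).zero_mem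
      smul_mem' := fun c x hx j => ((f j).gr i).smul_mem c (hx j) }
  isInternal := by
    classical
    refine isInternal_of _ LinearMap.id Function.injective_id
      (DirectSum.toModule ℚ J _ fun j =>
        Finsupp.mapRange.linearMap (DirectSum.lof ℚ J (fun j => (f j : Type)) j) ∘ₗ (f j).comps)
      ?_ ?_
    · intro i x hx
      replace hx : ∀ j, x j ∈ (f j).gr i := hx
      conv_lhs => rw [← DirectSum.sum_support_of x]
      conv_rhs => rw [← DirectSum.sum_support_of x]
      simp only [map_sum, LinearMap.id_coe, id]
      rw [← Finsupp.singleAddHom_apply, map_sum]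
      refine Finset.sum_congr rfl fun j _ => ?_
      rw [← DirectSum.lof_eq_of ℚ, DirectSum.toModule_lof]
      simp [(f j).comps_of_mem (hx j)]
    · intro x
      induction x using DirectSum.induction_on with
      | zero => exact Submodule.zero_mem _
      | add x y hx hy => exact Submodule.add_mem _ hx hy
      | of j x =>
        induction x using (f j).hom_induction with
        | mem i x hx =>
          refine Submodule.mem_iSup_of_mem i fun j' => ?_
          by_cases h : j = j'
          · subst h; simpa using hx
          · rw [DirectSum.of_eq_of_ne _ _ _ (Ne.symm h)]; exact Submodule.zero_mem _
        | add x y hx hy => rw [map_add]; exact Submodule.add_mem _ hx hy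
  act_mem := fun s i j a x ha hx k => (f k).act_mem s ha (hx k)

open Classical in
/-- The inclusion of a summand. -/
def sumι {J : Type} (f : J → GrMod S) (j : J) : f j ⟶ sum f :=
  ofLin (M := f j) (N := sum f) (DirectSum.lof ℚ J (fun j => (f j : Type)) j)
    (fun s a x => by
      exact (DirectSum.lmap_lof (R := ℚ) (fun j => (f j).act s a) j x).symm)
    (fun i x hx j' => by
      by_cases h : j = j'
      · subst h; simpa using hx
      · rw [DirectSum.lof_eq_of, DirectSum.of_eq_of_ne _ _ _ (Ne.symm h)]
        exact Submodule.zero_mem _)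

open Classical in
/-- The universal property of the direct sum. -/
def sumDesc {J : Type} (f : J → GrMod S) {N : GrMod S} (φ : ∀ j, f j ⟶ N) : sum f ⟶ N :=
  ofLin (M := sum f) (N := N) (DirectSum.toModule ℚ J N fun j => Hom.lin (φ j))
    (fun s a x => by
      change (⨁ j, f j) at x
      change DirectSum.toModule ℚ J N (fun j => Hom.lin (φ j))
        (DirectSum.lmap (fun j => (f j).act s a) x) = _
      induction x using DirectSum.induction_on with
      | zero => simp
      | add x y hx hy => simp only [map_add, hx, hy]
      | of j x =>
        rw [← DirectSum.lof_eq_of ℚ, DirectSum.lmap_lof, DirectSum.toModule_lof,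
          DirectSum.toModule_lof, Hom.lin_act])
    (fun i x hx => by
      replace hx : ∀ j, x j ∈ (f j).gr i := hx
      change (⨁ j, f j) at x
      rw [← DirectSum.sum_support_of x, map_sum]
      refine Submodule.sum_mem _ fun j _ => ?_
      rw [← DirectSum.lof_eq_of ℚ, DirectSum.toModule_lof]
      exact Hom.lin_mem _ (hx j))

lemma sumι_sumDesc {J : Type} (f : J → GrMod S) {N : GrMod S} (φ : ∀ j, f j ⟶ N) (j : J) :
    sumι f j ≫ sumDesc f φ = φ j := by
  classical
  ext x
  exact DirectSum.toModule_lof (M := fun j => (f j : Type)) ℚ (φ := fun j => Hom.lin (φ j)) j x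

lemma sum_hom_ext {J : Type} {f : J → GrMod S} {N : GrMod S} {g h : sum f ⟶ N}
    (H : ∀ j, sumι f j ≫ g = sumι f j ≫ h) : g = h := by
  classical
  refine Subtype.ext (DirectSum.linearMap_ext (M := fun j => (f j : Type)) ℚ fun j => ?_)
  exact LinearMap.ext fun x => congrArg (fun t => Hom.lin t x) (H j)

instance : HasCoproducts.{0} (GrMod S) := fun J => by
  have h (f : J → GrMod S) : HasCoproduct f :=
    ⟨⟨Cofan.mk (sum f) (sumι f), Cofan.IsColimit.mk _ (fun s => sumDesc f s.inj)
      (fun s j => sumι_sumDesc f s.inj j)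
      (fun s m hm => sum_hom_ext fun j => (hm j).trans (sumι_sumDesc f s.inj j).symm)⟩⟩
  exact ⟨fun F => hasColimit_of_iso Discrete.natIsoFunctor⟩

instance : HasZeroObject (GrMod S) := by
  refine ⟨sum (fun j : PEmpty => j.elim), ?_⟩
  rw [IsZero.iff_id_eq_zero]
  exact sum_hom_ext fun j => j.elim

instance : HasBinaryBiproducts (GrMod S) := HasBinaryBiproducts.of_hasBinaryCoproducts

/-- The functor taking a graded module to its homogeneous part of degree `j`. -/
def degreePart (S : Type) (j : ℤ) : GrMod S ⥤ ModuleCat.{0} ℚ where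
  obj M := ModuleCat.of ℚ (M.gr j)
  map f := ModuleCat.ofHom ((Hom.lin f).restrict fun _ hx => Hom.lin_mem f hx)

instance (j : ℤ) : (degreePart S j).Additive where
  map_add := by intros; rfl

/-! #### Quotients and subobjects -/

/-- The quotient of a graded module by a submodule spanned by homogeneous elements. -/
abbrev quot (M : GrMod S) (P : Submodule ℚ M)
    (hP : ∀ x ∈ P, ∀ i, M.comps x i ∈ P) (hact : ∀ s a, P ≤ P.comap (M.act s a)) : GrMod S where
  carrier := M ⧸ P
  act s := AlgHom.ofLinearMap
    { toFun := fun a => P.mapQ P (M.act s a) (hact s a)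
      map_add' := fun a b => by ext; simp
      map_smul' := fun c a => by ext; simp }
    (by ext; simp) (fun a b => by ext; simp)
  act_comm s t a b x := by
    induction x using Submodule.Quotient.induction_on with
    | H x => simp [M.act_comm s t a b]
  gr i := (M.gr i).map P.mkQ
  isInternal := by
    refine isInternal_of _ LinearMap.id Function.injective_id
      (P.liftQ (Finsupp.mapRange.linearMap P.mkQ ∘ₗ M.comps) fun x hx => ?_) ?_ ?_
    · ext i
      simpa using hP x hx i
    · rintro i _ ⟨x, hx, rfl⟩
      change Finsupp.mapRange.linearMap P.mkQ (M.comps x) = _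
      simp [M.comps_of_mem hx]
    · intro x
      induction x using Submodule.Quotient.induction_on with
      | H x =>
        induction x using M.hom_induction with
        | mem i x hx => exact Submodule.mem_iSup_of_mem i ⟨x, hx, rfl⟩
        | add x y hx hy => exact Submodule.add_mem _ hx hy
  act_mem := by
    rintro s i j a _ ha ⟨x, hx, rfl⟩
    exact ⟨M.act s a x, M.act_mem s ha hx, rfl⟩

/-- A submodule of a graded module spanned by homogeneous elements. -/
abbrev sub (M : GrMod S) (P : Submodule ℚ M)
    (hP : ∀ x ∈ P, ∀ i, M.comps x i ∈ P) (hact : ∀ s a, P ≤ P.comap (M.act s a)) : GrMod S where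
  carrier := P
  act s := AlgHom.ofLinearMap
    { toFun := fun a => (M.act s a).restrict (hact s a)
      map_add' := fun a b => by ext; simp
      map_smul' := fun c a => by ext; simp }
    (by ext; simp) (fun a b => by ext; simp)
  act_comm s t a b x := Subtype.ext (M.act_comm s t a b x)
  gr i := (M.gr i).comap P.subtype
  isInternal := by
    refine isInternal_of _ P.subtype P.subtype_injective (M.comps ∘ₗ P.subtype) ?_ ?_
    · intro i x hx
      simpa using M.comps_of_mem hx
    · intro x
      have : x = (M.comps x).sum fun i _ => (⟨M.comps x i, hP x x.2 i⟩ : P) := by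
        apply P.subtype_injective
        rw [Finsupp.sum, map_sum]
        exact (M.sum_comps x).symm
      rw [this]
      exact Submodule.sum_mem _ fun i _ => Submodule.mem_iSup_of_mem i (M.comps_mem x i)
  act_mem := fun s i j a x ha hx => M.act_mem s ha hx

end GrMod

/-! ### The bimodules `R` and `B₁` -/

lemma R.mem_deg (k : ℕ) : (X ^ k : R) ∈ R.deg (2 * k) := Submodule.subset_span ⟨k, rfl, rfl⟩

lemma R.X_mem_deg : (X : R) ∈ R.deg 2 := by simpa using R.mem_deg 1

lemma R.mul_mem_deg {i j : ℤ} {a b : R} (ha : a ∈ R.deg i) (hb : b ∈ R.deg j) :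
    a * b ∈ R.deg (i + j) := by
  have h := Submodule.mul_mem_mul ha hb
  rw [R.deg, R.deg, Submodule.span_mul_span] at h
  refine Submodule.span_mono ?_ h
  rintro _ ⟨_, ⟨k, hk, rfl⟩, _, ⟨l, hl, rfl⟩, rfl⟩
  exact ⟨k + l, by push_cast; omega, by simp [pow_add]⟩

/-- The decomposition of a polynomial into its homogeneous parts. -/
def R.comps : R →ₗ[ℚ] (ℤ →₀ R) :=
  Polynomial.lsum fun k => Finsupp.lsingle (2 * (k : ℤ)) ∘ₗ Polynomial.monomial k

lemma R.comps_of_mem {i : ℤ} {a : R} (ha : a ∈ R.deg i) : R.comps a = Finsupp.single i a := by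
  induction ha using Submodule.span_induction with
  | mem x h =>
    obtain ⟨k, rfl, rfl⟩ := h
    simp [R.comps, Polynomial.lsum_apply, ← Polynomial.monomial_one_right_eq_X_pow]
  | zero => simp
  | add x y _ _ hx hy => simp [hx, hy]
  | smul c x _ hx => simp [hx]

lemma R.mem_iSup_deg (a : R) : a ∈ ⨆ i, R.deg i := by
  induction a using Polynomial.induction_on' with
  | add p q hp hq => exact Submodule.add_mem _ hp hq
  | monomial n c =>
    refine Submodule.mem_iSup_of_mem (2 * n) ?_
    rw [← Polynomial.C_mul_X_pow_eq_monomial, ← Polynomial.smul_eq_C_mul]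
    exact Submodule.smul_mem _ _ (R.mem_deg n)

/-- `R` itself, every action being multiplication: the graded `R`-module `R` for `S = Unit`, the
graded `R`-bimodule `R` for `S = Side`. -/
abbrev ring (S : Type) : GrMod S where
  carrier := R
  act _ := Algebra.lmul ℚ R
  act_comm _ _ a b x := mul_left_comm a b x
  gr := R.deg
  isInternal := isInternal_of _ LinearMap.id Function.injective_id R.comps
    (fun _ _ hx => R.comps_of_mem hx) R.mem_iSup_deg
  act_mem _ _ _ _ _ ha hx := R.mul_mem_deg ha hx

/-- Multiplication by a homogeneous `f ∈ R`, as a degree-preserving map `R{s} ⟶ R{t}`. -/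
def mulR (S : Type) (f : R) {s t : ℤ} (hf : f ∈ R.deg (s - t)) :
    (ring S).shift s ⟶ (ring S).shift t :=
  GrMod.ofLin (M := (ring S).shift s) (N := (ring S).shift t) (LinearMap.mulLeft ℚ f)
    (fun _ a x => mul_left_comm f a x)
    (fun i x hx => by
      have := R.mul_mem_deg hf hx
      rwa [show s - t + (i - s) = i - t by ring] at this)

/-- The grading of a tensor product `M ⊗_A N` of graded spaces: the homogeneous part of degree `k`
is spanned by the `x ⊗ y` with `x`, `y` homogeneous of degrees adding up to `k`. -/
def tensorGr {A M N : Type} [CommRing A] [AddCommGroup M] [AddCommGroup N] [Module A M]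
    [Module A N] [Module ℚ M] [Module ℚ N] [SMulCommClass A ℚ M]
    (grM : ℤ → Submodule ℚ M) (grN : ℤ → Submodule ℚ N) (k : ℤ) : Submodule ℚ (M ⊗[A] N) :=
  Submodule.span ℚ {t | ∃ i j, i + j = k ∧ ∃ x ∈ grM i, ∃ y ∈ grN j, t = x ⊗ₜ[A] y}

/-- The family `tensorGr` is a grading if `A` is additively generated by elements that act
homogeneously. -/
lemma tensorGr_isInternal {A M N : Type} [CommRing A] [AddCommGroup M] [AddCommGroup N]
    [Module A M] [Module A N] [Module ℚ M] [Module ℚ N] [SMulCommClass A ℚ M]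
    (grM : ℤ → Submodule ℚ M) (grN : ℤ → Submodule ℚ N)
    (δM : M →ₗ[ℚ] (ℤ →₀ M)) (δN : N →ₗ[ℚ] (ℤ →₀ N))
    (hM : ∀ i, ∀ x ∈ grM i, δM x = Finsupp.single i x)
    (hN : ∀ i, ∀ x ∈ grN i, δN x = Finsupp.single i x)
    (topM : ∀ x, x ∈ ⨆ i, grM i) (topN : ∀ x, x ∈ ⨆ i, grN i)
    (hA : ∀ a : A, a ∈ AddSubmonoid.closure {a : A | ∃ k, (∀ i, ∀ x ∈ grM i, a • x ∈ grM (i + k)) ∧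
      (∀ i, ∀ x ∈ grN i, a • x ∈ grN (i + k))}) :
    DirectSum.IsInternal (tensorGr (A := A) grM grN) := by
  have sm : ∀ (c : ℚ) (x : M) (y : N), (c • x) ⊗ₜ[A] y = c • (x ⊗ₜ[A] y) := fun c x y =>
    map_rat_smul ((TensorProduct.mk A M N).flip y) c x
  have sm' : ∀ (c : ℚ) (x : M) (y : N), x ⊗ₜ[A] (c • y) = c • (x ⊗ₜ[A] y) := fun c x y =>
    map_rat_smul (TensorProduct.mk A M N x) c y
  let β : M →ₗ[ℚ] N →ₗ[ℚ] M ⊗[A] N := LinearMap.mk₂ ℚ (fun x y => x ⊗ₜ[A] y)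
    TensorProduct.add_tmul sm TensorProduct.tmul_add sm'
  let conv : (ℤ →₀ M) →ₗ[ℚ] (ℤ →₀ N) →ₗ[ℚ] (ℤ →₀ (M ⊗[A] N)) := Finsupp.lsum ℚ fun i =>
    (Finsupp.lsum ℚ fun j => (β.compr₂ (Finsupp.lsingle (i + j))).flip).flip
  have conv_single : ∀ i j x y, conv (Finsupp.single i x) (Finsupp.single j y) =
      Finsupp.single (i + j) (x ⊗ₜ[A] y) := by
    intro i j x y
    simp [conv, β]
  let D : M →ₗ[ℚ] N →ₗ[ℚ] (ℤ →₀ (M ⊗[A] N)) := conv.compl₁₂ δM δN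
  have D_mem : ∀ i j, ∀ x ∈ grM i, ∀ y ∈ grN j, D x y = Finsupp.single (i + j) (x ⊗ₜ[A] y) := by
    intro i j x hx y hy
    simp [D, hM i x hx, hN j y hy, conv_single]
  have bal : ∀ (a : A) (x : M) (y : N), D (a • x) y = D x (a • y) := by
    intro a x y
    induction hA a using AddSubmonoid.closure_induction with
    | mem a ha =>
      obtain ⟨k, h1, h2⟩ := ha
      refine Submodule.iSup_induction _ (motive := fun x => D (a • x) y = D x (a • y)) (topM x)
        (fun i x hx => ?_) (by simp) (fun x x' hx hx' => by simp [smul_add, hx, hx'])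
      refine Submodule.iSup_induction _ (motive := fun y => D (a • x) y = D x (a • y)) (topN y)
        (fun j y hy => ?_) (by simp) (fun x x' hx hx' => by simp [smul_add, hx, hx'])
      rw [D_mem _ _ _ (h1 i x hx) y hy, D_mem _ _ x hx _ (h2 j y hy), TensorProduct.smul_tmul]
      congr 1
      ring
    | zero => simp
    | add a b _ _ ha hb => simp [add_smul, ha, hb]
  let δ : M ⊗[A] N →ₗ[ℚ] (ℤ →₀ (M ⊗[A] N)) :=
    (TensorProduct.liftAddHom (LinearMap.toAddMonoidHom'.comp D.toAddMonoidHom)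
      bal).toRatLinearMap
  refine isInternal_of _ LinearMap.id Function.injective_id δ ?_ ?_
  · intro k x hx
    induction hx using Submodule.span_induction with
    | mem x h =>
      obtain ⟨i, j, rfl, x, hx, y, hy, rfl⟩ := h
      exact D_mem i j x hx y hy
    | zero => simp
    | add x y _ _ hx hy => rw [map_add, hx, hy, ← Finsupp.single_add, map_add]
    | smul c x _ hx => rw [map_smul, hx, Finsupp.smul_single, map_smul]
  · intro t
    induction t using TensorProduct.induction_on with
    | zero => exact Submodule.zero_mem _
    | add x y hx hy => exact Submodule.add_mem _ hx hy
    | tmul x y =>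
      refine Submodule.iSup_induction _ (motive := fun x => x ⊗ₜ[A] y ∈ ⨆ i, tensorGr grM grN i)
        (topM x) (fun i x hx => ?_) (by simp)
        (fun x x' hx hx' => by rw [TensorProduct.add_tmul]; exact Submodule.add_mem _ hx hx')
      refine Submodule.iSup_induction _ (motive := fun y => x ⊗ₜ[A] y ∈ ⨆ i, tensorGr grM grN i)
        (topN y) (fun j y hy => ?_) (by simp)
        (fun x x' hx hx' => by rw [TensorProduct.tmul_add]; exact Submodule.add_mem _ hx hx')
      exact Submodule.mem_iSup_of_mem (i + j) (Submodule.subset_span ⟨i, j, rfl, x, hx, y, hy, rfl⟩)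

lemma tmul_mem_tensorGr {A M N : Type} [CommRing A] [AddCommGroup M] [AddCommGroup N]
    [Module A M] [Module A N] [Module ℚ M] [Module ℚ N] [SMulCommClass A ℚ M]
    {grM : ℤ → Submodule ℚ M} {grN : ℤ → Submodule ℚ N} {i j : ℤ} {x : M} {y : N}
    (hx : x ∈ grM i) (hy : y ∈ grN j) : x ⊗ₜ[A] y ∈ tensorGr (A := A) grM grN (i + j) :=
  Submodule.subset_span ⟨i, j, rfl, x, hx, y, hy, rfl⟩

/-- The subring `R₁ = ℚ[y²]` of `R`. -/
abbrev R₁ : Subalgebra ℚ R := Algebra.adjoin ℚ {X ^ 2}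

/-- The ring `R ⊗_{R₁} R` underlying the bimodule `B₁`. -/
def BRing : Type := R ⊗[R₁] R

instance : CommRing BRing := inferInstanceAs (CommRing (R ⊗[R₁] R))
instance : Algebra ℚ BRing := inferInstanceAs (Algebra ℚ (R ⊗[R₁] R))

/-- The element `a ⊗ b` of `R ⊗_{R₁} R`. -/
def BRing.tmul (a b : R) : BRing := a ⊗ₜ[R₁] b

lemma BRing.tmul_mul_tmul (a b c d : R) :
    BRing.tmul a b * BRing.tmul c d = BRing.tmul (a * c) (b * d) :=
  Algebra.TensorProduct.tmul_mul_tmul a c b d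

/-- The ring homomorphism `a ↦ a ⊗ 1`. -/
def BRing.inl : R →ₐ[ℚ] BRing := (Algebra.TensorProduct.includeLeft : R →ₐ[ℚ] R ⊗[R₁] R)

/-- The ring homomorphism `a ↦ 1 ⊗ a`. -/
def BRing.inr : R →ₐ[ℚ] BRing :=
  (Algebra.TensorProduct.includeRight : R →ₐ[R₁] R ⊗[R₁] R).restrictScalars ℚ

lemma BRing.inl_apply (a : R) : BRing.inl a = BRing.tmul a 1 := rfl
lemma BRing.inr_apply (a : R) : BRing.inr a = BRing.tmul 1 a := rfl

/-- The grading of `R ⊗_{R₁} R`: the homogeneous part of degree `k` is spanned by the `x ⊗ y` with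
`x`, `y` homogeneous of degrees adding up to `k`. -/
def BRing.gr (k : ℤ) : Submodule ℚ BRing :=
  Submodule.span ℚ {t | ∃ i j, i + j = k ∧ ∃ x ∈ R.deg i, ∃ y ∈ R.deg j, t = BRing.tmul x y}

lemma BRing.gr_isInternal : DirectSum.IsInternal BRing.gr := by
  change DirectSum.IsInternal (tensorGr (A := R₁) R.deg R.deg)
  refine tensorGr_isInternal R.deg R.deg R.comps R.comps (fun _ _ h => R.comps_of_mem h)
    (fun _ _ h => R.comps_of_mem h) R.mem_iSup_deg R.mem_iSup_deg ?_
  rintro ⟨a, ha⟩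
  have key : ∀ (c : ℚ) (k : ℕ), (⟨c • (X ^ 2) ^ k, R₁.smul_mem (R₁.pow_mem
      (Algebra.subset_adjoin rfl) k) c⟩ : R₁) ∈ {a : R₁ | ∃ k : ℤ,
        (∀ i, ∀ x ∈ R.deg i, a • x ∈ R.deg (i + k)) ∧
        (∀ i, ∀ x ∈ R.deg i, a • x ∈ R.deg (i + k))} := by
    intro c k
    have h : ∀ i, ∀ x ∈ R.deg i, (c • (X ^ 2 : R) ^ k) * x ∈ R.deg (i + 2 * ((2 * k : ℕ) : ℤ)) := by
      intro i x hx
      rw [add_comm, ← pow_mul]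
      exact R.mul_mem_deg (Submodule.smul_mem _ _ (R.mem_deg _)) hx
    exact ⟨_, h, h⟩
  obtain ⟨p, hp⟩ : a ∈ (Polynomial.aeval (R := ℚ) (X ^ 2 : R)).range := by
    rw [← Algebra.adjoin_singleton_eq_range_aeval]; exact ha
  have hs : a = ∑ k ∈ Finset.range (p.natDegree + 1), p.coeff k • (X ^ 2 : R) ^ k := by
    rw [← hp]
    exact Polynomial.aeval_eq_sum_range (p := p) (X ^ 2 : R)
  have : (⟨a, ha⟩ : R₁) = ∑ k ∈ Finset.range (p.natDegree + 1), (⟨p.coeff k • (X ^ 2) ^ k, R₁.smul_mem (R₁.pow_mem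
      (Algebra.subset_adjoin rfl) k) _⟩ : R₁) := by
    apply Subtype.ext
    simpa using hs
  rw [this]
  exact AddSubmonoid.sum_mem _ fun k _ => AddSubmonoid.subset_closure (key _ _)

lemma BRing.mul_mem_gr {i j : ℤ} {a b : BRing} (ha : a ∈ BRing.gr i) (hb : b ∈ BRing.gr j) :
    a * b ∈ BRing.gr (i + j) := by
  have h := Submodule.mul_mem_mul ha hb
  rw [BRing.gr, BRing.gr, Submodule.span_mul_span] at h
  refine Submodule.span_mono ?_ h
  rintro _ ⟨_, ⟨i₁, i₂, rfl, x, hx, y, hy, rfl⟩, _, ⟨j₁, j₂, rfl, x', hx', y', hy', rfl⟩, rfl⟩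
  exact ⟨i₁ + j₁, i₂ + j₂, by ring, x * x', R.mul_mem_deg hx hx', y * y', R.mul_mem_deg hy hy',
    BRing.tmul_mul_tmul _ _ _ _⟩

/-- The left and right actions of `R` on `R ⊗_{R₁} R`, `a · t = (a ⊗ 1) t` and
`t · a = (1 ⊗ a) t`. -/
def BRing.act : Side → R →ₐ[ℚ] Module.End ℚ BRing
  | .left => (Algebra.lmul ℚ BRing).comp BRing.inl
  | .right => (Algebra.lmul ℚ BRing).comp BRing.inr

@[simp] lemma BRing.act_left (a : R) (t : BRing) : BRing.act .left a t = BRing.inl a * t := rfl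

@[simp] lemma BRing.act_right (a : R) (t : BRing) : BRing.act .right a t = BRing.inr a * t := rfl

lemma R.one_mem_deg : (1 : R) ∈ R.deg 0 := by simpa using R.mem_deg 0

lemma BRing.inl_mem {i : ℤ} {a : R} (ha : a ∈ R.deg i) : BRing.inl a ∈ BRing.gr i :=
  Submodule.subset_span ⟨i, 0, add_zero i, a, ha, 1, R.one_mem_deg, rfl⟩

lemma BRing.inr_mem {i : ℤ} {a : R} (ha : a ∈ R.deg i) : BRing.inr a ∈ BRing.gr i :=
  Submodule.subset_span ⟨0, i, zero_add i, 1, R.one_mem_deg, a, ha, rfl⟩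

/-- The graded `R`-bimodule `B₁ = R ⊗_{R₁} R`. -/
abbrev B : Bimod where
  carrier := BRing
  act := BRing.act
  act_comm s t a b x := by cases s <;> cases t <;> simp [mul_left_comm]
  gr := BRing.gr
  isInternal := BRing.gr_isInternal
  act_mem s _ _ _ _ ha hx := by
    cases s
    · exact BRing.mul_mem_gr (BRing.inl_mem ha) hx
    · exact BRing.mul_mem_gr (BRing.inr_mem ha) hx

/-- Multiplication by a homogeneous `b ∈ R ⊗_{R₁} R`, the map `B{s} ⟶ B{t}` of graded bimodules
with `1 ⊗ 1 ↦ b`. -/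
def mulB (b : BRing) {s t : ℤ} (hb : b ∈ BRing.gr (s - t)) : B.shift s ⟶ B.shift t :=
  GrMod.ofLin (M := B.shift s) (N := B.shift t) (LinearMap.mulLeft ℚ b)
    (fun s a x => by cases s <;> simp [mul_left_comm])
    (fun i x hx => by
      have := BRing.mul_mem_gr hb hx
      rwa [show s - t + (i - s) = i - t by ring] at this)

/-- The element `1 ⊗ y + y ⊗ 1`. -/
def yPlus : BRing := BRing.tmul 1 X + BRing.tmul X 1

/-- The element `1 ⊗ y - y ⊗ 1`. -/
def yMinus : BRing := BRing.tmul 1 X - BRing.tmul X 1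

lemma yPlus_mem : yPlus ∈ BRing.gr 2 :=
  Submodule.add_mem _ (BRing.inr_mem R.X_mem_deg) (BRing.inl_mem R.X_mem_deg)

lemma yMinus_mem : yMinus ∈ BRing.gr 2 :=
  Submodule.sub_mem _ (BRing.inr_mem R.X_mem_deg) (BRing.inl_mem R.X_mem_deg)

lemma BRing.inl_X_sq : BRing.inl (X ^ 2) = BRing.inr (X ^ 2) := by
  have h := TensorProduct.smul_tmul (R := R₁) (⟨X ^ 2, Algebra.subset_adjoin rfl⟩ : R₁)
    (1 : R) (1 : R)
  have e : (⟨X ^ 2, Algebra.subset_adjoin rfl⟩ : R₁) • (1 : R) = X ^ 2 := mul_one (X ^ 2)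
  rwa [e] at h

/-- The two actions of `R` agree on `1 ⊗ y + y ⊗ 1`. -/
lemma yPlus_comm (a : R) : BRing.inl a * yPlus = BRing.inr a * yPlus := by
  have hX : BRing.inl X * yPlus = BRing.inr X * yPlus := by
    have h := BRing.inl_X_sq
    rw [map_pow, map_pow] at h
    have e : yPlus = BRing.inr X + BRing.inl X := rfl
    rw [e]
    linear_combination h
  induction a using Polynomial.induction_on' with
  | add p q hp hq => rw [map_add, map_add, add_mul, add_mul, hp, hq]
  | monomial n c =>
    have hn : BRing.inl (X ^ n) * yPlus = BRing.inr (X ^ n) * yPlus := by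
      induction n with
      | zero => simp
      | succ n ih =>
        rw [pow_succ, map_mul, map_mul, mul_right_comm, ih, mul_right_comm, mul_assoc, hX]
        ring
    rw [← Polynomial.C_mul_X_pow_eq_monomial, ← Polynomial.smul_eq_C_mul, map_smul, map_smul,
      smul_mul_assoc, smul_mul_assoc, hn]

/-- The map `R{s} ⟶ B{t}` of graded bimodules with `1 ↦ 1 ⊗ y + y ⊗ 1`, where `s = t + 2`. -/
def rb {s t : ℤ} (h : s - t = 2) : (ring Side).shift s ⟶ B.shift t :=
  GrMod.ofLin (M := (ring Side).shift s) (N := B.shift t)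
    (LinearMap.mulRight ℚ yPlus ∘ₗ BRing.inl.toLinearMap)
    (fun s a x => by
      change BRing.inl (a * x) * yPlus = BRing.act s a (BRing.inl x * yPlus)
      rw [map_mul]
      cases s
      · rw [mul_assoc]; rfl
      · rw [BRing.act_right, mul_right_comm, yPlus_comm]; ring)
    (fun i x hx => by
      have := BRing.mul_mem_gr (BRing.inl_mem hx) yPlus_mem
      rwa [show i - s + 2 = i - t by omega] at this)

/-! ### Tensor product over `R` of graded bimodules -/

namespace GrMod

/-- The underlying space of `M`, as an `R`-module through the action `s`. -/
def As {S : Type} (M : GrMod S) (_s : S) : Type := M.carrier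

section

variable {S : Type} (M N : GrMod S) (s : S)

instance : AddCommGroup (M.As s) := M.addCommGroup
instance : Module ℚ (M.As s) := M.module
instance : Module R (M.As s) := Module.compHom M.carrier (M.act s).toRingHom

lemma smul_as (a : R) (x : M.As s) : a • x = M.act s a x := rfl

instance : IsScalarTower ℚ R (M.As s) where
  smul_assoc c a x := by
    rw [smul_as, smul_as, map_smul]; rfl

variable {M N} in
/-- A morphism, as an `R`-linear map for the action `s`. -/
def Hom.as (f : M ⟶ N) : M.As s →ₗ[R] N.As s where
  toFun := Hom.lin f
  map_add' := map_add (Hom.lin f)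
  map_smul' a x := Hom.lin_act f s a x

/-- The action `t` of an element of `R`, as an `R`-linear map for the action `s`. -/
def actAs (t : S) (a : R) : M.As s →ₗ[R] M.As s where
  toFun := M.act t a
  map_add' := map_add (M.act t a)
  map_smul' b x := M.act_comm t s a b x

end

/-- The vector space `M ⊗_R N`: the right action on `M` is matched with the left action on `N`. -/
abbrev TensorCarrier (M N : Bimod) : Type := M.As .right ⊗[R] N.As .left

/-- The left action of `R` on `M` and the right action of `R` on `N` make `M ⊗_R N` a bimodule. -/
def tensorAct (M N : Bimod) : Side → R → TensorCarrier M N →ₗ[R] TensorCarrier M N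
  | .left, a => (M.actAs .right .left a).rTensor (N.As .left)
  | .right, a => (N.actAs .left .right a).lTensor (M.As .right)

lemma tensorAct_left (M N : Bimod) (a : R) (x : M.As .right) (y : N.As .left) :
    tensorAct M N .left a (x ⊗ₜ y) = (M.actAs .right .left a x) ⊗ₜ y := rfl

lemma tensorAct_right (M N : Bimod) (a : R) (x : M.As .right) (y : N.As .left) :
    tensorAct M N .right a (x ⊗ₜ y) = x ⊗ₜ (N.actAs .left .right a y) := rfl

lemma actAs_add {S : Type} (M : GrMod S) (s t : S) (a b : R) (x : M.As s) :
    M.actAs s t (a + b) x = M.actAs s t a x + M.actAs s t b x :=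
  congrArg (fun f => f x) (map_add (M.act t) a b)

lemma actAs_mul {S : Type} (M : GrMod S) (s t : S) (a b : R) (x : M.As s) :
    M.actAs s t (a * b) x = M.actAs s t a (M.actAs s t b x) :=
  congrArg (fun f => f x) (map_mul (M.act t) a b)

lemma actAs_one {S : Type} (M : GrMod S) (s t : S) (x : M.As s) : M.actAs s t 1 x = x :=
  congrArg (fun f => f x) (map_one (M.act t))

lemma actAs_smul {S : Type} (M : GrMod S) (s t : S) (c : ℚ) (a : R) (x : M.As s) :
    M.actAs s t (c • a) x = c • M.actAs s t a x :=
  congrArg (fun f => f x) (map_smul (M.act t) c a)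

lemma tensorAct_add (M N : Bimod) (s : Side) (a b : R) :
    tensorAct M N s (a + b) = tensorAct M N s a + tensorAct M N s b := by
  refine TensorProduct.ext' fun x y => ?_
  cases s
  · simp only [LinearMap.add_apply, tensorAct_left, actAs_add, TensorProduct.add_tmul]
  · simp only [LinearMap.add_apply, tensorAct_right, actAs_add, TensorProduct.tmul_add]

lemma tensorAct_mul (M N : Bimod) (s : Side) (a b : R) :
    tensorAct M N s (a * b) = tensorAct M N s a ∘ₗ tensorAct M N s b := by
  refine TensorProduct.ext' fun x y => ?_
  cases s
  · simp only [LinearMap.comp_apply, tensorAct_left, actAs_mul]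
  · simp only [LinearMap.comp_apply, tensorAct_right, actAs_mul]

lemma tensorAct_one (M N : Bimod) (s : Side) : tensorAct M N s 1 = LinearMap.id := by
  refine TensorProduct.ext' fun x y => ?_
  cases s
  · simp only [LinearMap.id_apply, tensorAct_left, actAs_one]
  · simp only [LinearMap.id_apply, tensorAct_right, actAs_one]

lemma tensorAct_comm (M N : Bimod) (s t : Side) (a b : R) :
    tensorAct M N s a ∘ₗ tensorAct M N t b = tensorAct M N t b ∘ₗ tensorAct M N s a := by
  cases s <;> cases t
  · rw [← tensorAct_mul, ← tensorAct_mul, mul_comm]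
  · exact TensorProduct.ext' fun x y => rfl
  · exact TensorProduct.ext' fun x y => rfl
  · rw [← tensorAct_mul, ← tensorAct_mul, mul_comm]

lemma tensor_isInternal (M N : Bimod) : DirectSum.IsInternal
    (tensorGr (A := R) (M := M.As .right) (N := N.As .left) M.gr N.gr) := by
  refine tensorGr_isInternal (A := R) (M := M.As .right) (N := N.As .left) M.gr N.gr
    M.comps N.comps (fun _ _ h => M.comps_of_mem h) (fun _ _ h => N.comps_of_mem h) ?_ ?_ ?_
  · exact fun x => M.isInternal.submodule_iSup_eq_top.ge (Submodule.mem_top (x := x))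
  · exact fun x => N.isInternal.submodule_iSup_eq_top.ge (Submodule.mem_top (x := x))
  · intro a
    induction a using Polynomial.induction_on' with
    | add p q hp hq => exact AddSubmonoid.add_mem _ hp hq
    | monomial n c =>
      have h : Polynomial.monomial n c ∈ R.deg (2 * n) := by
        rw [← Polynomial.C_mul_X_pow_eq_monomial, ← Polynomial.smul_eq_C_mul]
        exact Submodule.smul_mem _ _ (R.mem_deg n)
      refine AddSubmonoid.subset_closure ⟨2 * n, fun i x hx => ?_, fun i x hx => ?_⟩
      · rw [add_comm]; exact M.act_mem _ h hx
      · rw [add_comm]; exact N.act_mem _ h hx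

/-- The tensor product `M ⊗_R N` of graded bimodules. -/
abbrev tensor (M N : Bimod) : Bimod where
  carrier := TensorCarrier M N
  act s := AlgHom.ofLinearMap
    (AddMonoidHom.toRatLinearMap
      { toFun := fun a => (tensorAct M N s a).restrictScalars ℚ
        map_zero' := by
          have h := tensorAct_add M N s 0 0
          rw [add_zero, left_eq_add] at h
          rw [h]; rfl
        map_add' := fun a b => by rw [tensorAct_add]; rfl })
    (congrArg (LinearMap.restrictScalars ℚ) (tensorAct_one M N s))
    (fun a b => congrArg (LinearMap.restrictScalars ℚ) (tensorAct_mul M N s a b))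
  act_comm s t a b x := congrArg (fun f => f x) (tensorAct_comm M N s t a b)
  gr := tensorGr (A := R) (M := M.As .right) (N := N.As .left) M.gr N.gr
  isInternal := tensor_isInternal M N
  act_mem := fun s i j a x ha hx => by
    change tensorAct M N s a x ∈ _
    induction hx using Submodule.span_induction with
    | mem x h =>
      obtain ⟨k, l, rfl, x, hx, y, hy, rfl⟩ := h
      cases s
      · exact Submodule.subset_span ⟨i + k, l, by ring, _, M.act_mem .left ha hx, y, hy, rfl⟩
      · exact Submodule.subset_span ⟨k, i + l, by ring, x, hx, _, N.act_mem .right ha hy, rfl⟩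
    | zero => rw [map_zero]; exact Submodule.zero_mem _
    | add x y _ _ hx hy => rw [map_add]; exact Submodule.add_mem _ hx hy
    | smul c x _ hx =>
      have := Submodule.smul_mem _ c hx
      rwa [← map_rat_smul (tensorAct M N s a)] at this

/-- The tensor product of two morphisms of graded bimodules. -/
def tensorMap {M M' N N' : Bimod} (f : M ⟶ M') (g : N ⟶ N') : tensor M N ⟶ tensor M' N' :=
  ofLin (M := tensor M N) (N := tensor M' N')
    ((TensorProduct.map (Hom.as .right f) (Hom.as .left g)).restrictScalars ℚ)
    (fun s a x => by
      change (TensorProduct.map (Hom.as .right f) (Hom.as .left g) ∘ₗ tensorAct M N s a) x =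
        (tensorAct M' N' s a ∘ₗ TensorProduct.map (Hom.as .right f) (Hom.as .left g)) x
      congr 1
      refine TensorProduct.ext' fun x y => ?_
      cases s
      · exact congrArg (fun t => t ⊗ₜ[R] Hom.as .left g y) (Hom.lin_act f .left a x)
      · exact congrArg (fun t => Hom.as .right f x ⊗ₜ[R] t) (Hom.lin_act g .right a y))
    (fun i x hx => by
      change TensorProduct.map (Hom.as .right f) (Hom.as .left g) x ∈ _
      induction hx using Submodule.span_induction with
      | mem x h =>
        obtain ⟨k, l, rfl, x, hx, y, hy, rfl⟩ := h
        exact Submodule.subset_span ⟨k, l, rfl, _, Hom.lin_mem f hx, _, Hom.lin_mem g hy, rfl⟩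
      | zero => rw [map_zero]; exact Submodule.zero_mem _
      | add x y _ _ hx hy => rw [map_add]; exact Submodule.add_mem _ hx hy
      | smul c x _ hx =>
        have := Submodule.smul_mem _ c hx
        rwa [← map_rat_smul (TensorProduct.map (Hom.as .right f) (Hom.as .left g))] at this)

lemma tensor_hom_ext {M N P : Bimod} {f g : tensor M N ⟶ P}
    (h : ∀ (x : M.As .right) (y : N.As .left), Hom.lin f (x ⊗ₜ[R] y) = Hom.lin g (x ⊗ₜ[R] y)) :
    f = g := by
  ext t
  change TensorCarrier M N at t
  induction t using TensorProduct.induction_on with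
  | zero => exact (map_zero (Hom.lin f)).trans (map_zero (Hom.lin g)).symm
  | tmul x y => exact h x y
  | add x y hx hy =>
    exact (map_add (Hom.lin f) x y).trans ((congrArg₂ (· + ·) hx hy).trans
      (map_add (Hom.lin g) x y).symm)

/-- The bifunctor `(M, N) ↦ M ⊗_R N`. -/
def tensorFunctor : Bimod ⥤ Bimod ⥤ Bimod where
  obj M :=
    { obj := fun N => tensor M N
      map := fun g => tensorMap (𝟙 M) g
      map_id := fun N => tensor_hom_ext fun _ _ => rfl
      map_comp := fun _ _ => tensor_hom_ext fun _ _ => rfl }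
  map f :=
    { app := fun N => tensorMap f (𝟙 N)
      naturality := fun _ _ _ => tensor_hom_ext fun _ _ => rfl }
  map_id M := by ext N : 2; exact tensor_hom_ext fun _ _ => rfl
  map_comp f g := by ext N : 2; exact tensor_hom_ext fun _ _ => rfl

instance : tensorFunctor.Additive where
  map_add {_ _ f g} := by
    ext N : 2
    exact tensor_hom_ext fun x y => TensorProduct.add_tmul (Hom.as .right f x) (Hom.as .right g x) y

instance (M : Bimod) : (tensorFunctor.obj M).Additive where
  map_add {_ _ f g} :=
    tensor_hom_ext fun x y => TensorProduct.tmul_add x (Hom.as .left f y) (Hom.as .left g y)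

/-! ### Hochschild homology over `R` -/

/-- A bimodule, regarded as a module through its left action. -/
abbrev leftModule (M : Bimod) : GrModule where
  carrier := M
  act _ := M.act .left
  act_comm _ _ := M.act_comm .left .left
  gr := M.gr
  isInternal := M.isInternal
  act_mem _ _ _ _ _ ha hx := M.act_mem .left ha hx

/-- The Koszul complex of `R ⊗_ℚ R`-modules
`0 ⟶ R ⊗ R ⟶ R ⊗ R ⟶ R ⟶ 0`, given by `y ⊗ 1 - 1 ⊗ y` and the multiplication, is exact. Being a
free resolution of the bimodule `R`, it computes `HH_i(R, M) = Tor_i(R, M)`. -/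
lemma koszul_resolution :
    Function.Injective (fun t : R ⊗[ℚ] R => (X ⊗ₜ 1 - 1 ⊗ₜ X) * t) ∧
    (∀ t : R ⊗[ℚ] R, Algebra.TensorProduct.lmul' ℚ t = 0 ↔ ∃ u, t = (X ⊗ₜ 1 - 1 ⊗ₜ X) * u) ∧
    Function.Surjective (Algebra.TensorProduct.lmul' ℚ : R ⊗[ℚ] R →ₐ[ℚ] R) := by
  refine ⟨?_, fun t => ⟨fun ht => ?_, ?_⟩, fun a => ⟨a ⊗ₜ 1, by simp⟩⟩
  · have e : (X ⊗ₜ 1 - 1 ⊗ₜ X : R ⊗[ℚ] R) = -polyEquivTensor ℚ R (X - C X) := by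
      rw [map_sub, polyEquivTensor_apply, polyEquivTensor_apply]; simp
    intro t u h
    replace h : (X ⊗ₜ 1 - 1 ⊗ₜ X : R ⊗[ℚ] R) * t = (X ⊗ₜ 1 - 1 ⊗ₜ X) * u := h
    have h' : polyEquivTensor ℚ R (X - C X) * t = polyEquivTensor ℚ R (X - C X) * u := by
      linear_combination (t - u) * e - h
    have h'' := congrArg (polyEquivTensor ℚ R).symm h'
    rw [map_mul, map_mul, AlgEquiv.symm_apply_apply] at h''
    exact (polyEquivTensor ℚ R).symm.injective
      ((Polynomial.monic_X_sub_C (X : R)).isRegular.left h'')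
  · have hd : ∀ a : R, (X ⊗ₜ 1 - 1 ⊗ₜ X : R ⊗[ℚ] R) ∣ a ⊗ₜ 1 - 1 ⊗ₜ a := by
      intro a
      induction a using Polynomial.induction_on' with
      | add p q hp hq =>
        rw [TensorProduct.add_tmul, TensorProduct.tmul_add, add_sub_add_comm]
        exact dvd_add hp hq
      | monomial n c =>
        have h := sub_dvd_pow_sub_pow (X ⊗ₜ 1 : R ⊗[ℚ] R) (1 ⊗ₜ X) n
        rw [Algebra.TensorProduct.tmul_pow, Algebra.TensorProduct.tmul_pow, one_pow] at h
        have e : ((c • X ^ n : R) ⊗ₜ[ℚ] (1 : R) - 1 ⊗ₜ[ℚ] (c • X ^ n)) =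
            c • ((X ^ n) ⊗ₜ 1 - 1 ⊗ₜ (X ^ n)) := by
          rw [TensorProduct.tmul_smul, ← TensorProduct.smul_tmul']
          exact (smul_sub c ((X ^ n : R) ⊗ₜ[ℚ] (1 : R)) (1 ⊗ₜ (X ^ n))).symm
        obtain ⟨v, hv⟩ := h
        rw [← Polynomial.C_mul_X_pow_eq_monomial, ← Polynomial.smul_eq_C_mul, e, hv]
        exact ⟨c • v, (mul_smul_comm _ _ _).symm⟩
    have hs : ∀ t : R ⊗[ℚ] R, (X ⊗ₜ 1 - 1 ⊗ₜ X : R ⊗[ℚ] R) ∣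
        t - (Algebra.TensorProduct.lmul' ℚ t) ⊗ₜ 1 := by
      intro t
      induction t using TensorProduct.induction_on with
      | zero => simp
      | tmul a b =>
        have : a ⊗ₜ b - (Algebra.TensorProduct.lmul' ℚ (a ⊗ₜ[ℚ] b)) ⊗ₜ 1 =
            -((a ⊗ₜ 1 : R ⊗[ℚ] R) * (b ⊗ₜ 1 - 1 ⊗ₜ b)) := by
          simp [mul_sub]
        rw [this]
        exact (dvd_mul_of_dvd_right (hd b) _).neg_right
      | add x y hx hy =>
        have h : x + y - (Algebra.TensorProduct.lmul' ℚ (x + y)) ⊗ₜ 1 =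
            (x - (Algebra.TensorProduct.lmul' ℚ x) ⊗ₜ 1) +
              (y - (Algebra.TensorProduct.lmul' ℚ y) ⊗ₜ 1) := by
          rw [map_add, TensorProduct.add_tmul, add_sub_add_comm]
        rw [h]
        exact dvd_add hx hy
    have h := hs t
    rw [ht, TensorProduct.zero_tmul, sub_zero] at h
    exact h
  · rintro ⟨u, rfl⟩
    simp

/-- The differential `m ↦ y m - m y` of the Koszul complex `C₁(M) = M{2} ⟶ C₀(M) = M`. -/
def koszul (M : Bimod) : M →ₗ[ℚ] M := M.act .left X - M.act .right X

lemma koszul_act (M : Bimod) (s : Side) (a : R) (x : M) :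
    koszul M (M.act s a x) = M.act s a (koszul M x) := by
  simp [koszul, M.act_comm _ s X a]

lemma koszul_mem (M : Bimod) {i : ℤ} {x : M} (hx : x ∈ M.gr i) : koszul M x ∈ M.gr (2 + i) :=
  Submodule.sub_mem _ (M.act_mem .left R.X_mem_deg hx) (M.act_mem .right R.X_mem_deg hx)

lemma koszul_comps (M : Bimod) (x : M) (i : ℤ) :
    M.comps (koszul M x) (2 + i) = koszul M (M.comps x i) := by
  induction x using M.hom_induction with
  | mem j x hx =>
    rw [M.comps_of_mem hx, M.comps_of_mem (koszul_mem M hx)]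
    by_cases h : j = i
    · subst h; simp
    · simp [h]
  | add x y hx hy => simp [hx, hy]

lemma koszul_hom {M N : Bimod} (f : M ⟶ N) (x : M) :
    Hom.lin f (koszul M x) = koszul N (Hom.lin f x) := by
  simp [koszul, Hom.lin_act]

/-- `HH₀(R, M)`, the cokernel of the Koszul differential. -/
abbrev hh₀ (M : Bimod) : GrModule :=
  quot (leftModule M) (LinearMap.range (koszul M))
    (by
      rintro _ ⟨x, rfl⟩ i
      refine ⟨M.comps x (i - 2), ?_⟩
      rw [← koszul_comps, add_sub_cancel]; rfl)
    (by
      rintro _ a _ ⟨x, rfl⟩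
      exact ⟨M.act .left a x, koszul_act M _ a x⟩)

/-- `HH₁(R, M)`, the kernel of the Koszul differential, in the grading of `C₁(M) = M{2}`. -/
abbrev hh₁ (M : Bimod) : GrModule :=
  (sub (leftModule M) (LinearMap.ker (koszul M))
    (by
      intro x hx i
      rw [LinearMap.mem_ker] at hx ⊢
      change koszul M (M.comps x i) = 0
      rw [← koszul_comps, hx]; simp)
    (by
      intro _ a x hx
      rw [LinearMap.mem_ker] at hx
      rw [Submodule.mem_comap, LinearMap.mem_ker, koszul_act, hx, map_zero])).shift 2

/-- The functor `HH₀(R, -)`. -/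
def HH₀ : Bimod ⥤ GrModule where
  obj := hh₀
  map {M N} f := ofLin (M := hh₀ M) (N := hh₀ N)
    (Submodule.mapQ _ _ (Hom.lin (M := M) (N := N) f) (by
      rintro _ ⟨x, rfl⟩
      exact ⟨Hom.lin f x, (koszul_hom f x).symm⟩))
    (fun s a x => by
      induction x using Submodule.Quotient.induction_on with
      | H x => exact congrArg Submodule.Quotient.mk (Hom.lin_act f .left a x))
    (by
      rintro i _ ⟨x, hx, rfl⟩
      exact ⟨Hom.lin f x, Hom.lin_mem f hx, rfl⟩)
  map_id M := by
    ext x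
    induction x using Submodule.Quotient.induction_on with
    | H x => rfl
  map_comp f g := by
    ext x
    induction x using Submodule.Quotient.induction_on with
    | H x => rfl

/-- The functor `HH₁(R, -)`. -/
def HH₁ : Bimod ⥤ GrModule where
  obj := hh₁
  map {M N} f := ofLin (M := hh₁ M) (N := hh₁ N)
    ((Hom.lin f).restrict (p := LinearMap.ker (koszul M)) (q := LinearMap.ker (koszul N))
      fun x hx => by
        rw [LinearMap.mem_ker] at hx ⊢
        rw [← koszul_hom, hx, map_zero])
    (fun s a x => Subtype.ext (Hom.lin_act f .left a x.1))
    (fun i x hx => Hom.lin_mem (i := i - 2) f hx)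
  map_id M := rfl
  map_comp f g := rfl

open ZeroObject in
/-- The functors `HH_i(R, -)` from graded bimodules to graded `R`-modules: the homology of the
Koszul complex `0 ⟶ M{2} ⟶ M ⟶ 0`. -/
def HH : ℕ → Bimod ⥤ GrModule
  | 0 => HH₀
  | 1 => HH₁
  | _ + 2 => (Functor.const _).obj 0

instance : HH₀.Additive where
  map_add {M N f g} := by
    ext x
    change M ⧸ LinearMap.range (koszul M) at x
    induction x using Submodule.Quotient.induction_on with
    | H x => rfl

instance : HH₁.Additive where
  map_add := rfl

instance (i : ℕ) : (HH i).Additive where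
  map_add {M N f g} := by
    match i with
    | 0 => exact HH₀.map_add
    | 1 => exact HH₁.map_add
    | _ + 2 => exact (isZero_zero _).eq_of_src _ _

end GrMod

/-! ### The Rouquier complex of `σ₁ⁿ` and its triply graded homology -/

open GrMod

/-- The complex `F(σ₁) : 0 ⟶ R{2} ⟶ B₁ ⟶ 0`, with `B₁` in cohomological degree `0`. -/
def rouquierGen : CochainComplex Bimod ℤ :=
  HomologicalComplex.double (c := ComplexShape.up ℤ) (i₀ := -1) (i₁ := 0)
    (rb (s := 2) (t := 0) rfl) (by simp)

/-- The Rouquier complex `F(σ₁ⁿ) = F(σ₁) ⊗_R ⋯ ⊗_R F(σ₁)`; for `n = 0` it is `R` in degree `0`. -/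
def rouquier : ℕ → CochainComplex Bimod ℤ
  | 0 => (HomologicalComplex.single Bimod (ComplexShape.up ℤ) 0).obj (ring Side)
  | n + 1 => HomologicalComplex.mapBifunctor (rouquier n) rouquierGen tensorFunctor
      (ComplexShape.up ℤ)

/-- Hochschild homology `HH_i` applied to each term of a complex of graded bimodules. -/
abbrev HHComplex (i : ℕ) (K : CochainComplex Bimod ℤ) : CochainComplex GrModule ℤ :=
  ((HH i).mapHomologicalComplex (ComplexShape.up ℤ)).obj K

/-- Triply graded homology: the part of Hochschild degree `i`, internal degree `j` (the one coming
from the variables) and cohomological degree `k` of the cohomology of the complex obtained from `K`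
by taking the Hochschild homology of each term. For `K = F(σ)` this is `HHH(σ)`. -/
def HHH (K : CochainComplex Bimod ℤ) (i : ℕ) (j k : ℤ) : ModuleCat.{0} ℚ :=
  (((degreePart Unit j).mapHomologicalComplex (ComplexShape.up ℤ)).obj (HHComplex i K)).homology k

/-! ### Finite complexes with prescribed terms -/

/-- `K` is, up to isomorphism, the complex `0 ⟶ T 0 ⟶ T 1 ⟶ ⋯ ⟶ T n ⟶ 0` with differentials `d i`
and with `T 0` in cohomological degree `a`. -/
def IsFiniteComplex {V : Type*} [Category V] [HasZeroMorphisms V] (K : CochainComplex V ℤ) (a : ℤ)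
    (n : ℕ) (T : ℕ → V) (d : ∀ i, T i ⟶ T (i + 1)) : Prop :=
  (∀ k : ℤ, k < a ∨ a + n < k → IsZero (K.X k)) ∧
  ∃ e : ∀ i : ℕ, i ≤ n → (K.X (a + i) ≅ T i), ∀ (i : ℕ) (h : i + 1 ≤ n),
    K.d (a + i) (a + (i + 1 : ℕ)) ≫ (e (i + 1) h).hom = (e i (Nat.le_of_succ_le h)).hom ≫ d i

/-- A complex is contractible if its identity map is null-homotopic. -/
def IsContractible {V : Type*} [Category V] [Preadditive V] (K : CochainComplex V ℤ) : Prop :=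
  Nonempty (Homotopy (𝟙 K) 0)

/-- A complex is minimal if it has no nonzero contractible direct summand. -/
def IsMinimal (K : CochainComplex Bimod ℤ) : Prop :=
  ∀ K' C : CochainComplex Bimod ℤ, Nonempty (K ≅ K' ⊞ C) → IsContractible C → IsZero C

/-- The terms `R{2n}, B₁{2n-2}, B₁{2n-4}, …, B₁`. -/
def minTerm (n : ℕ) : ℕ → Bimod
  | 0 => (ring Side).shift (2 * n)
  | i + 1 => B.shift (2 * n - 2 * (i + 1))

/-- The differentials: `1 ↦ 1 ⊗ y + y ⊗ 1` for `i = 0`; for `i > 0`, `1 ⊗ 1 ↦ 1 ⊗ y - y ⊗ 1` if `i`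
is odd and `1 ⊗ 1 ↦ 1 ⊗ y + y ⊗ 1` if `i` is even. -/
def minD (n : ℕ) : ∀ i, minTerm n i ⟶ minTerm n (i + 1)
  | 0 => rb (by push_cast; ring)
  | i + 1 =>
    if Odd (i + 1) then
      mulB yMinus (by convert yMinus_mem using 2; push_cast; ring)
    else
      mulB yPlus (by convert yPlus_mem using 2; push_cast; ring)

lemma R.two_X_mem_deg : (2 * X : R) ∈ R.deg 2 := by
  rw [two_mul]; exact Submodule.add_mem _ R.X_mem_deg R.X_mem_deg

/-- The terms `R{2n}, R{2n-2}, R{2n-4}, …`. -/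
def hh₀Term (n : ℕ) (i : ℕ) : GrModule := (ring Unit).shift (2 * n - 2 * i)

/-- The differentials `2y, 0, 2y, 0, …`. -/
def hh₀D (n : ℕ) (i : ℕ) : hh₀Term n i ⟶ hh₀Term n (i + 1) :=
  if Even i then mulR Unit (2 * X) (by convert R.two_X_mem_deg using 2; push_cast; ring) else 0

/-- The terms `R{2n+2}, R{2n+2}, R{2n}, R{2n-2}, …`. -/
def hh₁Term (n : ℕ) : ℕ → GrModule
  | 0 => (ring Unit).shift (2 * n + 2)
  | i + 1 => (ring Unit).shift (2 * n + 2 - 2 * i)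

/-- The differentials `1, 0, 2y, 0, 2y, …`. -/
def hh₁D (n : ℕ) : ∀ i, hh₁Term n i ⟶ hh₁Term n (i + 1)
  | 0 => mulR Unit 1 (by convert R.one_mem_deg using 2; push_cast; ring)
  | i + 1 =>
    if Even (i + 1) then
      mulR Unit (2 * X) (by convert R.two_X_mem_deg using 2; push_cast; ring)
    else 0

/-- The tridegrees (Hochschild, internal, cohomological) listed for `HHH(σ₁ⁿ)`, the cohomological
degree being counted from the leftmost term of the complex: `(0, 2n-2t, t)` for odd `1 ≤ t ≤ n` and
`(1, 2n-2t+4, t)` for odd `3 ≤ t ≤ n`. -/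
def tridegrees (n : ℕ) : Set (ℕ × ℤ × ℤ) :=
  {p | ∃ t : ℕ, Odd t ∧ 1 ≤ t ∧ t ≤ n ∧ p = (0, 2 * (n : ℤ) - 2 * t, (t : ℤ))} ∪
  {p | ∃ t : ℕ, Odd t ∧ 3 ≤ t ∧ t ≤ n ∧ p = (1, 2 * (n : ℤ) - 2 * t + 4, (t : ℤ))}

end

end RouquierHHH

open RouquierHHH

/-! Write `K_n` for the minimal complex. It is built recursively: `K_{n+1}` is `K_n{2}` moved one
cohomological step to the left, followed by a new last term `B₁`; up to signs it is the cone of a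
map `K_n{2} ⟶ B₁`. The homotopy equivalence `F(σ₁ⁿ) ≃ K_n` (`nonempty_homotopyEquiv_minK`) is proved
by induction. Tensoring with the two-term complex `F(σ₁)` is a mapping cone, so `K_n ⊗ F(σ₁)` is the
cone of `K_n ⊗ R{2} ⟶ K_n ⊗ B₁`, and everything rests on the equivalence `K_n ⊗ B₁ ≃ B₁`
(`homotopyEquivK`).

For that equivalence, `R` is free over `R₁` on `1, y`, so `B₁ ⊗ B₁ = B₁ ⊕ B₁{2}` with generators `1
⊗ 1 ⊗ 1` and `1 ⊗ y ⊗ 1`. The map `K_n ⊗ B₁ ⟶ B₁` lives on the last term and replaces the middle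
variable by `(-1)ⁿ y`, where `y` is the left variable. The last differential of `K_{n+1}` sends the
generator to `1 ⊗ y + (-1)ⁿ y ⊗ 1`; after tensoring with `B₁` its image is exactly what the
replacement of the middle variable by `(-1)ⁿ⁺¹ y` kills, and the contracting homotopy reads off the
coordinate of `1 ⊗ y ⊗ 1`. Composing the evaluation for `n` with `R{2} ⟶ B₁`, `1 ↦ 1 ⊗ y + y ⊗ 1`,
gives `1 ⊗ y + (-1)ⁿ y ⊗ 1` (`rbB_minEv`). This is the next differential, and it explains why the
signs alternate.

For degree reasons there are no nonzero morphisms from a term of `K_n` to the preceding one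
(`minK_hom_eq_zero`). Hence homotopic maps `K_n ⟶ K_n` are equal (`eq_of_homotopy`). This turns the
homotopy equivalence into a splitting with contractible complement, and it also makes `K_n` minimal,
since the idempotent onto a contractible summand is null-homotopic. The terms are indecomposable
because they are cyclic with only scalars in the degree of the generator.

On Hochschild homology, `HH₀(B₁) = R` by multiplication, under which `1 ⊗ y + y ⊗ 1` becomes `2y`
and `1 ⊗ y - y ⊗ 1` becomes `0`. `HH₁(B₁)` is the free left `R`-module on `1 ⊗ y + y ⊗ 1`; the
product of this element with itself is `2y` times it, its product with `1 ⊗ y - y ⊗ 1` is `0`, and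
it is the image of `1 ∈ R`. The homology is then a sum of cokernels of `2y`, each one-dimensional.
For odd `n` no kernel of a zero map is left over at the right end, and there are `(n + 1)/2 + (n -
1)/2 = n` such cokernels. -/

namespace RouquierHHH

noncomputable section

/-! ### Cochain complexes in additive categories -/

section Retract

variable {V : Type*} [Category V] [Preadditive V]

/-- A summand inclusion that is a homotopy equivalence has a contractible complement. -/
lemma exists_iso_biprod_contractible [HasKernels V] [HasBinaryBiproducts V]
    {K T : CochainComplex V ℤ} (f : K ⟶ T) (g : T ⟶ K) (hfg : f ≫ g = 𝟙 K)
    (h : Homotopy (g ≫ f) (𝟙 T)) :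
    ∃ C : CochainComplex V ℤ, Nonempty (T ≅ K ⊞ C) ∧ IsContractible C := by
  have : HasEqualizers V := Preadditive.hasEqualizers_of_hasKernels
  let r : T ⟶ kernel g := kernel.lift g (𝟙 T - g ≫ f) (by simp [hfg])
  have hr : kernel.ι g ≫ r = 𝟙 _ := by
    rw [← cancel_mono (kernel.ι g)]
    simp [r, Preadditive.comp_sub]
  have hf : f ≫ r = 0 := by
    rw [← cancel_mono (kernel.ι g)]
    simp [r, Preadditive.comp_sub, reassoc_of% hfg]
  -- The complement is the kernel of the retraction `g`, onto which `r` projects by `1 - g ≫ f`.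
  let s : (ShortComplex.mk f r hf).Splitting :=
    { r := g, s := kernel.ι g, f_r := hfg, s_g := hr, id := by simp [r] }
  refine ⟨kernel g, ⟨s.isoBinaryBiproduct⟩, ⟨?_⟩⟩
  -- The projector onto the complement is null-homotopic. Sandwiched between the inclusion and the
  -- projection of `kernel g`, it becomes the identity of `kernel g`.
  have h1 : Homotopy (𝟙 T - g ≫ f) 0 := Homotopy.equivSubZero h.symm
  refine (Homotopy.ofEq ?_).trans (((h1.compLeft (kernel.ι g)).compRight r).trans
    (Homotopy.ofEq (by simp)))
  have h2 : 𝟙 T - g ≫ f = r ≫ kernel.ι g := by simp [r]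
  rw [h2, Category.assoc, Category.assoc, hr, Category.comp_id, hr]

/-- Postcomposing with a homotopy equivalence does not change a mapping cone. -/
lemma nonempty_homotopyEquiv_mappingCone [HasZeroObject V] [HasBinaryBiproducts V]
    {P Q Q' : CochainComplex V ℤ} (φ : P ⟶ Q) (e : HomotopyEquiv Q Q') :
    Nonempty (HomotopyEquiv (CochainComplex.mappingCone φ)
      (CochainComplex.mappingCone (φ ≫ e.hom))) := by
  -- In the homotopy category the two cones complete isomorphic morphisms to distinguished
  -- triangles, so their third vertices are isomorphic.
  let t := Pretriangulated.isoTriangleOfIso₁₂ _ _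
    (HomotopyCategory.mappingCone_triangleh_distinguished φ)
    (HomotopyCategory.mappingCone_triangleh_distinguished (φ ≫ e.hom)) (Iso.refl _)
    (HomotopyCategory.isoOfHomotopyEquiv e) (by
      refine Eq.trans ?_ (Category.id_comp _).symm
      exact ((HomotopyCategory.quotient V (ComplexShape.up ℤ)).map_comp φ e.hom).symm)
  exact ⟨HomotopyCategory.homotopyEquivOfIso (Pretriangulated.Triangle.π₃.mapIso t)⟩

open CochainComplex.mappingCone in
/-- A complex whose terms split as those of a mapping cone, compatibly with the differentials, is
isomorphic to it. -/
lemma nonempty_mappingCone_iso [HasBinaryBiproducts V]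
    {P Q T : CochainComplex V ℤ} (φ : P ⟶ Q)
    (α : ∀ k, P.X (k + 1) ⟶ T.X k) (β : ∀ k, Q.X k ⟶ T.X k)
    (π : ∀ k, T.X k ⟶ P.X (k + 1)) (ρ : ∀ k, T.X k ⟶ Q.X k)
    (hαπ : ∀ k, α k ≫ π k = 𝟙 _) (hαρ : ∀ k, α k ≫ ρ k = 0)
    (hβπ : ∀ k, β k ≫ π k = 0) (hβρ : ∀ k, β k ≫ ρ k = 𝟙 _)
    (hT : ∀ k, π k ≫ α k + ρ k ≫ β k = 𝟙 _)
    (hα : ∀ k, α k ≫ T.d k (k + 1) =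
      φ.f (k + 1) ≫ β (k + 1) - P.d (k + 1) (k + 1 + 1) ≫ α (k + 1))
    (hβ : ∀ k, β k ≫ T.d k (k + 1) = Q.d k (k + 1) ≫ β (k + 1)) :
    Nonempty (CochainComplex.mappingCone φ ≅ T) := by
  refine ⟨HomologicalComplex.Hom.isoOfComponents (fun k =>
    { hom := (fst φ).1.v k (k + 1) rfl ≫ α k + (snd φ).v k k (add_zero k) ≫ β k
      inv := π k ≫ (inl φ).v (k + 1) k (by lia) + ρ k ≫ (inr φ).f k
      hom_inv_id := ?_
      inv_hom_id := ?_ }) ?_⟩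
  · rw [ext_from_iff _ (k + 1) k rfl]
    constructor <;> simp [Preadditive.add_comp, Preadditive.comp_add, reassoc_of% hαπ,
      reassoc_of% hαρ, reassoc_of% hβπ, reassoc_of% hβρ]
  · simp [Preadditive.add_comp, Preadditive.comp_add, hT]
  · rintro k _ rfl
    rw [ext_from_iff _ (k + 1) k rfl]
    constructor
    · rw [inl_v_d_assoc φ (k + 1) k (k + 1 + 1) (by lia) (by lia)]
      simp [Preadditive.add_comp, Preadditive.comp_add, hα, sub_eq_neg_add]
    · simp [Preadditive.comp_add, hβ]

end Retract

/-! ### Complexes in nonpositive degrees indexed by natural numbers -/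

section NegComplex

variable {V : Type*} [Category V] [HasZeroObject V]

open ZeroObject in
/-- The `ℤ`-indexed family with `X m` in degree `-m`. -/
def negX (X : ℕ → V) : ℤ → V
  | .ofNat 0 => X 0
  | .ofNat (_ + 1) => 0
  | .negSucc m => X (m + 1)

lemma isZero_negX (X : ℕ → V) (m : ℕ) : IsZero (negX X (Int.ofNat (m + 1))) := isZero_zero V

variable [Preadditive V]

/-- The differentials of `negComplex`. -/
def negD {X : ℕ → V} (d : ∀ m, X (m + 1) ⟶ X m) : ∀ k : ℤ, negX X k ⟶ negX X (k + 1)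
  | .ofNat _ => 0
  | .negSucc 0 => d 0
  | .negSucc (m + 1) => d (m + 1)

/-- The cochain complex `⋯ ⟶ X 2 ⟶ X 1 ⟶ X 0 ⟶ 0` with `X m` in degree `-m`. -/
def negComplex (X : ℕ → V) (d : ∀ m, X (m + 1) ⟶ X m) (hd : ∀ m, d (m + 1) ≫ d m = 0) :
    CochainComplex V ℤ :=
  CochainComplex.of (negX X) (negD d) (by
    rintro (_ | _ | _ | m)
    · exact zero_comp
    · exact comp_zero
    · exact hd 0
    · exact hd (m + 1))

variable {X : ℕ → V} {d : ∀ m, X (m + 1) ⟶ X m} {hd : ∀ m, d (m + 1) ≫ d m = 0}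

lemma negComplex_d (k : ℤ) : (negComplex X d hd).d k (k + 1) = negD d k :=
  CochainComplex.of_d _ _ k

/-- The terms of `negComplex`. -/
def negXIso (X : ℕ → V) (d : ∀ m, X (m + 1) ⟶ X m) (hd : ∀ m, d (m + 1) ≫ d m = 0) :
    ∀ m : ℕ, (negComplex X d hd).X (-m) ≅ X m
  | 0 => Iso.refl _
  | _ + 1 => Iso.refl _

/-- The degrees are free variables with equations so that the formula can be used in degrees written
`-n + i`, which agree with `-m` only propositionally. -/
lemma negXIso_comm (m : ℕ) (k l : ℤ) (hk : k = -(m + 1 : ℕ)) (hl : l = -m) :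
    (negComplex X d hd).d k l ≫ eqToHom (by rw [hl]) ≫ (negXIso X d hd m).hom =
      eqToHom (by rw [hk]) ≫ (negXIso X d hd (m + 1)).hom ≫ d m := by
  subst hk hl
  have h : ∀ l, ∀ h : -((m + 1 : ℕ) : ℤ) + 1 = l, (negComplex X d hd).d (-(m + 1 : ℕ)) l =
      negD d (-(m + 1 : ℕ)) ≫ eqToHom (by rw [h]; rfl) := by
    rintro _ rfl
    rw [negComplex_d]
    exact (Category.comp_id _).symm
  rw [h (-m) (by push_cast; ring)]
  cases m with
  | zero =>
    change ((d 0 : X 1 ⟶ X 0) ≫ 𝟙 (X 0)) ≫ 𝟙 (X 0) ≫ 𝟙 (X 0) = 𝟙 (X 1) ≫ 𝟙 (X 1) ≫ d 0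
    simp
  | succ m =>
    change ((d (m + 1) : X (m + 2) ⟶ X (m + 1)) ≫ 𝟙 _) ≫ 𝟙 (X (m + 1)) ≫ 𝟙 (X (m + 1)) =
      𝟙 (X (m + 2)) ≫ 𝟙 (X (m + 2)) ≫ d (m + 1)
    simp

/-- Translates between two numberings of the same terms: `m` counts from the right end and `i` from
the left end, so that `i + m = n`. -/
lemma isFiniteComplex_negComplex {n : ℕ} (h0 : ∀ m, n < m → IsZero (X m)) {T : ℕ → V}
    {dT : ∀ i, T i ⟶ T (i + 1)} (e : ∀ i m, i + m = n → (X m ≅ T i))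
    (he : ∀ i m (h : i + 1 + m = n), d m ≫ (e (i + 1) m h).hom =
      (e i (m + 1) (by omega)).hom ≫ dT i) :
    IsFiniteComplex (negComplex X d hd) (-(n : ℤ)) n T dT := by
  constructor
  · rintro ((_ | m) | m) hk
    · simp at hk; omega
    · exact isZero_zero V
    · exact h0 _ (by rw [Int.negSucc_eq] at hk; omega)
  · refine ⟨fun i hi => eqToIso (by congr 1; omega) ≪≫ negXIso X d hd (n - i) ≪≫
      e i (n - i) (by omega), fun i hi => ?_⟩
    obtain ⟨m, rfl⟩ : ∃ m, n = i + 1 + m := ⟨n - (i + 1), by omega⟩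
    have h1 : i + 1 + m - i = m + 1 := by omega
    have h2 : i + 1 + m - (i + 1) = m := by omega
    have key := negXIso_comm (X := X) (d := d) (hd := hd) m (-((i + 1 + m : ℕ) : ℤ) + i)
      (-((i + 1 + m : ℕ) : ℤ) + (i + 1 : ℕ)) (by push_cast; ring) (by push_cast; ring)
    -- The indices `n - i` and `n - (i + 1)` do not reduce to `m + 1` and `m`. They are generalized
    -- to `b` and `a`, so that the equalities can be substituted in the dependent isomorphisms.
    have hg : ∀ a b (ha : a = m) (hb : b = m + 1) (pa) (pb),
        (eqToHom (by rw [ha]; congr 1; push_cast; ring) ≫ (negXIso X d hd a).hom ≫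
          (e (i + 1) a pa).hom : (negComplex X d hd).X (-((i + 1 + m : ℕ) : ℤ) + (i + 1 : ℕ)) ⟶ _) =
        eqToHom (by congr 1; push_cast; ring) ≫ (negXIso X d hd m).hom ≫ (e (i + 1) m rfl).hom ∧
        (eqToHom (by rw [hb]; congr 1; push_cast; ring) ≫ (negXIso X d hd b).hom ≫
          (e i b pb).hom : (negComplex X d hd).X (-((i + 1 + m : ℕ) : ℤ) + i) ⟶ _) =
        eqToHom (by congr 1; push_cast; ring) ≫ (negXIso X d hd (m + 1)).hom ≫
          (e i (m + 1) (by omega)).hom := by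
      rintro _ _ rfl rfl _ _
      exact ⟨rfl, rfl⟩
    have hg' := hg _ _ h2 h1 (by omega) (by omega)
    simp only [Iso.trans_hom, eqToIso.hom]
    erw [hg'.1, hg'.2]
    simp only [← Category.assoc] at key ⊢
    erw [key]
    simp only [Category.assoc]
    rw [he]

end NegComplex

/-! ### Transport of finite complexes along functors and isomorphisms -/

section FiniteComplex

variable {V W : Type*} [Category V] [Category W] [Preadditive V] [Preadditive W]

lemma IsFiniteComplex.map {K : CochainComplex V ℤ} {a : ℤ} {n : ℕ} {T : ℕ → V}
    {d : ∀ i, T i ⟶ T (i + 1)} (h : IsFiniteComplex K a n T d) (F : V ⥤ W) [F.Additive] :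
    IsFiniteComplex ((F.mapHomologicalComplex _).obj K) a n (fun i => F.obj (T i))
      (fun i => F.map (d i)) := by
  obtain ⟨h0, e, he⟩ := h
  refine ⟨fun k hk => F.map_isZero (h0 k hk), fun i hi => F.mapIso (e i hi), fun i hi => ?_⟩
  have := congrArg F.map (he i hi)
  rwa [F.map_comp, F.map_comp] at this

lemma IsFiniteComplex.congr {K : CochainComplex V ℤ} {a : ℤ} {n : ℕ} {T T' : ℕ → V}
    {d : ∀ i, T i ⟶ T (i + 1)} {d' : ∀ i, T' i ⟶ T' (i + 1)} (h : IsFiniteComplex K a n T d)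
    (ε : ∀ i, T i ≅ T' i) (hε : ∀ i, d i ≫ (ε (i + 1)).hom = (ε i).hom ≫ d' i) :
    IsFiniteComplex K a n T' d' := by
  obtain ⟨h0, e, he⟩ := h
  refine ⟨h0, fun i hi => e i hi ≪≫ ε i, fun i hi => ?_⟩
  simp only [Iso.trans_hom, Category.assoc]
  rw [reassoc_of% (he i hi), hε]

end FiniteComplex

namespace GrMod

/-! ### Morphisms of graded modules -/

section

variable {S : Type}

lemma lin_comp_apply {M N P : GrMod S} (f : M ⟶ N) (g : N ⟶ P) (x : M) :
    Hom.lin (f ≫ g) x = Hom.lin g (Hom.lin f x) := rfl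

/-- A linear map commuting with the actions of `X` commutes with those of all polynomials. -/
lemma map_act_of_X {S' : Type} {M : GrMod S} {N : GrMod S'} (f : M →ₗ[ℚ] N) (s : S) (t : S')
    (h : ∀ x, f (M.act s X x) = N.act t X (f x)) (a : R) (x : M) :
    f (M.act s a x) = N.act t a (f x) := by
  induction a using Polynomial.induction_on' with
  | add p q hp hq => simp [hp, hq]
  | monomial n c =>
    rw [← Polynomial.C_mul_X_pow_eq_monomial, ← Polynomial.smul_eq_C_mul, map_smul, map_smul,
      LinearMap.smul_apply, LinearMap.smul_apply, map_smul]
    congr 1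
    induction n generalizing x with
    | zero => simp
    | succ n ih =>
      rw [pow_succ, map_mul, map_mul, Module.End.mul_apply, Module.End.mul_apply, ih, h]

lemma Hom.comps_lin {M N : GrMod S} (f : M ⟶ N) (x : M) (i : ℤ) :
    N.comps (Hom.lin f x) i = Hom.lin f (M.comps x i) := by
  induction x using M.hom_induction with
  | mem j x hx =>
    rw [M.comps_of_mem hx, N.comps_of_mem (Hom.lin_mem f hx)]
    by_cases h : j = i
    · subst h; simp
    · simp [h]
  | add x y hx hy => simp [hx, hy]

/-- A bijective morphism of graded modules is an isomorphism. -/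
def isoOfBijective {M N : GrMod S} (f : M ⟶ N) (hf : Function.Bijective (Hom.lin f)) : M ≅ N where
  hom := f
  inv := ofLin (M := N) (N := M) (LinearEquiv.ofBijective (Hom.lin f) hf).symm.toLinearMap
    (fun s a x => by
      obtain ⟨y, rfl⟩ := hf.2 x
      rw [← Hom.lin_act]
      exact (LinearEquiv.ofBijective_symm_apply_apply (Hom.lin f) _).trans (congrArg (M.act s a)
        (LinearEquiv.ofBijective_symm_apply_apply (Hom.lin f) y).symm))
    (fun i x hx => by
      obtain ⟨y, rfl⟩ := hf.2 x
      -- The inverse preserves degrees because the preimage of a homogeneous element equals its own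
      -- component in that degree, by injectivity.
      have h1 : y = M.comps y i := hf.1 (by
        rw [← Hom.comps_lin, N.comps_of_mem hx, Finsupp.single_eq_same])
      have h2 : y ∈ M.gr i := by rw [h1]; exact M.comps_mem y i
      refine Set.mem_of_eq_of_mem ?_ h2
      exact LinearEquiv.ofBijective_symm_apply_apply (Hom.lin f) y)
  hom_inv_id := GrMod.hom_ext fun x =>
    (LinearEquiv.ofBijective (Hom.lin f) hf).symm_apply_apply x
  inv_hom_id := GrMod.hom_ext fun x =>
    (LinearEquiv.ofBijective (Hom.lin f) hf).apply_symm_apply x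

instance : HasKernels (GrMod S) where
  has_limit {M N} f := by
    have hP : ∀ x ∈ LinearMap.ker (Hom.lin f), ∀ i, M.comps x i ∈ LinearMap.ker (Hom.lin f) := by
      intro x hx i
      rw [LinearMap.mem_ker] at hx ⊢
      rw [← Hom.comps_lin, hx]
      simp
    have ha : ∀ s a, LinearMap.ker (Hom.lin f) ≤ (LinearMap.ker (Hom.lin f)).comap (M.act s a) := by
      intro s a x hx
      rw [LinearMap.mem_ker] at hx
      rw [Submodule.mem_comap, LinearMap.mem_ker, Hom.lin_act, hx, map_zero]
    let ι : sub M _ hP ha ⟶ M := ofLin (M := sub M _ hP ha) (N := M) (Submodule.subtype _)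
      (fun _ _ _ => rfl) (fun _ _ h => h)
    have hι : ι ≫ f = 0 := by
      ext x
      exact x.2
    have : Mono ι := ⟨fun {A} a b h => GrMod.hom_ext fun x =>
      Subtype.ext (congrArg (fun t => Hom.lin t x) h)⟩
    exact ⟨⟨⟨KernelFork.ofι ι hι, KernelFork.IsLimit.ofι' ι hι fun {A} k hk =>
      ⟨ofLin (M := A) (N := sub M _ hP ha) ((Hom.lin k).codRestrict _ fun x =>
          congrArg (fun t => Hom.lin t x) hk)
        (fun s a x => Subtype.ext (Hom.lin_act k s a x)) (fun i x hx => Hom.lin_mem k hx), rfl⟩⟩⟩⟩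

/-- The shift of a morphism. -/
def shiftHom {M N : GrMod S} (k : ℤ) (f : M ⟶ N) : M.shift k ⟶ N.shift k :=
  ofLin (M := M.shift k) (N := N.shift k) (Hom.lin (M := M) (N := N) f) (Hom.lin_act f)
    (fun i _ hx => Hom.lin_mem (i := i - k) f hx)

lemma shiftHom_comp {M N P : GrMod S} (k : ℤ) (f : M ⟶ N) (g : N ⟶ P) :
    shiftHom k (f ≫ g) = shiftHom k f ≫ shiftHom k g := rfl

lemma shiftHom_zero (M N : GrMod S) (k : ℤ) : shiftHom k (0 : M ⟶ N) = 0 := rfl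

/-- An element generating a graded module under all actions. -/
def Gen (M : GrMod S) (x : M) : Prop :=
  ∀ p : Submodule ℚ M, x ∈ p → (∀ s, ∀ y ∈ p, M.act s X y ∈ p) → ∀ y, y ∈ p

lemma Gen.hom_ext {M N : GrMod S} {x : M} (hx : Gen M x) {f g : M ⟶ N}
    (h : Hom.lin f x = Hom.lin g x) : f = g := by
  refine GrMod.hom_ext fun y => hx (LinearMap.eqLocus (Hom.lin f) (Hom.lin g)) h ?_ y
  intro s y hy
  rw [LinearMap.mem_eqLocus] at hy ⊢
  rw [Hom.lin_act, Hom.lin_act, hy]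

lemma gen_ring (s : S) : Gen (ring S) (1 : R) := by
  intro p h1 hp (y : R)
  induction y using Polynomial.induction_on' with
  | add a b ha hb => exact p.add_mem ha hb
  | monomial n c =>
    rw [← Polynomial.C_mul_X_pow_eq_monomial, ← Polynomial.smul_eq_C_mul]
    refine p.smul_mem c ?_
    induction n with
    | zero => rw [pow_zero]; exact h1
    | succ n ih => rw [pow_succ']; exact hp s _ ih

end

/-! ### Elements of tensor products -/

section

variable {M N : Bimod}

/-- The element `x ⊗ y` of `M ⊗_R N`. -/
def tm (x : M) (y : N) : tensor M N :=
  ((x : M.As .right) ⊗ₜ[R] (y : N.As .left) : TensorCarrier M N)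

lemma tm_add_left (x x' : M) (y : N) : tm (x + x') y = tm x y + tm x' y :=
  TensorProduct.add_tmul (R := R) (M := M.As .right) (N := N.As .left) x x' y

lemma tm_add_right (x : M) (y y' : N) : tm x (y + y') = tm x y + tm x y' :=
  TensorProduct.tmul_add (R := R) (M := M.As .right) (N := N.As .left) x y y'

lemma tm_zero_left (y : N) : tm (0 : M) y = 0 :=
  TensorProduct.zero_tmul (R := R) (M.As .right) (N := N.As .left) y

lemma tm_smul_left (c : ℚ) (x : M) (y : N) : tm (c • x) y = c • tm x y :=
  map_rat_smul ((TensorProduct.mk R (M.As .right) (N.As .left)).flip y) c x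

lemma tm_smul_right (c : ℚ) (x : M) (y : N) : tm x (c • y) = c • tm x y :=
  map_rat_smul (TensorProduct.mk R (M.As .right) (N.As .left) x) c y

lemma tm_act (a : R) (x : M) (y : N) : tm (M.act .right a x) y = tm x (N.act .left a y) :=
  TensorProduct.smul_tmul (R := R) (M := M.As .right) (N := N.As .left) a x y

lemma act_left_tm (a : R) (x : M) (y : N) :
    (tensor M N).act .left a (tm x y) = tm (M.act .left a x) y := rfl

lemma act_right_tm (a : R) (x : M) (y : N) :
    (tensor M N).act .right a (tm x y) = tm x (N.act .right a y) := rfl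

lemma tm_mem {i j : ℤ} {x : M} {y : N} (hx : x ∈ M.gr i) (hy : y ∈ N.gr j) :
    tm x y ∈ (tensor M N).gr (i + j) :=
  tmul_mem_tensorGr (A := R) (M := M.As .right) (N := N.As .left) hx hy

/-- A middle-linear map on `M × N` as a map on `M ⊗_R N`. -/
def tensorLift {P : Type} [AddCommGroup P] [Module ℚ P] (β : M →ₗ[ℚ] N →ₗ[ℚ] P)
    (hβ : ∀ x y, β (M.act .right X x) y = β x (N.act .left X y)) : tensor M N →ₗ[ℚ] P :=
  (TensorProduct.liftAddHom (R := R) (M := M.As .right) (N := N.As .left)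
    (LinearMap.toAddMonoidHom'.comp β.toAddMonoidHom) (fun a (x : M) (y : N) => by
      change β (M.act .right a x) y = β x (N.act .left a y)
      induction a using Polynomial.induction_on' with
      | add p q hp hq =>
        rw [map_add, map_add, LinearMap.add_apply, LinearMap.add_apply, map_add, map_add,
          LinearMap.add_apply, hp, hq]
      | monomial n c =>
        rw [← Polynomial.C_mul_X_pow_eq_monomial, ← Polynomial.smul_eq_C_mul, map_smul, map_smul,
          LinearMap.smul_apply, LinearMap.smul_apply, map_smul, map_smul, LinearMap.smul_apply]
        congr 1
        induction n generalizing x y with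
        | zero => simp
        | succ n ih =>
          rw [pow_succ, map_mul, Module.End.mul_apply, ih, hβ, ← Module.End.mul_apply, ← map_mul,
            ← pow_succ', pow_succ])).toRatLinearMap

lemma tensor_induction {p : tensor M N → Prop} (t : tensor M N) (tmul : ∀ x y, p (tm x y))
    (add : ∀ t u, p t → p u → p (t + u)) : p t :=
  TensorProduct.induction_on (R := R) (M := M.As .right) (N := N.As .left) (motive := p) t
    (by have := tmul 0 0; rwa [tm_zero_left] at this) tmul add

lemma tm_hom_ext {P : Bimod} {f g : tensor M N ⟶ P}
    (h : ∀ (x : M) (y : N), Hom.lin f (tm x y) = Hom.lin g (tm x y)) : f = g :=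
  tensor_hom_ext h

/-- A middle-linear, bilinear, homogeneous map on `M × N` as a morphism on `M ⊗_R N`. -/
def tensorDesc {P : Bimod} (β : M →ₗ[ℚ] N →ₗ[ℚ] P)
    (hβ : ∀ x y, β (M.act .right X x) y = β x (N.act .left X y))
    (hl : ∀ x y, β (M.act .left X x) y = P.act .left X (β x y))
    (hr : ∀ x y, β x (N.act .right X y) = P.act .right X (β x y))
    (hg : ∀ i j, ∀ x ∈ M.gr i, ∀ y ∈ N.gr j, β x y ∈ P.gr (i + j)) : tensor M N ⟶ P :=
  ofLin (M := tensor M N) (N := P) (tensorLift β hβ)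
    (fun s => map_act_of_X _ s s fun t => by
      induction t using tensor_induction with
      | tmul x y =>
        cases s
        · exact hl x y
        · exact hr x y
      | add t u ht hu => rw [map_add, map_add, map_add, map_add, ht, hu])
    (fun i t ht => by
      induction ht using Submodule.span_induction with
      | mem t h =>
        obtain ⟨k, l, rfl, x, hx, y, hy, rfl⟩ := h
        exact hg k l x hx y hy
      | zero => exact Submodule.zero_mem _
      | add t u _ _ ht hu => rw [map_add]; exact Submodule.add_mem _ ht hu
      | smul c t _ ht => rw [map_smul]; exact Submodule.smul_mem _ c ht)

variable (M N)

/-- The identity map `M ⊗_R N ⟶ M{k} ⊗_R N`. -/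
def tensorShiftLin (k : ℤ) : tensor M N →ₗ[ℚ] tensor (M.shift k) N :=
  tensorLift (LinearMap.mk₂ ℚ (fun x y => tm (M := M.shift k) x y)
    (fun x x' y => tm_add_left (M := M.shift k) x x' y)
    (fun c x y => tm_smul_left (M := M.shift k) c x y)
    (fun x y y' => tm_add_right (M := M.shift k) x y y')
    (fun c x y => tm_smul_right (M := M.shift k) c x y)) (fun x y => tm_act (M := M.shift k) X x y)

/-- The identity map `M{k} ⊗_R N ⟶ M ⊗_R N`. -/
def tensorUnshiftLin (k : ℤ) : tensor (M.shift k) N →ₗ[ℚ] tensor M N :=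
  tensorLift (M := M.shift k) (LinearMap.mk₂ ℚ (fun (x : M) y => tm x y)
    (fun x x' y => tm_add_left x x' y)
    (fun c x y => tm_smul_left c x y)
    (fun x y y' => tm_add_right x y y')
    (fun c x y => tm_smul_right c x y)) (fun x y => tm_act X x y)

/-- Shifting a tensor product is shifting its first factor. -/
def tensorShift (k : ℤ) : (tensor M N).shift k ≅ tensor (M.shift k) N where
  hom := ofLin (M := (tensor M N).shift k) (N := tensor (M.shift k) N) (tensorShiftLin M N k)
    (fun s a x => by
      change tensorShiftLin M N k ((tensor M N).act s a x) = _
      change tensor M N at x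
      induction x using tensor_induction with
      | tmul x y => cases s <;> rfl
      | add t u ht hu => rw [map_add, map_add, map_add, map_add, ht, hu])
    (fun i t ht => by
      change t ∈ (tensor M N).gr (i - k) at ht
      generalize hj : i - k = j at ht
      induction ht using Submodule.span_induction with
      | mem t h =>
        obtain ⟨a, b, hab, x, hx, y, hy, rfl⟩ := h
        refine Submodule.subset_span ⟨a + k, b, by omega, x, ?_, y, hy, rfl⟩
        exact (congrArg (x ∈ M.gr ·) (add_sub_cancel_right a k)).mpr hx
      | zero => exact Submodule.zero_mem _
      | add t u _ _ ht hu => rw [map_add]; exact Submodule.add_mem _ ht hu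
      | smul c t _ ht => rw [map_smul]; exact Submodule.smul_mem _ c ht)
  inv := ofLin (M := tensor (M.shift k) N) (N := (tensor M N).shift k) (tensorUnshiftLin M N k)
    (fun s a x => by
      induction x using tensor_induction with
      | tmul x y => cases s <;> rfl
      | add t u ht hu => rw [map_add, map_add, map_add, map_add, ht, hu])
    (fun i t ht => by
      change tensorUnshiftLin M N k t ∈ (tensor M N).gr (i - k)
      induction ht using Submodule.span_induction with
      | mem t h =>
        obtain ⟨a, b, hab, x, hx, y, hy, rfl⟩ := h
        exact Submodule.subset_span ⟨a - k, b, by omega, x, hx, y, hy, rfl⟩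
      | zero => exact Submodule.zero_mem _
      | add t u _ _ ht hu => rw [map_add]; exact Submodule.add_mem _ ht hu
      | smul c t _ ht => rw [map_smul]; exact Submodule.smul_mem _ c ht)
  hom_inv_id := GrMod.hom_ext fun t => by
    change tensor M N at t
    induction t using tensor_induction with
    | tmul x y => rfl
    | add t u ht hu => rw [map_add, map_add, ht, hu]
  inv_hom_id := tm_hom_ext fun _ _ => rfl

lemma tensorShift_hom_tm (k : ℤ) (x : M) (y : N) :
    Hom.lin (tensorShift M N k).hom (tm x y) = tm (M := M.shift k) x y := rfl

variable {M N} in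
lemma tensorMap_shiftHom {M' N' : Bimod} (k : ℤ) (f : M ⟶ M') (g : N ⟶ N') :
    tensorMap (shiftHom k f) g =
      (tensorShift M N k).inv ≫ shiftHom k (tensorMap f g) ≫ (tensorShift M' N' k).hom :=
  tm_hom_ext fun _ _ => rfl

/-- The right unit isomorphism `M ⊗_R R{k} ≅ M{k}`. -/
def rightUnit (k : ℤ) : tensor M ((ring Side).shift k) ≅ M.shift k where
  hom := tensorDesc (P := M.shift k) (N := (ring Side).shift k)
    ((M.act .right).toLinearMap.flip) (fun x (y : R) => by
      change M.act .right y (M.act .right X x) = M.act .right (X * y) x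
      rw [mul_comm, map_mul]; rfl)
    (fun x (y : R) => M.act_comm _ _ _ _ _)
    (fun x (y : R) => by
      change M.act .right (X * y) x = _
      rw [map_mul]; rfl)
    (fun i j x hx y hy => by
      change M.act .right y x ∈ M.gr _
      have := M.act_mem .right hy hx
      rwa [show j - k + i = i + j - k by ring] at this)
  inv := ofLin (M := M.shift k) (N := tensor M ((ring Side).shift k))
    { toFun := fun x => tm (N := (ring Side).shift k) x (1 : R)
      map_add' := fun x y => tm_add_left x y _
      map_smul' := fun c x => tm_smul_left c x _ }
    (fun s a x => by
      cases s
      · rfl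
      · change tm (N := (ring Side).shift k) (M.act .right a x) (1 : R) = _
        rw [tm_act]; rfl)
    (fun i x hx => by
      have := tm_mem (N := (ring Side).shift k) (i := i - k) (j := k) (M := M) (x := x) hx
        (y := (1 : R))
        (by change (1 : R) ∈ R.deg (k - k); rw [sub_self]; exact R.one_mem_deg)
      exact (congrArg (fun j => tm (N := (ring Side).shift k) x (1 : R) ∈
        (tensor M ((ring Side).shift k)).gr j) (sub_add_cancel i k)).mp this)
  hom_inv_id := tm_hom_ext fun x (y : R) => by
    change tm (N := (ring Side).shift k) (M.act .right y x) (1 : R) =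
      tm (N := (ring Side).shift k) x y
    rw [tm_act]
    exact congrArg (tm (N := (ring Side).shift k) x) (mul_one (y : R))
  inv_hom_id := by
    ext x
    change M.act .right 1 x = x
    rw [map_one]; rfl

variable {M} in
lemma rightUnit_naturality {M' : Bimod} (k : ℤ) (f : M ⟶ M') :
    tensorMap f (𝟙 ((ring Side).shift k)) ≫ (rightUnit M' k).hom =
      (rightUnit M k).hom ≫ shiftHom k f :=
  tm_hom_ext fun x y => (Hom.lin_act f .right y x).symm

/-- The left unit isomorphism `R ⊗_R N ≅ N`. -/
def leftUnit : tensor (ring Side) N ≅ N where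
  hom := tensorDesc (M := ring Side) (P := N) (N.act .left).toLinearMap
    (fun (x : R) y => by
      change N.act .left (X * x) y = N.act .left x (N.act .left X y)
      rw [mul_comm, map_mul]; rfl)
    (fun (x : R) y => by
      change N.act .left (X * x) y = _
      rw [map_mul]; rfl)
    (fun x y => N.act_comm _ _ _ _ _)
    (fun i j x hx y hy => N.act_mem .left hx hy)
  inv := ofLin (M := N) (N := tensor (ring Side) N)
    { toFun := fun x => tm (M := ring Side) (1 : R) x
      map_add' := fun x y => tm_add_right _ x y
      map_smul' := fun c x => tm_smul_right c _ x }
    (fun s a x => by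
      cases s
      · change tm (M := ring Side) (1 : R) (N.act .left a x) = _
        rw [← tm_act]; rfl
      · rfl)
    (fun i x hx => by
      have := tm_mem (M := ring Side) R.one_mem_deg hx
      rwa [zero_add] at this)
  hom_inv_id := tm_hom_ext fun (x : R) y => by
    change tm (M := ring Side) (1 : R) (N.act .left x y) = tm (M := ring Side) x y
    rw [← tm_act]
    exact congrArg (fun t => tm (M := ring Side) t y) (mul_one (x : R))
  inv_hom_id := by
    ext x
    change N.act .left 1 x = x
    rw [map_one]; rfl

end

end GrMod

section

open GrMod

/-! ### Even and odd parts of polynomials -/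

/-- The involution `y ↦ -y` of `R`. -/
def R.refl : R →ₐ[ℚ] R := aeval (-X)

@[simp] lemma R.refl_X : R.refl X = -X := by simp [R.refl]

lemma R.refl_of_mem (r : R₁) : R.refl r = r := by
  obtain ⟨r, hr⟩ := r
  have : R₁ ≤ AlgHom.equalizer R.refl (AlgHom.id ℚ R) := Algebra.adjoin_le (by
    rintro _ rfl
    simp)
  exact this hr

/-- The even part of a polynomial. -/
def R.even : R →ₗ[R₁] R where
  toFun f := C (1 / 2) * (f + R.refl f)
  map_add' f g := by rw [map_add]; ring
  map_smul' r f := by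
    rw [show r • f = (r : R) * f from rfl, map_mul, R.refl_of_mem, RingHom.id_apply,
      show ∀ g : R, r • g = (r : R) * g from fun _ => rfl]
    ring

lemma R.even_apply (f : R) : R.even f = C (1 / 2) * (f + R.refl f) := rfl

/-- The odd part of `f` has zero constant term, so dividing it by `y` loses nothing. All identities
for `R.odd` below are checked after multiplying by `y`. -/
lemma R.X_mul_divX_sub_refl (f : R) :
    X * (C (1 / 2) * (f - R.refl f)).divX = C (1 / 2) * (f - R.refl f) := by
  have h : (C (1 / 2) * (f - R.refl f)).coeff 0 = 0 := by
    simp [R.refl, Polynomial.coeff_zero_eq_eval_zero, ← Polynomial.comp_eq_aeval]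
  conv_rhs => rw [← Polynomial.divX_mul_X_add (C (1 / 2) * (f - R.refl f))]
  rw [h]; simp [mul_comm]

/-- The odd part of a polynomial, divided by `y`. -/
def R.odd : R →ₗ[R₁] R where
  toFun f := (C (1 / 2) * (f - R.refl f)).divX
  map_add' f g := by
    refine mul_left_cancel₀ (Polynomial.X_ne_zero (R := ℚ)) ?_
    rw [mul_add, R.X_mul_divX_sub_refl, R.X_mul_divX_sub_refl, R.X_mul_divX_sub_refl, map_add]
    ring
  map_smul' r f := by
    refine mul_left_cancel₀ (Polynomial.X_ne_zero (R := ℚ)) ?_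
    rw [RingHom.id_apply, show ∀ g : R, r • g = (r : R) * g from fun _ => rfl,
      show ∀ g : R, r • g = (r : R) * g from fun _ => rfl, mul_left_comm,
      R.X_mul_divX_sub_refl, R.X_mul_divX_sub_refl, map_mul, R.refl_of_mem]
    ring

lemma R.X_mul_odd (f : R) : X * R.odd f = C (1 / 2) * (f - R.refl f) := R.X_mul_divX_sub_refl f

lemma R.C_half : (2 : R) * C (1 / 2) = 1 := by
  rw [← map_ofNat C 2, ← C_mul]; norm_num

lemma R.odd_X_mul (f : R) : R.odd (X * f) = R.even f := by
  refine mul_left_cancel₀ (Polynomial.X_ne_zero (R := ℚ)) ?_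
  rw [R.X_mul_odd, R.even_apply, map_mul, R.refl_X]
  ring

lemma R.even_X_mul (f : R) : R.even (X * f) = X ^ 2 * R.odd f := by
  rw [pow_two, mul_assoc, R.X_mul_odd, R.even_apply, map_mul, R.refl_X]
  ring

lemma R.even_one : R.even 1 = 1 := by
  rw [R.even_apply, map_one]
  linear_combination R.C_half

lemma R.odd_one : R.odd 1 = 0 := by
  refine mul_left_cancel₀ (Polynomial.X_ne_zero (R := ℚ)) ?_
  rw [R.X_mul_odd, map_one]
  ring

/-- Multiplication by `y` exchanges the two parts, up to a factor `y²` in one direction, so both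
claims have to be carried through the induction together. -/
lemma R.even_mem_odd_mem_pow (k : ℕ) :
    R.even (X ^ k) ∈ R.deg (2 * k) ∧ R.odd (X ^ k) ∈ R.deg (2 * k - 2) := by
  induction k with
  | zero => simpa [R.even_one, R.odd_one] using R.one_mem_deg
  | succ k ih =>
    rw [pow_succ', R.even_X_mul, R.odd_X_mul]
    have := R.mul_mem_deg (R.mem_deg 2) ih.2
    refine ⟨?_, ?_⟩
    · rwa [show ((2 : ℤ) * (2 : ℕ) + (2 * k - 2)) = 2 * (k + 1 : ℕ) by push_cast; ring] at this
    · rw [show (2 * ((k + 1 : ℕ) : ℤ) - 2) = 2 * k by push_cast; ring]; exact ih.1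

lemma R.even_mem {i : ℤ} {f : R} (hf : f ∈ R.deg i) : R.even f ∈ R.deg i := by
  have : R.deg i ≤ (R.deg i).comap (R.even.restrictScalars ℚ) := by
    refine Submodule.span_le.2 ?_
    rintro _ ⟨k, rfl, rfl⟩
    exact (R.even_mem_odd_mem_pow k).1
  exact this hf

lemma R.odd_mem {i : ℤ} {f : R} (hf : f ∈ R.deg i) : R.odd f ∈ R.deg (i - 2) := by
  have : R.deg i ≤ (R.deg (i - 2)).comap (R.odd.restrictScalars ℚ) := by
    refine Submodule.span_le.2 ?_
    rintro _ ⟨k, rfl, rfl⟩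
    exact (R.even_mem_odd_mem_pow k).2
  exact this hf

/-! ### Coordinates on `R ⊗_{R₁} R` -/

namespace BRing

lemma induction {p : BRing → Prop} (t : BRing) (mul : ∀ a b, p (inl a * inr b))
    (add : ∀ t u, p t → p u → p (t + u)) : p t := by
  have h : ∀ a b, tmul a b = inl a * inr b := fun a b => by
    rw [inl_apply, inr_apply, tmul_mul_tmul, mul_one, one_mul]
  refine TensorProduct.induction_on (R := R₁) (M := R) (N := R) (motive := p) t ?_
    (fun a b => by
      change p (BRing.tmul a b)
      rw [h]; exact mul a b) add
  have := mul 0 0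
  rwa [map_zero, zero_mul] at this

/-- The left `R`-linear extension of an `R₁`-linear map `R ⟶ R` to `R ⊗_{R₁} R`. -/
def lcoord (P : R →ₗ[R₁] R) : BRing →ₗ[ℚ] R :=
  (LinearMap.mul' R₁ R ∘ₗ TensorProduct.map LinearMap.id P).restrictScalars ℚ

/-- The right `R`-linear extension of an `R₁`-linear map `R ⟶ R` to `R ⊗_{R₁} R`. -/
def rcoord (P : R →ₗ[R₁] R) : BRing →ₗ[ℚ] R :=
  (LinearMap.mul' R₁ R ∘ₗ TensorProduct.map P LinearMap.id).restrictScalars ℚ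

lemma inl_mul_inr (a b : R) : inl a * inr b = tmul a b := by
  rw [inl_apply, inr_apply, tmul_mul_tmul, mul_one, one_mul]

lemma lcoord_inl_mul_inr (P : R →ₗ[R₁] R) (a b : R) : lcoord P (inl a * inr b) = a * P b := by
  rw [inl_mul_inr]; rfl

lemma rcoord_inl_mul_inr (P : R →ₗ[R₁] R) (a b : R) : rcoord P (inl a * inr b) = P a * b := by
  rw [inl_mul_inr]; rfl

lemma lcoord_inl_mul (P : R →ₗ[R₁] R) (a : R) (t : BRing) :
    lcoord P (inl a * t) = a * lcoord P t := by
  induction t using BRing.induction with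
  | mul b c => rw [← mul_assoc, ← map_mul, lcoord_inl_mul_inr, lcoord_inl_mul_inr, mul_assoc]
  | add t u ht hu => rw [mul_add, map_add, map_add, ht, hu, mul_add]

lemma rcoord_inr_mul (P : R →ₗ[R₁] R) (a : R) (t : BRing) :
    rcoord P (inr a * t) = a * rcoord P t := by
  induction t using BRing.induction with
  | mul b c =>
    rw [mul_left_comm, ← map_mul, rcoord_inl_mul_inr, rcoord_inl_mul_inr, mul_left_comm]
  | add t u ht hu => rw [mul_add, map_add, map_add, ht, hu, mul_add]

lemma lcoord_even_X_mul (t : BRing) :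
    lcoord R.even (inr X * t) = X ^ 2 * lcoord R.odd t := by
  induction t using BRing.induction with
  | mul b c =>
    rw [mul_left_comm, ← map_mul, lcoord_inl_mul_inr, lcoord_inl_mul_inr, R.even_X_mul,
      mul_left_comm]
  | add t u ht hu => rw [mul_add, map_add, map_add, ht, hu, mul_add]

lemma lcoord_odd_X_mul (t : BRing) : lcoord R.odd (inr X * t) = lcoord R.even t := by
  induction t using BRing.induction with
  | mul b c =>
    rw [mul_left_comm, ← map_mul, lcoord_inl_mul_inr, lcoord_inl_mul_inr, R.odd_X_mul]
  | add t u ht hu => rw [mul_add, map_add, map_add, ht, hu]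

lemma rcoord_even_X_mul (t : BRing) :
    rcoord R.even (inl X * t) = X ^ 2 * rcoord R.odd t := by
  induction t using BRing.induction with
  | mul b c =>
    rw [← mul_assoc, ← map_mul, rcoord_inl_mul_inr, rcoord_inl_mul_inr, R.even_X_mul, mul_assoc]
  | add t u ht hu => rw [mul_add, map_add, map_add, ht, hu, mul_add]

lemma rcoord_odd_X_mul (t : BRing) : rcoord R.odd (inl X * t) = rcoord R.even t := by
  induction t using BRing.induction with
  | mul b c =>
    rw [← mul_assoc, ← map_mul, rcoord_inl_mul_inr, rcoord_inl_mul_inr, R.odd_X_mul]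
  | add t u ht hu => rw [mul_add, map_add, map_add, ht, hu]

lemma lcoord_even_one : lcoord R.even 1 = 1 := by
  have := lcoord_inl_mul_inr R.even 1 1
  rwa [map_one, map_one, mul_one, one_mul, R.even_one] at this

lemma lcoord_odd_one : lcoord R.odd 1 = 0 := by
  have := lcoord_inl_mul_inr R.odd 1 1
  rwa [map_one, map_one, mul_one, one_mul, R.odd_one] at this

lemma rcoord_even_one : rcoord R.even 1 = 1 := by
  have := rcoord_inl_mul_inr R.even 1 1
  rwa [map_one, map_one, mul_one, mul_one, R.even_one] at this

lemma rcoord_odd_one : rcoord R.odd 1 = 0 := by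
  have := rcoord_inl_mul_inr R.odd 1 1
  rwa [map_one, map_one, mul_one, mul_one, R.odd_one] at this

/-- Even polynomials pass through the tensor sign: from `f = f₀ + f₁ y` with `f₀, f₁ ∈ R₁` one gets
`1 ⊗ f = f₀ ⊗ 1 + f₁ ⊗ y`. The induction on powers of `y` uses only `y² ⊗ 1 = 1 ⊗ y²`. -/
lemma inr_eq (f : R) : inr f = inl (R.even f) + inl (R.odd f) * inr X := by
  induction f using Polynomial.induction_on' with
  | add p q hp hq =>
    rw [map_add, map_add, map_add, map_add, map_add]
    linear_combination hp + hq
  | monomial n c =>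
    rw [← Polynomial.C_mul_X_pow_eq_monomial, ← Polynomial.smul_eq_C_mul,
      map_rat_smul R.even, map_rat_smul R.odd, map_smul, map_smul, map_smul, smul_mul_assoc,
      ← smul_add]
    congr 1
    induction n with
    | zero => rw [pow_zero, R.even_one, R.odd_one, map_one, map_one, map_zero, zero_mul, add_zero]
    | succ n ih =>
      have h := inl_X_sq
      rw [map_pow inr] at h
      rw [pow_succ', R.even_X_mul, R.odd_X_mul, map_mul, map_mul, ih, h]
      ring

/-- As a left `R`-module, `B₁` has the basis `1 ⊗ 1, 1 ⊗ y`. This is the spanning half; the values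
of the coordinates on these elements give independence. -/
lemma eq_lcoord (t : BRing) :
    t = inl (lcoord R.even t) + inl (lcoord R.odd t) * inr X := by
  induction t using BRing.induction with
  | mul a b =>
    rw [lcoord_inl_mul_inr, lcoord_inl_mul_inr, map_mul, map_mul]
    linear_combination inl a * inr_eq b
  | add t u ht hu =>
    rw [map_add, map_add, map_add, map_add]
    linear_combination ht + hu

lemma lcoord_even_mem {i : ℤ} {t : BRing} (ht : t ∈ gr i) : lcoord R.even t ∈ R.deg i := by
  have : gr i ≤ (R.deg i).comap (lcoord R.even) := by
    refine Submodule.span_le.2 ?_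
    rintro _ ⟨k, l, rfl, x, hx, y, hy, rfl⟩
    exact R.mul_mem_deg hx (R.even_mem hy)
  exact this ht

lemma lcoord_odd_mem {i : ℤ} {t : BRing} (ht : t ∈ gr i) : lcoord R.odd t ∈ R.deg (i - 2) := by
  have : gr i ≤ (R.deg (i - 2)).comap (lcoord R.odd) := by
    refine Submodule.span_le.2 ?_
    rintro _ ⟨k, l, rfl, x, hx, y, hy, rfl⟩
    have := R.mul_mem_deg hx (R.odd_mem hy)
    rwa [← add_sub_assoc] at this
  exact this ht

lemma rcoord_even_mem {i : ℤ} {t : BRing} (ht : t ∈ gr i) : rcoord R.even t ∈ R.deg i := by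
  have : gr i ≤ (R.deg i).comap (rcoord R.even) := by
    refine Submodule.span_le.2 ?_
    rintro _ ⟨k, l, rfl, x, hx, y, hy, rfl⟩
    exact R.mul_mem_deg (R.even_mem hx) hy
  exact this ht

lemma rcoord_odd_mem {i : ℤ} {t : BRing} (ht : t ∈ gr i) : rcoord R.odd t ∈ R.deg (i - 2) := by
  have : gr i ≤ (R.deg (i - 2)).comap (rcoord R.odd) := by
    refine Submodule.span_le.2 ?_
    rintro _ ⟨k, l, rfl, x, hx, y, hy, rfl⟩
    have := R.mul_mem_deg (R.odd_mem hx) hy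
    rwa [sub_add_eq_add_sub] at this
  exact this ht

lemma one_mem_gr : (1 : BRing) ∈ gr 0 := by
  have := inl_mem R.one_mem_deg
  rwa [map_one] at this

lemma one_ne_zero : (1 : BRing) ≠ 0 := fun h => by
  have := congrArg (lcoord R.even) h
  rw [lcoord_even_one, map_zero] at this
  exact _root_.one_ne_zero this

end BRing

/-! ### Maps out of `B₁` and of tensor products with `B₁` -/

namespace GrMod

lemma gen_B : Gen B (1 : BRing) := by
  intro p h1 hp (t : BRing)
  have hl : ∀ (s : Side) (a : R) (u : BRing), u ∈ p → B.act s a u ∈ p := by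
    intro s a u hu
    induction a using Polynomial.induction_on' with
    | add a b ha hb => rw [map_add]; exact p.add_mem ha hb
    | monomial n c =>
      rw [← Polynomial.C_mul_X_pow_eq_monomial, ← Polynomial.smul_eq_C_mul, map_smul]
      refine p.smul_mem c ?_
      induction n with
      | zero => rw [pow_zero, map_one]; exact hu
      | succ n ih => rw [pow_succ', map_mul]; exact hp s _ ih
  induction t using BRing.induction with
  | mul a b =>
    have := hl .left a _ (hl .right b _ h1)
    rwa [show B.act .left a (B.act .right b (1 : BRing)) = BRing.inl a * (BRing.inr b * 1) from rfl,
      mul_one] at this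
  | add t u ht hu => exact p.add_mem ht hu

/-- The morphism `B ⟶ M` with `1 ⊗ 1 ↦ x`. -/
def descB {M : Bimod} (x : M) (hx : x ∈ M.gr 0)
    (h : M.act .left X (M.act .left X x) = M.act .right X (M.act .right X x)) : B ⟶ M :=
  ofLin (M := B) (N := M)
    ({ toFun := fun t => M.act .left (BRing.lcoord R.even t) x +
          M.act .right X (M.act .left (BRing.lcoord R.odd t) x)
       map_add' := fun t u => by
        simp only [map_add, LinearMap.add_apply]; abel
       map_smul' := fun c t => by simp } : BRing →ₗ[ℚ] M)
    (fun s => by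
      refine map_act_of_X (M := B) (N := M) _ s s fun t => ?_
      cases s with
      | left =>
        change M.act .left (BRing.lcoord R.even (BRing.inl X * t)) x +
          M.act .right X (M.act .left (BRing.lcoord R.odd (BRing.inl X * t)) x) =
          M.act .left X (M.act .left (BRing.lcoord R.even t) x +
            M.act .right X (M.act .left (BRing.lcoord R.odd t) x))
        simp only [BRing.lcoord_inl_mul, map_mul, Module.End.mul_apply, map_add]
        rw [M.act_comm .right .left]
      | right =>
        change M.act .left (BRing.lcoord R.even (BRing.inr X * t)) x +
          M.act .right X (M.act .left (BRing.lcoord R.odd (BRing.inr X * t)) x) =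
          M.act .right X (M.act .left (BRing.lcoord R.even t) x +
            M.act .right X (M.act .left (BRing.lcoord R.odd t) x))
        simp only [BRing.lcoord_even_X_mul, BRing.lcoord_odd_X_mul, map_add, pow_two]
        -- Here `h`, the equality `y² x = x y²`, is exactly what makes the right action of `y` on
        -- the component of `1 ⊗ y` consistent.
        rw [mul_comm, map_mul, map_mul, Module.End.mul_apply, Module.End.mul_apply, h,
          M.act_comm .left .right, M.act_comm .left .right, add_comm])
    (fun i t ht => by
      refine Submodule.add_mem _ ?_ ?_
      · have := M.act_mem .left (BRing.lcoord_even_mem ht) hx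
        rwa [add_zero] at this
      · have := M.act_mem .right R.X_mem_deg (M.act_mem .left (BRing.lcoord_odd_mem ht) hx)
        rwa [show 2 + (i - 2 + 0) = i by ring] at this)

lemma descB_one {M : Bimod} (x : M) (hx) (h) : Hom.lin (descB x hx h) (1 : BRing) = x := by
  change M.act .left (BRing.lcoord R.even 1) x +
    M.act .right X (M.act .left (BRing.lcoord R.odd 1) x) = x
  rw [BRing.lcoord_even_one, BRing.lcoord_odd_one]
  simp

/-- Besides the two outer actions, `M ⊗ B₁` has a middle variable, on which morphisms of bimodules
need not be linear. Its square is the square of the right variable, so `x ⊗ 1` and `x ⊗ (y ⊗ 1)`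
together generate `M ⊗ B₁` as a bimodule. -/
lemma Gen.tensor_hom_ext {M P : Bimod} {x : M} (hx : Gen M x) {f g : tensor M B ⟶ P}
    (h0 : Hom.lin f (tm x (1 : BRing)) = Hom.lin g (tm x (1 : BRing)))
    (h1 : Hom.lin f (tm x (BRing.inl X)) = Hom.lin g (tm x (BRing.inl X))) : f = g := by
  have hact : ∀ (s : Side) (t : tensor M B), Hom.lin f t = Hom.lin g t →
      Hom.lin f ((tensor M B).act s X t) = Hom.lin g ((tensor M B).act s X t) := by
    intro s t ht
    rw [Hom.lin_act, Hom.lin_act, ht]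
  have hB : ∀ b : B, Hom.lin f (tm x b) = Hom.lin g (tm x b) := by
    intro b
    -- Agreement is required at `b` and at `y b` simultaneously; otherwise the condition would not
    -- be stable under the left action on `B`.
    let p : Submodule ℚ B :=
      { carrier := {b | Hom.lin f (tm x b) = Hom.lin g (tm x b) ∧
          Hom.lin f (tm x (B.act .left X b)) = Hom.lin g (tm x (B.act .left X b))}
        add_mem' := fun {a b} ha hb =>
          ⟨by rw [tm_add_right, map_add, map_add, ha.1, hb.1],
            by rw [map_add (B.act .left X), tm_add_right, map_add, map_add, ha.2, hb.2]⟩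
        zero_mem' := by
          have : tm x (0 : B) = 0 := by
            have := tm_smul_right 0 x (0 : B)
            rwa [zero_smul, zero_smul] at this
          simp [this]
        smul_mem' := fun c a ha =>
          ⟨by rw [tm_smul_right, map_smul, map_smul, ha.1],
            by rw [map_smul (B.act .left X), tm_smul_right, map_smul, map_smul, ha.2]⟩ }
    refine (gen_B p ⟨h0, ?_⟩ ?_ b).1
    · rw [show B.act .left X (1 : BRing) = BRing.inl X from mul_one _]; exact h1
    · rintro (_ | _) y hy
      · refine ⟨hy.2, ?_⟩
        have h2 : B.act .left X (B.act .left X y) = B.act .right X (B.act .right X y) := by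
          change BRing.inl X * (BRing.inl X * y) = BRing.inr X * (BRing.inr X * y)
          rw [← mul_assoc, ← mul_assoc, ← map_mul, ← map_mul, ← pow_two, BRing.inl_X_sq]
        rw [h2, ← act_right_tm, ← act_right_tm]
        exact hact _ _ (hact _ _ hy.1)
      · refine ⟨hact .right _ hy.1, ?_⟩
        rw [B.act_comm .left .right, ← act_right_tm]
        exact hact _ _ hy.2
  refine tm_hom_ext fun m => ?_
  let p : Submodule ℚ M :=
    { carrier := {m | ∀ b, Hom.lin f (tm m b) = Hom.lin g (tm m b)}
      add_mem' := fun {a b} ha hb c => by rw [tm_add_left, map_add, map_add, ha, hb]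
      zero_mem' := fun c => by rw [tm_zero_left, map_zero, map_zero]
      smul_mem' := fun c a ha b => by rw [tm_smul_left, map_smul, map_smul, ha] }
  refine hx p hB ?_ m
  rintro (_ | _) y hy b
  · exact hact .left _ (hy b)
  · rw [tm_act]; exact hy _

/-- The bilinear map `(b, c) ↦ (b₀ ⊗ 1)(1 ⊗ P c) + (b₁ ⊗ 1)(1 ⊗ Q c)`, where `b₀`, `b₁` are the
left coordinates of `b`. -/
def coordMap (P Q : BRing →ₗ[ℚ] R) : BRing →ₗ[ℚ] BRing →ₗ[ℚ] BRing :=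
  (LinearMap.mul ℚ BRing).compl₁₂ (BRing.inl.toLinearMap ∘ₗ BRing.lcoord R.even)
      (BRing.inr.toLinearMap ∘ₗ P) +
    (LinearMap.mul ℚ BRing).compl₁₂ (BRing.inl.toLinearMap ∘ₗ BRing.lcoord R.odd)
      (BRing.inr.toLinearMap ∘ₗ Q)

lemma coordMap_apply (P Q : BRing →ₗ[ℚ] R) (b c : BRing) :
    coordMap P Q b c = BRing.inl (BRing.lcoord R.even b) * BRing.inr (P c) +
      BRing.inl (BRing.lcoord R.odd b) * BRing.inr (Q c) := rfl

/-- The coordinate of `1 ⊗ 1 ⊗ 1` in `B ⊗_R B`, which has the left basis `1 ⊗ 1 ⊗ 1`, `1 ⊗ y ⊗ 1`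
over `B`. -/
def coord₀ : tensor B B ⟶ B :=
  -- Expand `b = b₀ + b₁ y` and `c = c₀ + y c₁`, with `y` the middle variable. The part of `b ⊗ c`
  -- even in `y` is `b₀ c₀ + b₁ c₁ y²`, and `y²` may be moved to the right variable.
  tensorDesc (M := B) (N := B) (P := B) (coordMap (BRing.rcoord R.even)
      (LinearMap.mulLeft ℚ (X ^ 2) ∘ₗ BRing.rcoord R.odd))
    (fun (b c : BRing) => by
      change coordMap _ _ (BRing.inr X * b) c = coordMap _ _ b (BRing.inl X * c)
      have h := BRing.inl_X_sq
      simp only [coordMap_apply, LinearMap.comp_apply, LinearMap.mulLeft_apply,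
        BRing.lcoord_even_X_mul, BRing.lcoord_odd_X_mul, BRing.rcoord_even_X_mul,
        BRing.rcoord_odd_X_mul, map_mul, h]
      ring)
    (fun (b c : BRing) => by
      change coordMap _ _ (BRing.inl X * b) c = BRing.inl X * coordMap _ _ b c
      simp only [coordMap_apply, BRing.lcoord_inl_mul, map_mul]
      ring)
    (fun (b c : BRing) => by
      change coordMap _ _ b (BRing.inr X * c) = BRing.inr X * coordMap _ _ b c
      simp only [coordMap_apply, BRing.rcoord_inr_mul, map_mul, LinearMap.comp_apply,
        LinearMap.mulLeft_apply]
      ring)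
    (fun i j x hx y hy => by
      refine Submodule.add_mem _ ?_ ?_
      · exact BRing.mul_mem_gr (BRing.inl_mem (BRing.lcoord_even_mem hx))
          (BRing.inr_mem (BRing.rcoord_even_mem hy))
      · have := BRing.mul_mem_gr (BRing.inl_mem (BRing.lcoord_odd_mem hx))
          (BRing.inr_mem (R.mul_mem_deg (R.mem_deg 2) (BRing.rcoord_odd_mem hy)))
        rwa [show i - 2 + (2 * ((2 : ℕ) : ℤ) + (j - 2)) = i + j by push_cast; ring] at this)

/-- The coordinate of `1 ⊗ y ⊗ 1` in `B ⊗_R B`, which has the left basis `1 ⊗ 1 ⊗ 1`, `1 ⊗ y ⊗ 1`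
over `B`. -/
def coord₁ : tensor B B ⟶ B.shift 2 :=
  -- The part odd in the middle variable is `(b₀ c₁ + b₁ c₀) y`; dropping `y` costs the shift by
  -- `2`.
  tensorDesc (M := B) (N := B) (P := B.shift 2) (coordMap (BRing.rcoord R.odd)
      (BRing.rcoord R.even))
    (fun (b c : BRing) => by
      change coordMap _ _ (BRing.inr X * b) c = coordMap _ _ b (BRing.inl X * c)
      have h := BRing.inl_X_sq
      simp only [coordMap_apply,
        BRing.lcoord_even_X_mul, BRing.lcoord_odd_X_mul, BRing.rcoord_even_X_mul,
        BRing.rcoord_odd_X_mul, map_mul, h]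
      ring)
    (fun (b c : BRing) => by
      change coordMap _ _ (BRing.inl X * b) c = BRing.inl X * coordMap _ _ b c
      simp only [coordMap_apply, BRing.lcoord_inl_mul, map_mul]
      ring)
    (fun (b c : BRing) => by
      change coordMap _ _ b (BRing.inr X * c) = BRing.inr X * coordMap _ _ b c
      simp only [coordMap_apply, BRing.rcoord_inr_mul, map_mul]
      ring)
    (fun i j x hx y hy => by
      refine Submodule.add_mem _ ?_ ?_
      · have := BRing.mul_mem_gr (BRing.inl_mem (BRing.lcoord_even_mem hx))
          (BRing.inr_mem (BRing.rcoord_odd_mem hy))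
        rwa [← add_sub_assoc] at this
      · have := BRing.mul_mem_gr (BRing.inl_mem (BRing.lcoord_odd_mem hx))
          (BRing.inr_mem (BRing.rcoord_even_mem hy))
        rwa [sub_add_eq_add_sub] at this)

lemma coord₀_tm (b c : BRing) : Hom.lin coord₀ (tm (M := B) (N := B) b c) =
    coordMap (BRing.rcoord R.even) (LinearMap.mulLeft ℚ (X ^ 2) ∘ₗ BRing.rcoord R.odd) b c := rfl

lemma coord₁_tm (b c : BRing) : Hom.lin coord₁ (tm (M := B) (N := B) b c) =
    coordMap (BRing.rcoord R.odd) (BRing.rcoord R.even) b c := rfl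

end GrMod

end

section

open GrMod

/-! ### The minimal complex -/

/-- A module shifted by `0`. -/
def shiftZero {S : Type} (M : GrMod S) : M.shift 0 ≅ M where
  hom := ofLin (M := M.shift 0) (N := M) LinearMap.id (fun _ _ _ => rfl)
    (fun i x hx => (congrArg (x ∈ M.gr ·) (sub_zero i)).mp hx)
  inv := ofLin (M := M) (N := M.shift 0) LinearMap.id (fun _ _ _ => rfl)
    (fun i x hx => (congrArg (x ∈ M.gr ·) (sub_zero i)).mpr hx)
  hom_inv_id := rfl
  inv_hom_id := rfl

open ZeroObject in
/-- The term of the minimal complex of `σ₁ⁿ` in cohomological degree `-m`. -/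
def minX : ℕ → ℕ → Bimod
  | 0, 0 => ring Side
  | 0, _ + 1 => 0
  | _ + 1, 0 => B
  | n + 1, m + 1 => (minX n m).shift 2

/-- The generator of the last term of the minimal complex. -/
def minGen : ∀ n, minX n 0
  | 0 => (1 : R)
  | _ + 1 => (1 : BRing)

lemma gen_minGen : ∀ n, Gen (minX n 0) (minGen n)
  | 0 => gen_ring .left
  | _ + 1 => gen_B

lemma minGen_mem : ∀ n, minGen n ∈ (minX n 0).gr 0
  | 0 => R.one_mem_deg
  | _ + 1 => BRing.one_mem_gr

lemma minX_act_sq : ∀ n (x : minX n 0), (minX n 0).act .left X ((minX n 0).act .left X x) =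
    (minX n 0).act .right X ((minX n 0).act .right X x)
  | 0, _ => rfl
  | _ + 1, (x : BRing) => by
    change BRing.inl X * (BRing.inl X * x) = BRing.inr X * (BRing.inr X * x)
    rw [← mul_assoc, ← mul_assoc, ← map_mul, ← map_mul, ← pow_two, BRing.inl_X_sq]

/-- The sign `(-1)ⁿ`. -/
def ysgn (n : ℕ) : ℚ := (-1) ^ n

/-- The element `1 ⊗ y + (-1)ⁿ y ⊗ 1`. -/
def ysum (n : ℕ) : BRing := BRing.inr X + ysgn n • BRing.inl X

lemma ysum_mem (n : ℕ) : ysum n ∈ BRing.gr 2 :=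
  Submodule.add_mem _ (BRing.inr_mem R.X_mem_deg)
    (Submodule.smul_mem _ _ (BRing.inl_mem R.X_mem_deg))

lemma ysum_zero : ysum 0 = yPlus := by
  rw [ysum, ysgn, pow_zero, one_smul]; rfl

lemma ysgn_succ (n : ℕ) : ysgn (n + 1) = -ysgn n := by rw [ysgn, pow_succ, ysgn]; ring

lemma ysgn_mul_self (n : ℕ) : ysgn n * ysgn n = 1 := by
  rw [ysgn, ← mul_pow]; norm_num

/-- Consecutive signs are opposite, so the product is the difference of squares `1 ⊗ y² - y² ⊗ 1`,
which vanishes over `R₁`. -/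
lemma ysum_mul_ysum_succ (n : ℕ) : ysum n * ysum (n + 1) = 0 := by
  have h := BRing.inl_X_sq
  rw [map_pow, map_pow] at h
  have h2 : (ysgn n • BRing.inl X) * (ysgn n • BRing.inl X) = BRing.inr X ^ 2 := by
    rw [smul_mul_smul_comm, ysgn_mul_self, one_smul, ← pow_two, h]
  rw [ysum, ysum, ysgn_succ, neg_smul]
  linear_combination -h2

/-- The differential of the complex of `σ₁`. -/
def rbB : (ring Side).shift 2 ⟶ B := rb (s := 2) (t := 0) rfl ≫ (shiftZero B).hom

lemma rbB_one : Hom.lin rbB (1 : R) = ysum 0 := by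
  change BRing.inl 1 * yPlus = ysum 0
  rw [map_one, one_mul, ysum_zero]

/-- The last differential of the minimal complex of `σ₁ⁿ⁺¹`, sending the generator to `ysum n`. -/
def minLast : ∀ n, (minX n 0).shift 2 ⟶ B
  | 0 => rbB
  | n + 1 => mulB (s := 2) (t := 0) (ysum (n + 1)) (ysum_mem _) ≫ (shiftZero B).hom

lemma minLast_gen : ∀ n, Hom.lin (minLast n) (minGen n) = ysum n
  | 0 => rbB_one
  | n + 1 => mul_one (ysum (n + 1))

/-- The differentials of the minimal complex. -/
def minDiff : ∀ n m, minX n (m + 1) ⟶ minX n m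
  | 0, _ => 0
  | n + 1, 0 => minLast n
  | n + 1, m + 1 => shiftHom 2 (minDiff n m)

/-- Only the last two differentials need an argument: their composite sends the generator to `ysum
(n + 1) * ysum n`. All other composites are shifts of composites in the complex for `n - 1`. -/
lemma minDiff_comp : ∀ n m, minDiff n (m + 1) ≫ minDiff n m = 0
  | 0, _ => Limits.comp_zero
  | 1, 0 => by
    change shiftHom 2 (0 : minX 0 1 ⟶ minX 0 0) ≫ minLast 0 = 0
    rw [shiftHom_zero, Limits.zero_comp]
  | n + 2, 0 => (gen_minGen n).hom_ext (M := ((minX n 0).shift 2).shift 2) (N := B) (by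
      change ysum (n + 1) * (Hom.lin (minLast n) (minGen n) : BRing) = 0
      rw [minLast_gen, mul_comm, ysum_mul_ysum_succ])
  | n + 1, m + 1 => by
    change shiftHom 2 (minDiff n (m + 1)) ≫ shiftHom 2 (minDiff n m) = 0
    rw [← shiftHom_comp, minDiff_comp n m, shiftHom_zero]

/-! ### Contracting the minimal complex after tensoring with `B` -/

/-- The multiplication `B{2} ⟶ B` by `(-1)ⁿ y ⊗ 1`. -/
def mulY (n : ℕ) : B.shift 2 ⟶ B :=
  mulB (s := 2) (t := 0) (ysgn n • BRing.inl X)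
    (Submodule.smul_mem _ _ (BRing.inl_mem R.X_mem_deg)) ≫ (shiftZero B).hom

/-- The map `b ⊗ c ↦ b(y, (-1)ⁿ y) c((-1)ⁿ y, z)` (for `n = 0`, multiplication). -/
def minEv : ∀ n, tensor (minX n 0) B ⟶ B
  | 0 => (leftUnit B).hom
  | n + 1 => coord₀ + coord₁ ≫ mulY (n + 1)

lemma lcoord_even_ysum (n : ℕ) : BRing.lcoord R.even (ysum n) = ysgn n • X := by
  have h1 := BRing.lcoord_even_X_mul 1
  have h2 := BRing.lcoord_inl_mul R.even X 1
  rw [mul_one, BRing.lcoord_odd_one, mul_zero] at h1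
  rw [mul_one, BRing.lcoord_even_one, mul_one] at h2
  rw [ysum, map_add, map_smul, h1, h2, zero_add]

lemma lcoord_odd_ysum (n : ℕ) : BRing.lcoord R.odd (ysum n) = 1 := by
  have h1 := BRing.lcoord_odd_X_mul 1
  have h2 := BRing.lcoord_inl_mul R.odd X 1
  rw [mul_one, BRing.lcoord_even_one] at h1
  rw [mul_one, BRing.lcoord_odd_one, mul_zero] at h2
  rw [ysum, map_add, map_smul, h1, h2, smul_zero, add_zero]

lemma coord₀_tm_one (b : BRing) : Hom.lin coord₀ (tm (M := B) (N := B) b (1 : BRing)) =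
    BRing.inl (BRing.lcoord R.even b) := by
  rw [coord₀_tm, coordMap_apply, LinearMap.comp_apply, BRing.rcoord_even_one, BRing.rcoord_odd_one]
  simp

lemma coord₁_tm_one (b : BRing) : Hom.lin coord₁ (tm (M := B) (N := B) b (1 : BRing)) =
    BRing.inl (BRing.lcoord R.odd b) := by
  rw [coord₁_tm, coordMap_apply, BRing.rcoord_even_one, BRing.rcoord_odd_one]
  simp

lemma coord₀_tm_X (b : BRing) : Hom.lin coord₀ (tm (M := B) (N := B) b (BRing.inl X)) =
    BRing.inl (BRing.lcoord R.odd b) * BRing.inr (X ^ 2) := by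
  have h1 := BRing.rcoord_even_X_mul 1
  have h2 := BRing.rcoord_odd_X_mul 1
  rw [mul_one, BRing.rcoord_odd_one, mul_zero] at h1
  rw [mul_one, BRing.rcoord_even_one] at h2
  rw [coord₀_tm, coordMap_apply, LinearMap.comp_apply, h1, h2]
  simp

lemma coord₁_tm_X (b : BRing) : Hom.lin coord₁ (tm (M := B) (N := B) b (BRing.inl X)) =
    BRing.inl (BRing.lcoord R.even b) := by
  have h1 := BRing.rcoord_even_X_mul 1
  have h2 := BRing.rcoord_odd_X_mul 1
  rw [mul_one, BRing.rcoord_odd_one, mul_zero] at h1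
  rw [mul_one, BRing.rcoord_even_one] at h2
  rw [coord₁_tm, coordMap_apply, h1, h2]
  simp

lemma minEv_succ_apply (n : ℕ) (t : tensor B B) : Hom.lin (minEv (n + 1)) t =
    Hom.lin coord₀ t + (ysgn (n + 1) • BRing.inl X) * (Hom.lin coord₁ t : BRing) := rfl

lemma minEv_one : ∀ n, Hom.lin (minEv n) (tm (minGen n) (1 : BRing)) = (1 : BRing)
  | 0 => by
    change BRing.inl 1 * (1 : BRing) = 1
    rw [map_one, one_mul]
  | n + 1 => by
    refine (minEv_succ_apply n (tm (M := B) (N := B) (1 : BRing) (1 : BRing))).trans ?_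
    rw [coord₀_tm_one, coord₁_tm_one, BRing.lcoord_even_one, BRing.lcoord_odd_one, map_one,
      map_zero, mul_zero, add_zero]

lemma minEv_X : ∀ n, Hom.lin (minEv n) (tm (minGen n) (BRing.inl X)) =
    (ysgn n • BRing.inl X : BRing)
  | 0 => by
    change BRing.inl 1 * BRing.inl X = _
    rw [map_one, one_mul, ysgn, pow_zero, one_smul]
  | n + 1 => by
    refine (minEv_succ_apply n (tm (M := B) (N := B) (1 : BRing) (BRing.inl X))).trans ?_
    rw [coord₀_tm_X, coord₁_tm_X, BRing.lcoord_even_one, BRing.lcoord_odd_one, map_one,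
      map_zero, zero_mul, zero_add, mul_one]

/-- The map `B ⟶ X ⊗_R B`, `1 ⊗ 1 ↦ g ⊗ (1 ⊗ 1)`, where `g` generates the last term `X` of the
minimal complex. -/
def minUnit (n : ℕ) : B ⟶ tensor (minX n 0) B :=
  descB (M := tensor (minX n 0) B) (tm (minGen n) (1 : BRing))
    (by have := tm_mem (N := B) (minGen_mem n) BRing.one_mem_gr
        rwa [add_zero] at this)
    (by
      rw [act_left_tm, act_left_tm, minX_act_sq, tm_act, tm_act, act_right_tm, act_right_tm]
      congr 1
      change BRing.inl X * (BRing.inl X * 1) = BRing.inr X * (BRing.inr X * 1)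
      rw [← mul_assoc, ← mul_assoc, ← map_mul, ← map_mul, ← pow_two, BRing.inl_X_sq])

lemma minUnit_one (n : ℕ) :
    Hom.lin (minUnit n) (1 : BRing) = tm (minGen n) (1 : BRing) := descB_one _ _ _

lemma minUnit_inl_X (n : ℕ) : Hom.lin (minUnit n) (BRing.inl X) =
    (tensor (minX n 0) B).act .left X (tm (minGen n) (1 : BRing)) := by
  rw [← minUnit_one, ← Hom.lin_act]
  exact congrArg (Hom.lin (minUnit n)) (mul_one (BRing.inl X)).symm

lemma minUnit_minEv (n : ℕ) : minUnit n ≫ minEv n = 𝟙 B :=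
  gen_B.hom_ext (by rw [lin_comp_apply, minUnit_one, minEv_one]; rfl)

/-- Whiskering by `B`. -/
def tensB {M N : Bimod} (f : M ⟶ N) : tensor M B ⟶ tensor N B := tensorMap f (𝟙 B)

lemma tensB_tm {M N : Bimod} (f : M ⟶ N) (x : M) (b : B) :
    Hom.lin (tensB f) (tm x b) = tm (Hom.lin f x) b := rfl

lemma tensB_zero {M N : Bimod} : tensB (0 : M ⟶ N) = 0 := tm_hom_ext fun _ _ => tm_zero_left _

lemma tensB_shiftHom {M N : Bimod} (k : ℤ) (f : M ⟶ N) : tensB (shiftHom k f) =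
    (tensorShift M B k).inv ≫ shiftHom k (tensB f) ≫ (tensorShift N B k).hom :=
  tensorMap_shiftHom k f (𝟙 B)

/-- The contracting homotopy on the tensor product of the minimal complex with `B`. -/
def minHtpy : ∀ n m, tensor (minX n m) B ⟶ tensor (minX n (m + 1)) B
  | 0, _ => 0
  | n + 1, 0 => coord₁ ≫ shiftHom 2 (minUnit n) ≫ (tensorShift (minX n 0) B 2).hom
  | n + 1, m + 1 => (tensorShift (minX n m) B 2).inv ≫ shiftHom 2 (minHtpy n m) ≫
      (tensorShift (minX n (m + 1)) B 2).hom

/-- The last differential for `n + 1` contributes the middle variable plus `(-1)ⁿ` times the left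
one, and evaluation replaces the middle variable by `(-1)ⁿ⁺¹` times the left one. The check on the
second generator multiplies this by the middle variable. -/
lemma tensB_minDiff_minEv : ∀ n, tensB (minDiff n 0) ≫ minEv n = 0
  | 0 => by
    change tensB 0 ≫ _ = 0
    rw [tensB_zero, Limits.zero_comp]
  | n + 1 => by
    have hg : Gen ((minX n 0).shift 2) (minGen n) := gen_minGen n
    refine hg.tensor_hom_ext ?_ ?_
    · refine (minEv_succ_apply n (tm (M := B) (N := B) (Hom.lin (minLast n) (minGen n))
        (1 : BRing))).trans ?_
      rw [minLast_gen, coord₀_tm_one, coord₁_tm_one, lcoord_even_ysum, lcoord_odd_ysum, map_one,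
        mul_one, ysgn_succ, map_smul, neg_smul, add_neg_cancel]
      rfl
    · refine (minEv_succ_apply n (tm (M := B) (N := B) (Hom.lin (minLast n) (minGen n))
        (BRing.inl X))).trans ?_
      rw [minLast_gen, coord₀_tm_X, coord₁_tm_X, lcoord_even_ysum, lcoord_odd_ysum, map_one,
        one_mul, ysgn_succ, map_smul, neg_smul, neg_mul, smul_mul_smul_comm, ysgn_mul_self,
        one_smul, ← BRing.inl_X_sq, map_pow, pow_two, add_neg_cancel]
      rfl

/-- This links the homotopy for `n + 1` with the evaluation for `n`: in `b · (y + (-1)ⁿ x)`, with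
`x` left and `y` middle, the coefficient of `y` is `1` for `b = 1` and `(-1)ⁿ x` for `b = y`. These
are the values of evaluation at `y = (-1)ⁿ x`. -/
lemma tensB_minLast_coord₁ (n : ℕ) : tensB (minLast n) ≫ coord₁ =
    (tensorShift (minX n 0) B 2).inv ≫ shiftHom 2 (minEv n) := by
  have hg : Gen ((minX n 0).shift 2) (minGen n) := gen_minGen n
  refine hg.tensor_hom_ext ?_ ?_
  · change Hom.lin coord₁ (tm (M := B) (N := B) (Hom.lin (minLast n) (minGen n)) (1 : BRing)) =
      Hom.lin (minEv n) (tm (minGen n) (1 : BRing))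
    rw [minLast_gen, coord₁_tm_one, lcoord_odd_ysum, minEv_one, map_one]
  · change Hom.lin coord₁ (tm (M := B) (N := B) (Hom.lin (minLast n) (minGen n)) (BRing.inl X)) =
      Hom.lin (minEv n) (tm (minGen n) (BRing.inl X))
    rw [minLast_gen, coord₁_tm_X, lcoord_even_ysum, minEv_X, map_smul]

lemma shiftHom_minUnit_one (n : ℕ) : Hom.lin (shiftHom 2 (minUnit n) ≫
    (tensorShift (minX n 0) B 2).hom ≫ tensB (minLast n)) (1 : BRing) =
      tm (M := B) (N := B) (ysum n) (1 : BRing) := by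
  change Hom.lin (tensB (minLast n)) (Hom.lin (tensorShift (minX n 0) B 2).hom
    (Hom.lin (minUnit n) (1 : BRing))) = _
  rw [minUnit_one, tensorShift_hom_tm]
  refine (tensB_tm (minLast n) (minGen n) (1 : BRing)).trans ?_
  rw [minLast_gen]

/-- The splitting `B₁ ⊗ B₁ = B₁{2} ⊕ B₁` in the basis formed by `1` and the middle variable `y` plus
`(-1)ⁿ` times the left variable `x`: one has `y = (y + (-1)ⁿ x) + (-1)ⁿ⁺¹ x`. It is stated for
arbitrary `θ`, `ε`, `υ` with prescribed values, so that the recursive definitions need not be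
unfolded. -/
lemma coord₁_comp_add {n : ℕ} {θ : B.shift 2 ⟶ tensor B B} {ε : tensor B B ⟶ B}
    {υ : B ⟶ tensor B B} (hθ : Hom.lin θ (1 : BRing) = tm (M := B) (N := B) (ysum n) (1 : BRing))
    (hε : Hom.lin ε (tm (M := B) (N := B) (1 : BRing) (1 : BRing)) = (1 : BRing))
    (hε' : Hom.lin ε (tm (M := B) (N := B) (1 : BRing) (BRing.inl X)) =
      (ysgn (n + 1) • BRing.inl X : BRing))
    (hυ : Hom.lin υ (1 : BRing) = tm (M := B) (N := B) (1 : BRing) (1 : BRing)) :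
    coord₁ ≫ θ + ε ≫ υ = 𝟙 (tensor B B) := by
  refine gen_B.tensor_hom_ext ?_ ?_
  · rw [lin_add, LinearMap.add_apply, lin_comp_apply, lin_comp_apply, coord₁_tm_one,
      BRing.lcoord_odd_one, map_zero, map_zero, hε, hυ, zero_add]
    rfl
  · have h1 : tm (M := B) (N := B) (BRing.inr X) (1 : BRing) = tm (1 : BRing) (BRing.inl X) := by
      have := tm_act (M := B) (N := B) X (1 : BRing) (1 : BRing)
      rw [BRing.act_right, BRing.act_left] at this
      rwa [mul_one, mul_one] at this
    have h2 : Hom.lin υ (BRing.inl X) = tm (M := B) (N := B) (BRing.inl X) (1 : BRing) := by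
      have := Hom.lin_act υ .left X (1 : BRing)
      rw [hυ, act_left_tm, BRing.act_left] at this
      rwa [mul_one] at this
    rw [lin_add, LinearMap.add_apply, lin_comp_apply, lin_comp_apply, coord₁_tm_X,
      BRing.lcoord_even_one, map_one, hε', map_smul, h2, hθ, ysum, tm_add_left, tm_smul_left,
      h1, ysgn_succ, neg_smul, add_neg_cancel_right]
    rfl

/-- The homotopy identity in degree `0`, where the correction term is the projection onto the copy
of `B₁`. For `n = 0` the homotopy vanishes and evaluation is the unit isomorphism. -/
lemma minHtpy_comp_zero : ∀ n, minHtpy n 0 ≫ tensB (minDiff n 0) + minEv n ≫ minUnit n = 𝟙 _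
  | 0 => by
    change (0 : tensor (minX 0 0) B ⟶ tensor (minX 0 1) B) ≫ _ + _ = _
    rw [Limits.zero_comp, zero_add]
    refine (gen_minGen 0).tensor_hom_ext ?_ ?_
    · rw [lin_comp_apply, minEv_one, minUnit_one]; rfl
    · rw [lin_comp_apply, minEv_X, map_smul, minUnit_inl_X, ysgn, pow_zero, one_smul]
      change tm (M := ring Side) (N := B) ((ring Side).act .right X (1 : R)) (1 : BRing) = _
      rw [tm_act]
      exact congrArg (tm (M := ring Side) (N := B) (1 : R)) (mul_one (BRing.inl X))
  | n + 1 => by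
    exact coord₁_comp_add (n := n) (shiftHom_minUnit_one n) (minEv_one (n + 1)) (minEv_X (n + 1))
      (minUnit_one (n + 1))

lemma isZero_tensor_left {M N : Bimod} (hM : IsZero M) : IsZero (tensor M N) :=
  (tensorFunctor.flip.obj N).map_isZero hM

lemma shiftHom_add {M N : Bimod} (k : ℤ) (f g : M ⟶ N) :
    shiftHom k (f + g) = shiftHom k f + shiftHom k g := rfl

lemma shiftHom_id (M : Bimod) (k : ℤ) : shiftHom k (𝟙 M) = 𝟙 (M.shift k) := rfl

/-- The complex for `n + 1` in degrees below `0` is the shifted complex for `n`, so the identity is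
inherited. In degree `-1` the differential followed by the new homotopy is evaluation followed by
the unit for `n`, which is the correction term of `minHtpy_comp_zero`. -/
lemma minHtpy_comp_succ : ∀ n m, minHtpy n (m + 1) ≫ tensB (minDiff n (m + 1)) +
    tensB (minDiff n m) ≫ minHtpy n m = 𝟙 _
  | 0, m => (isZero_tensor_left (isZero_zero Bimod)).eq_of_src _ _
  | n + 1, 0 => by
    change ((tensorShift (minX n 0) B 2).inv ≫ shiftHom 2 (minHtpy n 0) ≫
      (tensorShift (minX n 1) B 2).hom) ≫ tensB (shiftHom 2 (minDiff n 0)) +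
      tensB (minLast n) ≫ coord₁ ≫ shiftHom 2 (minUnit n) ≫ (tensorShift (minX n 0) B 2).hom = 𝟙 _
    rw [reassoc_of% (tensB_minLast_coord₁ n), tensB_shiftHom]
    simp only [Category.assoc, Iso.hom_inv_id_assoc]
    rw [← Preadditive.comp_add, Iso.inv_comp_eq, Category.comp_id]
    have h := congrArg (· ≫ (tensorShift (minX n 0) B 2).hom)
      (congrArg (shiftHom 2) (minHtpy_comp_zero n))
    rw [shiftHom_add, shiftHom_comp, shiftHom_comp, Preadditive.add_comp, Category.assoc,
      Category.assoc, shiftHom_id, Category.id_comp] at h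
    exact h
  | n + 1, m + 1 => by
    change ((tensorShift (minX n (m + 1)) B 2).inv ≫ shiftHom 2 (minHtpy n (m + 1)) ≫
      (tensorShift (minX n (m + 2)) B 2).hom) ≫ tensB (shiftHom 2 (minDiff n (m + 1))) +
      tensB (shiftHom 2 (minDiff n m)) ≫ (tensorShift (minX n m) B 2).inv ≫
        shiftHom 2 (minHtpy n m) ≫ (tensorShift (minX n (m + 1)) B 2).hom = 𝟙 _
    rw [tensB_shiftHom, tensB_shiftHom]
    simp only [Category.assoc, Iso.hom_inv_id_assoc]
    rw [← Preadditive.comp_add, Iso.inv_comp_eq, Category.comp_id]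
    have h := congrArg (· ≫ (tensorShift (minX n (m + 1)) B 2).hom)
      (congrArg (shiftHom 2) (minHtpy_comp_succ n m))
    rw [shiftHom_add, shiftHom_comp, shiftHom_comp, Preadditive.add_comp, Category.assoc,
      Category.assoc, shiftHom_id, Category.id_comp] at h
    exact h

/-- The source of the alternating signs: in `g ⊗ (1 ⊗ y + y ⊗ 1)` the second summand is the middle
variable, which evaluation turns into `(-1)ⁿ y ⊗ 1`. The result is the last differential for `n +
1`. -/
lemma rbB_minEv (n : ℕ) : tensorMap (𝟙 (minX n 0)) rbB ≫ minEv n =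
    (rightUnit (minX n 0) 2).hom ≫ minLast n := by
  rw [← cancel_epi (rightUnit (minX n 0) 2).inv, Iso.inv_hom_id_assoc]
  have hg : Gen ((minX n 0).shift 2) (minGen n) := gen_minGen n
  refine hg.hom_ext ?_
  rw [minLast_gen]
  change Hom.lin (minEv n) (tm (minGen n) (Hom.lin rbB (1 : R))) = _
  have h1 : Hom.lin (minEv n) (tm (minGen n) (BRing.inr X)) = BRing.inr X := by
    have h := Hom.lin_act (minEv n) .right X (tm (minGen n) (1 : BRing))
    rw [act_right_tm, minEv_one, BRing.act_right, mul_one] at h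
    exact h
  rw [rbB_one, ysum, ysgn, pow_zero, one_smul, tm_add_right, map_add, minEv_X, h1]
  rfl

end

/-! ### The equivalence `K_n ⊗ B₁ ≃ B₁` and `K_{n+1}` as a cone -/

section

open GrMod
open HomologicalComplex

/-- A homotopy given only by its components from degree `k + 1` to degree `k`. Writing all degrees
as successors matches the definition of `htpyK` by cases on the integer. -/
lemma nonempty_homotopy {V : Type*} [Category V] [Preadditive V] {K L : CochainComplex V ℤ}
    (f g : K ⟶ L) (h : ∀ k, K.X (k + 1) ⟶ L.X k)
    (comm : ∀ k, f.f (k + 1) = K.d (k + 1) (k + 1 + 1) ≫ h (k + 1) + h k ≫ L.d k (k + 1) +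
      g.f (k + 1)) : Nonempty (Homotopy f g) := by
  let H : ∀ i j, K.X i ⟶ L.X j := fun i j =>
    if hij : j + 1 = i then eqToHom (by rw [hij]) ≫ h j else 0
  have hH : ∀ k, H (k + 1) k = h k := fun k => by simp [H]
  refine ⟨{ hom := H, zero := fun i j hij => dif_neg hij, comm := fun i => ?_ }⟩
  obtain ⟨k, rfl⟩ : ∃ k, i = k + 1 := ⟨i - 1, by ring⟩
  rw [dNext_eq H (show (ComplexShape.up ℤ).Rel (k + 1) (k + 1 + 1) from rfl),
    prevD_eq H (show (ComplexShape.up ℤ).Rel k (k + 1) from rfl), hH, hH]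
  exact comm k

/-- The minimal complex of `σ₁ⁿ`. -/
def minK (n : ℕ) : CochainComplex Bimod ℤ := negComplex (minX n) (minDiff n) (minDiff_comp n)

/-- The functor `- ⊗_R B`. -/
abbrev functorB : Bimod ⥤ Bimod := tensorFunctor.flip.obj B

/-- The functor `- ⊗_R R{2}`. -/
abbrev functorR : Bimod ⥤ Bimod := tensorFunctor.flip.obj ((ring Side).shift 2)

/-- The transformation `- ⊗_R R{2} ⟶ - ⊗_R B` induced by the differential of the complex of
`σ₁`. -/
abbrev functorRB : functorR ⟶ functorB := tensorFunctor.flip.map rbB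

/-- The complex `K ⊗_R B`. -/
abbrev complexB (K : CochainComplex Bimod ℤ) : CochainComplex Bimod ℤ :=
  (functorB.mapHomologicalComplex _).obj K

/-- The complex `K ⊗_R R{2}`. -/
abbrev complexR (K : CochainComplex Bimod ℤ) : CochainComplex Bimod ℤ :=
  (functorR.mapHomologicalComplex _).obj K

/-- The map `K ⊗_R R{2} ⟶ K ⊗_R B`. -/
abbrev complexRB (K : CochainComplex Bimod ℤ) : complexR K ⟶ complexB K :=
  (NatTrans.mapHomologicalComplex functorRB _).app K

lemma complexB_minK_d (n : ℕ) (k : ℤ) :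
    (complexB (minK n)).d k (k + 1) = tensB (negD (minDiff n) k) :=
  congrArg tensB (negComplex_d k)

lemma minK_d (n : ℕ) (k : ℤ) : (minK n).d k (k + 1) = negD (minDiff n) k := negComplex_d k

lemma isZero_minK_X (n m : ℕ) : IsZero ((minK n).X (Int.ofNat (m + 1))) :=
  isZero_negX (minX n) m

/-- The map from `K ⊗_R B` to `B`, where `K` is the minimal complex. -/
def evK (n : ℕ) : complexB (minK n) ⟶ (single Bimod (ComplexShape.up ℤ) 0).obj B :=
  mkHomToSingle (K := complexB (minK n)) (j := 0) (minEv n) (by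
    rintro i hi
    obtain rfl : i = Int.negSucc 0 := by
      change i + 1 = 0 at hi
      omega
    refine Eq.trans ?_ (tensB_minDiff_minEv n)
    exact congrArg (· ≫ minEv n) (complexB_minK_d n (Int.negSucc 0)))

/-- The map from `B` to `K ⊗_R B`, where `K` is the minimal complex. -/
def unitK (n : ℕ) : (single Bimod (ComplexShape.up ℤ) 0).obj B ⟶ complexB (minK n) :=
  mkHomFromSingle (K := complexB (minK n)) (j := 0) (minUnit n) (by
    rintro i hi
    obtain rfl : i = Int.ofNat 1 := by
      change 0 + 1 = i at hi
      simp [← hi]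
    exact (functorB.map_isZero (isZero_minK_X n 0)).eq_of_tgt _ _)

/-- The homotopy contracting `K ⊗_R B` to `B`. -/
def htpyK (n : ℕ) : ∀ k : ℤ, (complexB (minK n)).X (k + 1) ⟶ (complexB (minK n)).X k
  | .ofNat _ => 0
  | .negSucc 0 => minHtpy n 0
  | .negSucc (m + 1) => minHtpy n (m + 1)

lemma evK_unitK_zero (n : ℕ) : (evK n ≫ unitK n).f 0 = minEv n ≫ minUnit n := by
  have h1 : (evK n).f 0 = minEv n ≫ (singleObjXSelf (ComplexShape.up ℤ) 0 B).inv :=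
    mkHomToSingle_f (K := complexB (minK n)) (j := 0) (minEv n) _
  have h2 : (unitK n).f 0 = (singleObjXSelf (ComplexShape.up ℤ) 0 B).hom ≫ minUnit n :=
    mkHomFromSingle_f (K := complexB (minK n)) (j := 0) (minUnit n) _
  exact (congrArg₂ (· ≫ ·) h1 h2).trans ((Category.assoc _ _ _).trans
    (congrArg (minEv n ≫ ·) (Iso.inv_hom_id_assoc _ _)))

lemma unitK_evK (n : ℕ) : unitK n ≫ evK n = 𝟙 _ := by
  have h1 : (evK n).f 0 = minEv n ≫ (singleObjXSelf (ComplexShape.up ℤ) 0 B).inv :=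
    mkHomToSingle_f (K := complexB (minK n)) (j := 0) (minEv n) _
  have h2 : (unitK n).f 0 = (singleObjXSelf (ComplexShape.up ℤ) 0 B).hom ≫ minUnit n :=
    mkHomFromSingle_f (K := complexB (minK n)) (j := 0) (minUnit n) _
  refine from_single_hom_ext ?_
  have h3 : (singleObjXSelf (ComplexShape.up ℤ) 0 B).hom ≫ minUnit n ≫ minEv n ≫
      (singleObjXSelf (ComplexShape.up ℤ) 0 B).inv = 𝟙 _ := by
    rw [reassoc_of% (minUnit_minEv n), Iso.hom_inv_id]
  exact (congrArg₂ (· ≫ ·) h2 h1).trans ((Category.assoc _ _ _).trans h3)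

lemma nonempty_homotopy_evK_unitK (n : ℕ) : Nonempty (Homotopy (𝟙 _) (evK n ≫ unitK n)) := by
  refine nonempty_homotopy _ _ (htpyK n) ?_
  -- The composite factors through a complex concentrated in degree `0`, so the correction term
  -- appears only there.
  have h0 : ∀ k : ℤ, k ≠ 0 → (evK n ≫ unitK n).f k = 0 := fun k hk => by
    rw [comp_f, (isZero_single_obj_X (ComplexShape.up ℤ) 0 B k hk).eq_of_tgt ((evK n).f k) 0,
      Limits.zero_comp]
  rintro (m | _ | m)
  · exact (functorB.map_isZero (isZero_minK_X n m)).eq_of_src _ _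
  · rw [complexB_minK_d]
    refine (minHtpy_comp_zero n).symm.trans ?_
    refine Eq.trans ?_ (congrArg₂ (· + ·) rfl (evK_unitK_zero n).symm)
    refine congrArg (· + minEv n ≫ minUnit n) ?_
    refine (zero_add _).symm.trans (congrArg₂ (· + ·) ?_ rfl)
    exact Limits.comp_zero.symm
  · rw [h0 _ (by omega), complexB_minK_d, complexB_minK_d, add_zero]
    refine (minHtpy_comp_succ n m).symm.trans ((add_comm _ _).trans ?_)
    cases m <;> rfl

/-- The tensor product of the minimal complex with `B` is homotopy equivalent to `B`. -/
def homotopyEquivK (n : ℕ) : HomotopyEquiv (complexB (minK n))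
    ((single Bimod (ComplexShape.up ℤ) 0).obj B) where
  hom := evK n
  inv := unitK n
  homotopyHomInvId := (nonempty_homotopy_evK_unitK n).some.symm
  homotopyInvHomId := Homotopy.ofEq (unitK_evK n)

/-- The maps `(K_n)ᵏ⁺¹ ⊗_R R{2} ⟶ (K_{n+1})ᵏ`. -/
def coneInl (n : ℕ) : ∀ k : ℤ, (complexR (minK n)).X (k + 1) ⟶ (minK (n + 1)).X k
  | .ofNat _ => 0
  | .negSucc 0 => (rightUnit (minX n 0) 2).hom
  | .negSucc (m + 1) => (-1 : ℤˣ) ^ (m + 1) • (rightUnit (minX n (m + 1)) 2).hom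

/-- The maps `(K_{n+1})ᵏ ⟶ (K_n)ᵏ⁺¹ ⊗_R R{2}`. -/
def coneFst (n : ℕ) : ∀ k : ℤ, (minK (n + 1)).X k ⟶ (complexR (minK n)).X (k + 1)
  | .ofNat _ => 0
  | .negSucc 0 => (rightUnit (minX n 0) 2).inv
  | .negSucc (m + 1) => (-1 : ℤˣ) ^ (m + 1) • (rightUnit (minX n (m + 1)) 2).inv

/-- The maps `B ⟶ (K_{n+1})⁰`. -/
def coneInr (n : ℕ) : ∀ k : ℤ,
    ((single Bimod (ComplexShape.up ℤ) 0).obj B).X k ⟶ (minK (n + 1)).X k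
  | .ofNat 0 => (singleObjXSelf (ComplexShape.up ℤ) 0 B).hom
  | .ofNat (_ + 1) => 0
  | .negSucc _ => 0

/-- The maps `(K_{n+1})⁰ ⟶ B`. -/
def coneSnd (n : ℕ) : ∀ k : ℤ,
    (minK (n + 1)).X k ⟶ ((single Bimod (ComplexShape.up ℤ) 0).obj B).X k
  | .ofNat 0 => (singleObjXSelf (ComplexShape.up ℤ) 0 B).inv
  | .ofNat (_ + 1) => 0
  | .negSucc _ => 0

lemma isZero_single_negSucc (m : ℕ) :
    IsZero (((single Bimod (ComplexShape.up ℤ) 0).obj B).X (Int.negSucc m)) :=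
  isZero_single_obj_X _ _ _ _ (by omega)

lemma isZero_complexR_X (n m : ℕ) : IsZero ((complexR (minK n)).X (Int.ofNat m + 1)) :=
  functorR.map_isZero (isZero_minK_X n m)

/-- The first leg of the cone is `K_n ⊗ R{2} = K_n{2}` moved to the left. The cone negates its
differential, which the sign `(-1)^(k+1)` in `coneInl` and `coneFst` in degree `k` undoes. The
connecting map in degree `-1` is identified by `rbB_minEv`. -/
lemma minK_succ_iso_mappingCone (n : ℕ) :
    Nonempty (CochainComplex.mappingCone (complexRB (minK n) ≫ evK n) ≅ minK (n + 1)) := by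
  refine nonempty_mappingCone_iso _ (coneInl n) (coneInr n) (coneFst n) (coneSnd n)
    ?_ ?_ ?_ ?_ ?_ ?_ ?_
  · rintro (m | _ | m)
    · exact (isZero_complexR_X n m).eq_of_src _ _
    · exact (rightUnit (minX n 0) 2).hom_inv_id
    · change ((-1 : ℤˣ) ^ (m + 1) • (rightUnit (minX n (m + 1)) 2).hom) ≫
        ((-1 : ℤˣ) ^ (m + 1) • (rightUnit (minX n (m + 1)) 2).inv) = 𝟙 _
      rw [Linear.units_smul_comp, Linear.comp_units_smul, smul_smul, ← mul_pow]
      simp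
  · rintro (m | m)
    · exact (isZero_complexR_X n m).eq_of_src _ _
    · exact (isZero_single_negSucc m).eq_of_tgt _ _
  · rintro (m | m)
    · exact (isZero_complexR_X n m).eq_of_tgt _ _
    · exact (isZero_single_negSucc m).eq_of_src _ _
  · rintro ((_ | m) | m)
    · exact (singleObjXSelf (ComplexShape.up ℤ) 0 B).hom_inv_id
    · exact (isZero_single_obj_X (ComplexShape.up ℤ) 0 B (Int.ofNat (m + 1))
        (by simp; omega)).eq_of_src _ _
    · exact (isZero_single_negSucc m).eq_of_src _ _
  · rintro ((_ | m) | _ | m)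
    · refine Eq.trans (congrArg₂ (· + ·) Limits.zero_comp
        (singleObjXSelf (ComplexShape.up ℤ) 0 B).inv_hom_id) (zero_add _)
    · exact (isZero_minK_X (n + 1) m).eq_of_src _ _
    · refine Eq.trans (congrArg₂ (· + ·) (rightUnit (minX n 0) 2).inv_hom_id
        Limits.zero_comp) (add_zero _)
    · refine Eq.trans (congrArg₂ (· + ·) (?_ : ((-1 : ℤˣ) ^ (m + 1) •
        (rightUnit (minX n (m + 1)) 2).inv) ≫
        ((-1 : ℤˣ) ^ (m + 1) • (rightUnit (minX n (m + 1)) 2).hom) = 𝟙 _)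
        Limits.zero_comp) (add_zero _)
      rw [Linear.units_smul_comp, Linear.comp_units_smul, smul_smul, ← mul_pow]
      simp
  · rintro (m | _ | m)
    · exact (isZero_complexR_X n m).eq_of_src _ _
    · have h1 : (evK n).f 0 = minEv n ≫ (singleObjXSelf (ComplexShape.up ℤ) 0 B).inv :=
        mkHomToSingle_f (K := complexB (minK n)) (j := 0) (minEv n) _
      rw [minK_d (n + 1)]
      have h2 : tensorMap (𝟙 (minX n 0)) rbB ≫ (minEv n ≫
          (singleObjXSelf (ComplexShape.up ℤ) 0 B).inv) ≫
            (singleObjXSelf (ComplexShape.up ℤ) 0 B).hom =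
          (rightUnit (minX n 0) 2).hom ≫ minLast n := by
        rw [Category.assoc, Iso.inv_hom_id, Category.comp_id, rbB_minEv]
      refine h2.symm.trans (((?_ : _ = _)).trans (sub_zero _).symm |>.trans
        (congrArg₂ (· - ·) rfl Limits.comp_zero.symm))
      exact congrArg (fun t => tensorMap (𝟙 (minX n 0)) rbB ≫ t ≫
            (singleObjXSelf (ComplexShape.up ℤ) 0 B).hom) h1.symm |>.trans
              (Category.assoc _ _ _).symm
    · rw [minK_d (n + 1)]
      -- The signs on adjacent terms differ by `-1`, which supplies the minus sign of the cone
      -- differential.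
      have h2 : (-1 : ℤˣ) ^ (m + 1) • (rightUnit (minX n (m + 1)) 2).hom ≫
          shiftHom 2 (minDiff n m) = - tensorMap (minDiff n m) (𝟙 _) ≫ ((-1 : ℤˣ) ^ m •
            (rightUnit (minX n m) 2).hom) := by
        rw [← rightUnit_naturality, pow_succ, mul_neg_one, Linear.comp_units_smul, Units.neg_smul]
      have h3 : (complexR (minK n)).d (Int.negSucc m) (Int.negSucc m + 1) =
          tensorMap (negD (minDiff n) (Int.negSucc m)) (𝟙 _) :=
        congrArg (fun t => tensorMap t (𝟙 ((ring Side).shift 2))) (negComplex_d (Int.negSucc m))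
      refine Eq.trans (Linear.units_smul_comp _ _ _) (h2.trans ?_)
      refine (zero_sub _).symm.trans (congrArg₂ (· - ·) Limits.comp_zero.symm ?_)
      refine Eq.trans ?_ (congrArg (· ≫ coneInl n (Int.negSucc m)) h3.symm)
      cases m with
      | zero => exact congrArg (tensorMap (minDiff n 0) (𝟙 _) ≫ ·) (one_smul ℤˣ _)
      | succ m => rfl
  · rintro ((_ | m) | m)
    · exact (isZero_minK_X (n + 1) 0).eq_of_tgt _ _
    · exact (isZero_minK_X (n + 1) (m + 1)).eq_of_tgt _ _
    · exact (isZero_single_negSucc m).eq_of_src _ _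

end

section

open GrMod
open HomologicalComplex

/-! ### Tensoring with the complex of `σ₁` -/

/-- The term of the complex of `σ₁` in degree `-1`. -/
def genIsoR : rouquierGen.X (-1) ≅ (ring Side).shift 2 := doubleXIso₀ _ _

/-- The term of the complex of `σ₁` in degree `0`. -/
def genIsoB : rouquierGen.X 0 ≅ B := doubleXIso₁ _ _ (by decide) ≪≫ shiftZero B

lemma gen_d : rouquierGen.d (-1) 0 ≫ genIsoB.hom = genIsoR.hom ≫ rbB := by
  have h := double_d (c := ComplexShape.up ℤ) (i₀ := -1) (i₁ := 0)
    (rb (s := 2) (t := 0) rfl) (by simp) (by decide)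
  refine (congrArg (· ≫ genIsoB.hom) h).trans ?_
  change ((doubleXIso₀ _ _).hom ≫ _ ≫ (doubleXIso₁ _ _ _).inv) ≫ (doubleXIso₁ _ _ _).hom ≫
    (shiftZero B).hom = _
  rw [Category.assoc, Category.assoc, Iso.inv_hom_id_assoc]
  rfl

lemma isZero_gen_X (k : ℤ) (h : k ≠ -1) (h' : k ≠ 0) : IsZero (rouquierGen.X k) :=
  isZero_double_X _ _ _ h h'

lemma negOnePow_mul_self (k : ℤ) : k.negOnePow * k.negOnePow = 1 := by
  rw [← Int.negOnePow_add]; exact Int.negOnePow_even _ ⟨k, rfl⟩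

/-! ### The total complex with the two-term complex of `σ₁` -/

section Bifunctor

variable (F : Bimod ⥤ Bimod ⥤ Bimod) [F.Additive] [∀ M, (F.obj M).Additive]
  (K : CochainComplex Bimod ℤ)

/-- The value of a bifunctor on `K` and the complex of `σ₁`. -/
abbrev bifunctorGen : CochainComplex Bimod ℤ :=
  mapBifunctor K rouquierGen F (ComplexShape.up ℤ)

/-- The inclusion of `F(Kᵏ⁺¹, R{2})`, up to a sign. -/
def genInl (k : ℤ) : (F.obj (K.X (k + 1))).obj ((ring Side).shift 2) ⟶ (bifunctorGen F K).X k :=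
  (k + 1).negOnePow • ((F.obj (K.X (k + 1))).map genIsoR.inv ≫
    ιMapBifunctor K rouquierGen F (ComplexShape.up ℤ) (k + 1) (-1) k
      (add_neg_cancel_right k 1))

/-- The inclusion of `F(Kᵏ, B)`. -/
def genInr (k : ℤ) : (F.obj (K.X k)).obj B ⟶ (bifunctorGen F K).X k :=
  (F.obj (K.X k)).map genIsoB.inv ≫
    ιMapBifunctor K rouquierGen F (ComplexShape.up ℤ) k 0 k (add_zero k)

/-- The projection to `F(Kᵏ⁺¹, R{2})`, up to a sign. -/
def genFst (k : ℤ) : (bifunctorGen F K).X k ⟶ (F.obj (K.X (k + 1))).obj ((ring Side).shift 2) :=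
  mapBifunctorDesc fun i₁ i₂ h => if h' : i₂ = -1 then (k + 1).negOnePow •
    ((F.map (eqToHom (by
        subst h'; rw [← h]; exact congrArg K.X (neg_add_cancel_right i₁ 1).symm))).app _ ≫
      (F.obj (K.X (k + 1))).map (eqToHom (by rw [h']) ≫ genIsoR.hom)) else 0

/-- The projection to `F(Kᵏ, B)`. -/
def genSnd (k : ℤ) : (bifunctorGen F K).X k ⟶ (F.obj (K.X k)).obj B :=
  mapBifunctorDesc fun i₁ i₂ h => if h' : i₂ = 0 then
    ((F.map (eqToHom (by
        subst h'; rw [← h]; exact congrArg K.X (add_zero i₁).symm))).app _ ≫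
      (F.obj (K.X k)).map (eqToHom (by rw [h']) ≫ genIsoB.hom)) else 0

lemma ι_genFst (k : ℤ) (h) : ιMapBifunctor K rouquierGen F (ComplexShape.up ℤ)
    (k + 1) (-1) k h ≫ genFst F K k =
      (k + 1).negOnePow • (F.obj (K.X (k + 1))).map genIsoR.hom := by
  rw [genFst, ι_mapBifunctorDesc, dif_pos rfl]
  simp

lemma ι_genFst_zero (k : ℤ) (h) : ιMapBifunctor K rouquierGen F (ComplexShape.up ℤ)
    k 0 k h ≫ genFst F K k = 0 := by
  rw [genFst, ι_mapBifunctorDesc]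
  exact dif_neg (by decide)

lemma ι_genSnd (k : ℤ) (h) : ιMapBifunctor K rouquierGen F (ComplexShape.up ℤ)
    k 0 k h ≫ genSnd F K k = (F.obj (K.X k)).map genIsoB.hom := by
  rw [genSnd, ι_mapBifunctorDesc, dif_pos rfl]
  simp

lemma ι_genSnd_zero (k : ℤ) (h) : ιMapBifunctor K rouquierGen F (ComplexShape.up ℤ)
    (k + 1) (-1) k h ≫ genSnd F K k = 0 := by
  rw [genSnd, ι_mapBifunctorDesc]
  exact dif_neg (by decide)

lemma genInl_genFst (k : ℤ) : genInl F K k ≫ genFst F K k = 𝟙 _ := by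
  rw [genInl, Linear.units_smul_comp, Category.assoc, ι_genFst, Linear.comp_units_smul,
    smul_smul, negOnePow_mul_self, one_smul, ← Functor.map_comp, Iso.inv_hom_id,
    CategoryTheory.Functor.map_id]

lemma genInl_genSnd (k : ℤ) : genInl F K k ≫ genSnd F K k = 0 := by
  rw [genInl, Linear.units_smul_comp, Category.assoc, ι_genSnd_zero, Limits.comp_zero, smul_zero]

lemma genInr_genFst (k : ℤ) : genInr F K k ≫ genFst F K k = 0 := by
  rw [genInr, Category.assoc, ι_genFst_zero, Limits.comp_zero]

lemma genInr_genSnd (k : ℤ) : genInr F K k ≫ genSnd F K k = 𝟙 _ := by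
  rw [genInr, Category.assoc, ι_genSnd, ← Functor.map_comp, Iso.inv_hom_id,
    CategoryTheory.Functor.map_id]

lemma gen_total (k : ℤ) :
    genFst F K k ≫ genInl F K k + genSnd F K k ≫ genInr F K k = 𝟙 _ := by
  refine mapBifunctor.hom_ext fun i₁ i₂ h => ?_
  by_cases h1 : i₂ = -1
  · subst h1
    obtain rfl : i₁ = k + 1 := by change i₁ + -1 = k at h; omega
    rw [Preadditive.comp_add, reassoc_of% (ι_genSnd_zero F K k h), reassoc_of% (ι_genFst F K k h),
      genInl, Linear.units_smul_comp, Linear.comp_units_smul, smul_smul, negOnePow_mul_self,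
      one_smul, ← Category.assoc, ← Functor.map_comp, Iso.hom_inv_id, CategoryTheory.Functor.map_id]
    simp
  by_cases h2 : i₂ = 0
  · subst h2
    obtain rfl : i₁ = k := by change i₁ + 0 = k at h; omega
    rw [Preadditive.comp_add, reassoc_of% (ι_genFst_zero F K i₁ h),
      reassoc_of% (ι_genSnd F K i₁ h),
      genInr, ← Category.assoc, ← Functor.map_comp, Iso.hom_inv_id, CategoryTheory.Functor.map_id]
    simp
  · exact ((F.obj _).map_isZero (isZero_gen_X i₂ h1 h2)).eq_of_src _ _

/-- In the total complex the sign `(-1)^(k+1)` falls on the differential of `σ₁`, whereas a cone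
puts its sign on the differential of `K`. Rescaling the inclusion by `(-1)^(k+1)` passes from one
convention to the other. -/
lemma genInl_d (k : ℤ) : genInl F K k ≫ (bifunctorGen F K).d k (k + 1) =
    (F.obj (K.X (k + 1))).map rbB ≫ genInr F K (k + 1) -
      (F.map (K.d (k + 1) (k + 1 + 1))).app _ ≫ genInl F K (k + 1) := by
  have h1 : (F.obj (K.X (k + 1))).map rbB =
      (F.obj (K.X (k + 1))).map genIsoR.inv ≫ (F.obj (K.X (k + 1))).map (rouquierGen.d (-1) 0) ≫
        (F.obj (K.X (k + 1))).map genIsoB.hom := by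
    rw [← Functor.map_comp, ← Functor.map_comp, gen_d, Iso.inv_hom_id_assoc]
  have h2 : (k + 1).negOnePow * (k + 1).negOnePow = 1 := negOnePow_mul_self _
  rw [genInl, mapBifunctor.d_eq, Linear.units_smul_comp, Category.assoc, Preadditive.comp_add,
    mapBifunctor.ι_D₁, mapBifunctor.ι_D₂,
    mapBifunctor.d₁_eq K rouquierGen F (ComplexShape.up ℤ)
      (show (ComplexShape.up ℤ).Rel (k + 1) (k + 1 + 1) from rfl) (-1) (k + 1)
      (add_neg_cancel_right (k + 1) 1),
    mapBifunctor.d₂_eq K rouquierGen F (ComplexShape.up ℤ) (k + 1)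
      (show (ComplexShape.up ℤ).Rel (-1) 0 by simp) (k + 1) (add_zero (k + 1)),
    genInl, genInr, h1]
  have h3 : (ComplexShape.ε₁ (ComplexShape.up ℤ) (ComplexShape.up ℤ) (ComplexShape.up ℤ)
    (k + 1, -1)) = 1 := rfl
  have h4 : (ComplexShape.ε₂ (ComplexShape.up ℤ) (ComplexShape.up ℤ) (ComplexShape.up ℤ)
    (k + 1, -1)) = (k + 1).negOnePow := rfl
  rw [h3, h4, one_smul, Preadditive.comp_add, smul_add, Linear.comp_units_smul,
    Linear.comp_units_smul, smul_smul, h2, one_smul, Int.negOnePow_succ (k + 1), sub_eq_add_neg,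
    Units.neg_smul, neg_neg]
  refine (add_comm _ _).trans (congrArg₂ (· + ·) ?_ ?_)
  · simp
  · rw [NatTrans.naturality_assoc]

lemma genInr_d (k : ℤ) : genInr F K k ≫ (bifunctorGen F K).d k (k + 1) =
    (F.map (K.d k (k + 1))).app _ ≫ genInr F K (k + 1) := by
  rw [genInr, mapBifunctor.d_eq, Category.assoc, Preadditive.comp_add,
    mapBifunctor.ι_D₁, mapBifunctor.ι_D₂,
    mapBifunctor.d₁_eq K rouquierGen F (ComplexShape.up ℤ)
      (show (ComplexShape.up ℤ).Rel k (k + 1) from rfl) 0 (k + 1)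
      (add_zero (k + 1)),
    mapBifunctor.d₂_eq K rouquierGen F (ComplexShape.up ℤ) k
      (show (ComplexShape.up ℤ).Rel 0 1 by simp) (k + 1) rfl]
  have h3 : (ComplexShape.ε₁ (ComplexShape.up ℤ) (ComplexShape.up ℤ) (ComplexShape.up ℤ)
    (k, 0)) = 1 := rfl
  have h4 : rouquierGen.d 0 1 = 0 :=
    -- The term `B₁` is the last one, so only the differential of `K` survives on this summand.
    (isZero_gen_X 1 (by decide) (by decide)).eq_of_tgt _ _
  rw [h3, h4, one_smul, Functor.map_zero, Limits.zero_comp, smul_zero, add_zero, genInr,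
    NatTrans.naturality_assoc]

end Bifunctor

/-- The complex `K ⊗_R F(σ₁)`. -/
abbrev complexGen (K : CochainComplex Bimod ℤ) : CochainComplex Bimod ℤ :=
  mapBifunctor K rouquierGen tensorFunctor (ComplexShape.up ℤ)

/-- Since `F(σ₁)` is the two-term complex `R{2} ⟶ B₁`, tensoring with it is the cone of `K ⊗ R{2} ⟶
K ⊗ B₁`. -/
lemma nonempty_mappingCone_iso_complexGen (K : CochainComplex Bimod ℤ) :
    Nonempty (CochainComplex.mappingCone (complexRB K) ≅ complexGen K) :=
  nonempty_mappingCone_iso (complexRB K) (genInl tensorFunctor K) (genInr tensorFunctor K)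
    (genFst tensorFunctor K) (genSnd tensorFunctor K)
    (genInl_genFst tensorFunctor K) (genInl_genSnd tensorFunctor K)
    (genInr_genFst tensorFunctor K) (genInr_genSnd tensorFunctor K)
    (gen_total tensorFunctor K) (genInl_d tensorFunctor K) (genInr_d tensorFunctor K)

end

section

open GrMod
open HomologicalComplex

/-! ### The complex of `σ₁ⁿ` up to homotopy -/

/-- The functor `- ⊗_R F(σ₁)` on complexes. -/
def functorGen : CochainComplex Bimod ℤ ⥤ CochainComplex Bimod ℤ :=
  tensorFunctor.map₂CochainComplex.flip.obj rouquierGen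

/-- Homotopy equivalent complexes remain so after tensoring with the complex of `σ₁`. -/
def homotopyEquivGen {K L : CochainComplex Bimod ℤ} (e : HomotopyEquiv K L) :
    HomotopyEquiv (complexGen K) (complexGen L) where
  hom := functorGen.map e.hom
  inv := functorGen.map e.inv
  homotopyHomInvId := (Homotopy.ofEq (functorGen.map_comp _ _).symm).trans
    ((mapBifunctorMapHomotopy₁ e.homotopyHomInvId (𝟙 rouquierGen) tensorFunctor _).trans
      (Homotopy.ofEq (functorGen.map_id K)))
  homotopyInvHomId := (Homotopy.ofEq (functorGen.map_comp _ _).symm).trans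
    ((mapBifunctorMapHomotopy₁ e.homotopyInvHomId (𝟙 rouquierGen) tensorFunctor _).trans
      (Homotopy.ofEq (functorGen.map_id L)))

lemma rouquier_zero_iso : Nonempty (rouquier 0 ≅ minK 0) := by
  refine ⟨HomologicalComplex.Hom.isoOfComponents (fun k => ?_) ?_⟩
  · exact if h : k = 0 then singleObjXIsoOfEq (ComplexShape.up ℤ) 0 (ring Side) k h ≪≫
        eqToIso (by subst h; rfl)
      else (isZero_single_obj_X (ComplexShape.up ℤ) 0 (ring Side) k h).iso (by
        rcases k with (_ | m) | m
        · exact absurd rfl h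
        · exact isZero_minK_X 0 m
        · exact isZero_zero _)
  · rintro k _ rfl
    by_cases h : k = 0
    · subst h
      exact (isZero_minK_X 0 0).eq_of_tgt _ _
    · exact (isZero_single_obj_X (ComplexShape.up ℤ) 0 (ring Side) k h).eq_of_src _ _

/-- Inductive step: replace `F(σ₁ⁿ)` by `K_n`, write `K_n ⊗ F(σ₁)` as a cone, replace the target
`K_n ⊗ B₁` of the cone map by `B₁`, and recognise `K_{n+1}`. -/
lemma nonempty_homotopyEquiv_minK :
    ∀ n, Nonempty (HomotopyEquiv (rouquier n) (minK n))
  | 0 => rouquier_zero_iso.map HomotopyEquiv.ofIso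
  | n + 1 => by
    obtain ⟨e⟩ := nonempty_homotopyEquiv_minK n
    obtain ⟨i⟩ := nonempty_mappingCone_iso_complexGen (minK n)
    obtain ⟨f⟩ := nonempty_homotopyEquiv_mappingCone (complexRB (minK n)) (homotopyEquivK n)
    obtain ⟨j⟩ := minK_succ_iso_mappingCone n
    exact ⟨(homotopyEquivGen e).trans ((HomotopyEquiv.ofIso i.symm).trans
      (f.trans (HomotopyEquiv.ofIso j)))⟩

end

section

open GrMod

/-! ### Degrees of elements of `R` and `B₁` -/

lemma R.deg_eq_zero {j : ℤ} (hj : ∀ k : ℕ, 2 * (k : ℤ) ≠ j) {a : R} (ha : a ∈ R.deg j) :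
    a = 0 := by
  have h : {f : R | ∃ k : ℕ, 2 * (k : ℤ) = j ∧ f = X ^ k} = ∅ :=
    Set.eq_empty_of_forall_notMem fun f ⟨k, hk, _⟩ => hj k hk
  rw [R.deg, h, Submodule.span_empty] at ha
  exact ha

lemma R.deg_neg {j : ℤ} (hj : j < 0) {a : R} (ha : a ∈ R.deg j) : a = 0 :=
  R.deg_eq_zero (fun k => by omega) ha

lemma R.mem_deg_two_mul {k : ℕ} {a : R} : a ∈ R.deg (2 * k) ↔ ∃ c : ℚ, a = c • X ^ k := by
  have h : {f : R | ∃ l : ℕ, 2 * (l : ℤ) = 2 * k ∧ f = X ^ l} = {X ^ k} := by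
    ext f
    refine ⟨fun ⟨l, hl, hf⟩ => ?_, fun hf => ⟨k, rfl, hf⟩⟩
    obtain rfl : l = k := by omega
    exact hf
  rw [R.deg, h, Submodule.mem_span_singleton]
  exact ⟨fun ⟨c, hc⟩ => ⟨c, hc.symm⟩, fun ⟨c, hc⟩ => ⟨c, hc.symm⟩⟩

lemma R.mem_deg_zero {a : R} (ha : a ∈ R.deg 0) : ∃ c : ℚ, a = c • 1 := by
  have := R.mem_deg_two_mul (k := 0) (a := a)
  rw [pow_zero] at this
  exact this.1 ha

lemma BRing.gr_neg {j : ℤ} (hj : j < 0) {t : BRing} (ht : t ∈ BRing.gr j) : t = 0 := by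
  rw [BRing.eq_lcoord t, R.deg_neg hj (BRing.lcoord_even_mem ht),
    R.deg_neg (by omega) (BRing.lcoord_odd_mem ht)]
  simp

/-- The coordinate of `1 ⊗ y` would have degree `-2` and so vanishes; the coordinate of `1 ⊗ 1` has
degree `0` and is a scalar. -/
lemma BRing.mem_gr_zero {t : BRing} (ht : t ∈ BRing.gr 0) : ∃ c : ℚ, t = c • 1 := by
  obtain ⟨c, hc⟩ := R.mem_deg_zero (BRing.lcoord_even_mem ht)
  refine ⟨c, ?_⟩
  conv_lhs => rw [BRing.eq_lcoord t, hc, R.deg_neg (by omega) (BRing.lcoord_odd_mem ht)]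
  simp

/-! ### Minimality -/

lemma minX_zero_gr_neg : ∀ n {j : ℤ}, j < 0 → ∀ x ∈ (minX n 0).gr j, x = 0
  | 0, _, hj, _, hx => R.deg_neg hj hx
  | _ + 1, _, hj, _, hx => BRing.gr_neg hj hx

/-- There are no nonzero morphisms between the terms of the minimal complex in the direction
opposite to the differentials. -/
lemma minX_hom_eq_zero : ∀ n m (f : minX n m ⟶ minX n (m + 1)), f = 0
  | 0, _, _ => (isZero_zero Bimod).eq_of_tgt _ _
  -- The generator of `B` in degree `0` would go to an element of degree `0 - 2` in the unshifted
  -- target, which has nothing in negative degrees.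
  | n + 1, 0, f => gen_B.hom_ext (M := B) (minX_zero_gr_neg n (by norm_num : (-2 : ℤ) < 0) _
      (Hom.lin_mem (i := 0) (M := B) (N := (minX n 0).shift 2) f BRing.one_mem_gr))
  | n + 1, m + 1, f => by
    -- Undoing the shift by `2` on both sides leaves the same underlying map, so the claim follows
    -- from the one for `n`.
    let g : minX n m ⟶ minX n (m + 1) := ofLin
      (Hom.lin (M := (minX n m).shift 2) (N := (minX n (m + 1)).shift 2) f)
      (Hom.lin_act (M := (minX n m).shift 2) (N := (minX n (m + 1)).shift 2) f)
      (fun i x hx => by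
        have h := Hom.lin_mem (M := (minX n m).shift 2) (N := (minX n (m + 1)).shift 2)
          (i := i + 2) f (x := x)
        change x ∈ (minX n m).gr (i + 2 - 2) → _ ∈ (minX n (m + 1)).gr (i + 2 - 2) at h
        rw [add_sub_cancel_right] at h
        exact h hx)
    have hg : shiftHom 2 g = 0 := by rw [minX_hom_eq_zero n m g, shiftHom_zero]
    exact hg

lemma minK_hom_eq_zero (n : ℕ) :
    ∀ (k : ℤ) (f : (minK n).X (k + 1) ⟶ (minK n).X k), f = 0
  | .ofNat m, f => (isZero_minK_X n m).eq_of_src f 0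
  | .negSucc 0, f => minX_hom_eq_zero n 0 f
  | .negSucc (m + 1), f => minX_hom_eq_zero n (m + 1) f

/-- Every component of a homotopy is a map lowering the degree by one, and here all of those vanish.
-/
lemma eq_of_homotopy {V : Type*} [Category V] [Preadditive V] {K L : CochainComplex V ℤ}
    (h : ∀ (k : ℤ) (f : K.X (k + 1) ⟶ L.X k), f = 0) {f g : K ⟶ L} (H : Homotopy f g) :
    f = g := by
  have h' : ∀ i j, H.hom i j = 0 := fun i j => by
    by_cases hij : j + 1 = i
    · subst hij; exact h j _
    · exact H.zero i j hij
  ext i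
  rw [H.comm i, _root_.dNext_eq H.hom (show (ComplexShape.up ℤ).Rel i (i + 1) from rfl),
    _root_.prevD_eq H.hom (show (ComplexShape.up ℤ).Rel (i - 1) i by simp), h', h']
  simp

/-- The idempotent of `K_n` that projects onto a contractible summand is null-homotopic, hence zero
by `eq_of_homotopy`; the summand is therefore zero. -/
lemma isMinimal_minK (n : ℕ) : IsMinimal (minK n) := by
  rintro K' C ⟨e⟩ ⟨H⟩
  have h1 : (biprod.inr ≫ e.inv) ≫ e.hom ≫ biprod.snd = 𝟙 C := by simp
  have h2 : (e.hom ≫ biprod.snd) ≫ biprod.inr ≫ e.inv = 0 :=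
    eq_of_homotopy (minK_hom_eq_zero n) ((Homotopy.ofEq (by simp)).trans
      (((H.compLeft (e.hom ≫ biprod.snd)).compRight (biprod.inr ≫ e.inv)).trans
        (Homotopy.ofEq (by simp))))
  rw [IsZero.iff_id_eq_zero, ← h1]
  have h3 := congrArg (fun t => (biprod.inr ≫ e.inv) ≫ t ≫ e.hom ≫ biprod.snd) h2
  simpa using h3

/-- The minimal complex is a direct summand of `F(σ₁ⁿ)` with contractible complement. -/
lemma rouquier_iso_biprod (n : ℕ) :
    ∃ C, Nonempty (rouquier n ≅ minK n ⊞ C) ∧ IsContractible C := by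
  obtain ⟨e⟩ := nonempty_homotopyEquiv_minK n
  exact exists_iso_biprod_contractible e.inv e.hom
    (eq_of_homotopy (minK_hom_eq_zero n) e.homotopyInvHomId) e.homotopyHomInvId

/-! ### Indecomposability -/

/-- A decomposition gives an idempotent endomorphism, which acts on the generator by a scalar `c`
with `c² = c`. If `c` is `0` or `1`, the idempotent is `0` or the identity, and one summand
vanishes. -/
lemma indecomposable_of_gen {S : Type} {M : GrMod S} {x : M} (hx : Gen M x) (h0 : x ≠ 0)
    (h : ∀ f : M ⟶ M, ∃ c : ℚ, Hom.lin f x = c • x) : Indecomposable M := by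
  refine ⟨fun hM => h0 ?_, fun Y Z e => ?_⟩
  · have := (IsZero.iff_id_eq_zero M).1 hM
    exact congrArg (fun t => Hom.lin t x) this
  · obtain ⟨c, hc⟩ := h ((e.hom ≫ biprod.fst) ≫ biprod.inl ≫ e.inv)
    have h1 : (biprod.inl ≫ e.inv) ≫ e.hom ≫ biprod.fst = 𝟙 Y := by simp
    have h2 : ((e.hom ≫ biprod.fst) ≫ biprod.inl ≫ e.inv) ≫
        ((e.hom ≫ biprod.fst) ≫ biprod.inl ≫ e.inv) =
        (e.hom ≫ biprod.fst) ≫ biprod.inl ≫ e.inv := by simp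
    have h3 : c * c = c := by
      have h4 := congrArg (fun t => Hom.lin t x) h2
      simp only [lin_comp_apply _ ((e.hom ≫ biprod.fst) ≫ biprod.inl ≫ e.inv)] at h4
      rw [hc, map_smul, hc, smul_smul] at h4
      exact smul_left_injective ℚ h0 h4
    rcases (IsIdempotentElem.iff_eq_zero_or_one.1 h3) with rfl | rfl
    · left
      have h5 : (e.hom ≫ biprod.fst) ≫ biprod.inl ≫ e.inv = 0 :=
        hx.hom_ext (hc.trans (zero_smul ℚ x))
      rw [IsZero.iff_id_eq_zero]
      have h6 := congrArg (fun t => (biprod.inl ≫ e.inv) ≫ t ≫ e.hom ≫ biprod.fst) h5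
      simpa using h6
    · right
      have h5 : (e.hom ≫ biprod.fst) ≫ biprod.inl ≫ e.inv = 𝟙 M :=
        hx.hom_ext (hc.trans (one_smul ℚ x))
      rw [IsZero.iff_id_eq_zero]
      have h6 := congrArg (fun t => (biprod.inr ≫ e.inv) ≫ t ≫ e.hom ≫ biprod.snd) h5
      simpa using h6.symm

lemma indecomposable_minTerm (n : ℕ) : ∀ i, Indecomposable (minTerm n i)
  | 0 => indecomposable_of_gen (M := (ring Side).shift (2 * n)) (x := (1 : R))
      (gen_ring .left) (_root_.one_ne_zero (α := R)) fun f => by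
      refine R.mem_deg_zero ?_
      have h := Hom.lin_mem (M := (ring Side).shift (2 * n)) (N := (ring Side).shift (2 * n))
        (i := 2 * n) f (x := (1 : R))
      change (1 : R) ∈ R.deg (2 * n - 2 * n) → _ ∈ R.deg (2 * n - 2 * n) at h
      rw [sub_self] at h
      exact h R.one_mem_deg
  | i + 1 => indecomposable_of_gen (M := B.shift (2 * n - 2 * (i + 1))) (x := (1 : BRing))
      gen_B BRing.one_ne_zero fun f => by
      refine BRing.mem_gr_zero ?_
      have h := Hom.lin_mem (M := B.shift (2 * n - 2 * (i + 1)))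
        (N := B.shift (2 * n - 2 * (i + 1))) (i := 2 * n - 2 * (i + 1)) f (x := (1 : BRing))
      change (1 : BRing) ∈ BRing.gr (_ - _) → _ ∈ BRing.gr (2 * n - 2 * (i + 1) -
        (2 * n - 2 * (i + 1))) at h
      rw [sub_self] at h
      exact h BRing.one_mem_gr

/-! ### The shape of the minimal complex -/

/-- Two gradings on the same module which agree. -/
def shiftIso {S : Type} (M : GrMod S) {a b : ℤ} (h : a = b) : M.shift a ≅ M.shift b where
  hom := ofLin (M := M.shift a) (N := M.shift b) LinearMap.id (fun _ _ _ => rfl)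
    (fun _ _ hx => by subst h; exact hx)
  inv := ofLin (M := M.shift b) (N := M.shift a) LinearMap.id (fun _ _ _ => rfl)
    (fun _ _ hx => by subst h; exact hx)
  hom_inv_id := rfl
  inv_hom_id := rfl

/-- Iterated shifts. -/
def shiftShift {S : Type} (M : GrMod S) {a b c : ℤ} (h : a + b = c) :
    (M.shift a).shift b ≅ M.shift c where
  hom := ofLin (M := (M.shift a).shift b) (N := M.shift c) LinearMap.id (fun _ _ _ => rfl)
    (fun i x hx => by
      change x ∈ M.gr (i - b - a) at hx
      change x ∈ M.gr (i - c)
      rwa [show i - c = i - b - a by omega])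
  inv := ofLin (M := M.shift c) (N := (M.shift a).shift b) LinearMap.id (fun _ _ _ => rfl)
    (fun i x hx => by
      change x ∈ M.gr (i - c) at hx
      change x ∈ M.gr (i - b - a)
      rwa [show i - b - a = i - c by omega])
  hom_inv_id := rfl
  inv_hom_id := rfl

/-- The shift of an isomorphism. -/
def shiftMapIso {S : Type} {M N : GrMod S} (k : ℤ) (e : M ≅ N) : M.shift k ≅ N.shift k where
  hom := shiftHom k e.hom
  inv := shiftHom k e.inv
  hom_inv_id := (shiftHom_comp k e.hom e.inv).symm.trans (congrArg (shiftHom k) e.hom_inv_id)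
  inv_hom_id := (shiftHom_comp k e.inv e.hom).symm.trans (congrArg (shiftHom k) e.inv_hom_id)

/-- The comparison of `minTerm n i` and `minTerm (n + 1) i`. -/
def minTermShift (n : ℕ) : ∀ i, (minTerm n i).shift 2 ≅ minTerm (n + 1) i
  | 0 => shiftShift (ring Side) (by push_cast; ring)
  | i + 1 => shiftShift B (by push_cast; ring)

lemma ysum_eq (n : ℕ) : ysum n = if Odd n then yMinus else yPlus := by
  rw [ysum, ysgn]
  split_ifs with h
  · rw [h.neg_one_pow, neg_one_smul, ← sub_eq_add_neg]; rfl
  · rw [(Nat.not_odd_iff_even.1 h).neg_one_pow, one_smul]; rfl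

lemma mulB_congr {b b' : BRing} (h : b = b') {s t : ℤ} (hb : b ∈ BRing.gr (s - t))
    (hb' : b' ∈ BRing.gr (s - t)) : mulB b hb = mulB b' hb' := by
  subst h; rfl

lemma minD_succ (n i : ℕ) : minD n (i + 1) =
    mulB (s := 2 * n - 2 * (i + 1)) (t := 2 * n - 2 * ((i + 1 : ℕ) + 1)) (ysum (i + 1))
      (by convert ysum_mem (i + 1) using 2; push_cast; ring) := by
  by_cases h : Odd (i + 1)
  · exact (if_pos h).trans (mulB_congr ((ysum_eq _).trans (if_pos h)).symm _ _)
  · exact (if_neg h).trans (mulB_congr ((ysum_eq _).trans (if_neg h)).symm _ _)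

lemma minD_minTermShift (n : ℕ) : ∀ i,
    shiftHom 2 (minD n i) ≫ (minTermShift n (i + 1)).hom =
      (minTermShift n i).hom ≫ minD (n + 1) i
  | 0 => rfl
  | i + 1 => by rw [minD_succ, minD_succ]; rfl

/-- The terms of the minimal complex. -/
def minXIso : ∀ m i n, i + m = n → (minX n m ≅ minTerm n i)
  | 0, 0, 0, _ => (shiftZero (ring Side)).symm
  | 0, i + 1, n + 1, h => (shiftZero B).symm ≪≫ shiftIso B (by
      have : (i : ℤ) + 1 = n + 1 := by exact_mod_cast h
      push_cast; linarith)
  | m + 1, i, n + 1, h => shiftMapIso 2 (minXIso m i n (by omega)) ≪≫ minTermShift n i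

/-- The generators of the terms of the minimal complex. -/
def termGen (n : ℕ) : ∀ i, minTerm n i
  | 0 => (1 : R)
  | _ + 1 => (1 : BRing)

lemma minXIso_minGen : ∀ n, Hom.lin (minXIso 0 n n rfl).hom (minGen n) = termGen n n
  | 0 => rfl
  | _ + 1 => rfl

/-- The last differential is compared on its generator; every other one is the shift by `2` of a
differential for `n - 1`. Counted from the left, the `i`-th differential is thus multiplication by
`ysum i`, independently of `n`. -/
lemma minXIso_comm : ∀ m i n (h : i + 1 + m = n),
    minDiff n m ≫ (minXIso m (i + 1) n h).hom =
      (minXIso (m + 1) i n (by omega)).hom ≫ minD n i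
  | 0, i, n + 1, h => by
    obtain rfl : i = n := by omega
    refine (gen_minGen i).hom_ext (M := (minX i 0).shift 2) ?_
    refine (minLast_gen i).trans ?_
    refine Eq.trans ?_ (congrArg (fun t => Hom.lin (minD (i + 1) i)
      (Hom.lin (minTermShift i i).hom t)) (minXIso_minGen i).symm)
    cases i with
    | zero => exact rbB_one.symm
    | succ i =>
      rw [minD_succ]
      exact (mul_one (ysum (i + 1))).symm
  | m + 1, i, n + 1, h => by
    have ih := minXIso_comm m i n (by omega)
    refine (congrArg (fun t => shiftHom 2 t ≫ (minTermShift n (i + 1)).hom) ih).trans ?_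
    exact congrArg (fun t => shiftHom 2 (minXIso (m + 1) i n (by omega)).hom ≫ t)
      (minD_minTermShift n i)

lemma isZero_minX : ∀ n m, n < m → IsZero (minX n m)
  | 0, _ + 1, _ => isZero_zero Bimod
  | n + 1, m + 1, h => by
    rw [IsZero.iff_id_eq_zero]
    have h1 := (IsZero.iff_id_eq_zero _).1 (isZero_minX n m (by omega))
    exact congrArg (shiftHom 2) h1

lemma isFiniteComplex_minK (n : ℕ) :
    IsFiniteComplex (minK n) (-(n : ℤ)) n (minTerm n) (minD n) :=
  isFiniteComplex_negComplex (isZero_minX n) (fun i m h => minXIso m i n h)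
    (fun i m h => minXIso_comm m i n h)

end

section

open GrMod

/-! ### Hochschild homology of `R` and `B₁` -/

lemma BRing.lcoord_even_inl (r : R) : BRing.lcoord R.even (BRing.inl r) = r := by
  have h := BRing.lcoord_inl_mul R.even r 1
  rwa [mul_one, BRing.lcoord_even_one, mul_one] at h

lemma BRing.lcoord_odd_inl (r : R) : BRing.lcoord R.odd (BRing.inl r) = 0 := by
  have h := BRing.lcoord_inl_mul R.odd r 1
  rwa [mul_one, BRing.lcoord_odd_one, mul_zero] at h

lemma koszul_ring (s : ℤ) (x : R) : koszul ((ring Side).shift s) x = 0 := sub_self _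

lemma koszul_B (s : ℤ) (t : BRing) : koszul (B.shift s) t = BRing.inl X * t - BRing.inr X * t := rfl

lemma lcoord_even_koszul (t : BRing) :
    BRing.lcoord R.even (BRing.inl X * t - BRing.inr X * t) =
      X * BRing.lcoord R.even t - X ^ 2 * BRing.lcoord R.odd t := by
  rw [map_sub, BRing.lcoord_inl_mul, BRing.lcoord_even_X_mul]

lemma lcoord_odd_koszul (t : BRing) :
    BRing.lcoord R.odd (BRing.inl X * t - BRing.inr X * t) =
      X * BRing.lcoord R.odd t - BRing.lcoord R.even t := by
  rw [map_sub, BRing.lcoord_inl_mul, BRing.lcoord_odd_X_mul]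

/-- The map `R{s} ⟶ HH₀(R{s})`. -/
def hh₀RHom {s t : ℤ} (h : s = t) : (ring Unit).shift t ⟶ hh₀ ((ring Side).shift s) :=
  ofLin (M := (ring Unit).shift t) (N := hh₀ ((ring Side).shift s))
    (Submodule.mkQ (LinearMap.range (koszul ((ring Side).shift s)))) (fun _ _ _ => rfl)
    (fun _ x hx => ⟨x, h ▸ hx, rfl⟩)

lemma hh₀RHom_bijective {s t : ℤ} (h : s = t) : Function.Bijective (Hom.lin (hh₀RHom h)) := by
  refine ⟨(injective_iff_map_eq_zero _).2 fun x hx => ?_, Submodule.mkQ_surjective _⟩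
  obtain ⟨y, hy⟩ := (Submodule.Quotient.mk_eq_zero _).1 hx
  rw [← hy]
  exact koszul_ring s y

/-- The map `R{s} ⟶ HH₀(B{s})`. -/
def hh₀BHom {s t : ℤ} (h : s = t) : (ring Unit).shift t ⟶ hh₀ (B.shift s) :=
  ofLin (M := (ring Unit).shift t) (N := hh₀ (B.shift s))
    (Submodule.mkQ (LinearMap.range (koszul (B.shift s))) ∘ₗ BRing.inl.toLinearMap)
    (fun _ a x => congrArg (Submodule.mkQ (LinearMap.range (koszul (B.shift s))))
      (map_mul BRing.inl a x))
    (fun _ x hx => ⟨BRing.inl x, BRing.inl_mem (h ▸ hx), rfl⟩)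

/-- Modulo `y ⊗ 1 - 1 ⊗ y` the two variables agree, so `e ⊗ 1 + o ⊗ y` becomes `e + y o`.
Conversely, for `t = e ⊗ 1 + o ⊗ y` the Koszul differential has coordinates `y (e - y o)` and `-(e -
y o)`, so an image lying in `R ⊗ 1` is zero. -/
lemma hh₀BHom_bijective {s t : ℤ} (h : s = t) : Function.Bijective (Hom.lin (hh₀BHom h)) := by
  constructor
  · refine (injective_iff_map_eq_zero _).2 fun (x : R) hx => ?_
    obtain ⟨t, ht⟩ := (Submodule.Quotient.mk_eq_zero _).1 hx
    change BRing.inl X * t - BRing.inr X * t = BRing.inl x at ht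
    have h1 := lcoord_even_koszul t
    have h2 := lcoord_odd_koszul t
    rw [ht, BRing.lcoord_even_inl] at h1
    rw [ht, BRing.lcoord_odd_inl] at h2
    change x = 0
    rw [h1]
    linear_combination X * h2
  · intro q
    induction q using Submodule.Quotient.induction_on with
    | H t =>
      change BRing at t
      refine ⟨(BRing.lcoord R.even t + X * BRing.lcoord R.odd t : R), ?_⟩
      -- The difference of the two representatives is `(o ⊗ 1)(y ⊗ 1 - 1 ⊗ y)`, the Koszul
      -- differential of `o ⊗ 1`.
      refine (Submodule.Quotient.eq _).2 ⟨BRing.inl (BRing.lcoord R.odd t), ?_⟩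
      change BRing.inl X * BRing.inl (BRing.lcoord R.odd t) -
        BRing.inr X * BRing.inl (BRing.lcoord R.odd t) =
          BRing.inl (BRing.lcoord R.even t + X * BRing.lcoord R.odd t) - t
      have := BRing.eq_lcoord t
      rw [map_add, map_mul]
      linear_combination this

/-- The map `R{s + 2} ⟶ HH₁(R{s})`. -/
def hh₁RHom {s t : ℤ} (h : s + 2 = t) : (ring Unit).shift t ⟶ hh₁ ((ring Side).shift s) :=
  ofLin (M := (ring Unit).shift t) (N := hh₁ ((ring Side).shift s))
    (LinearMap.codRestrict (LinearMap.ker (koszul ((ring Side).shift s))) LinearMap.id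
      (fun x => koszul_ring s x))
    (fun _ _ _ => rfl)
    (fun i x hx => by
      change x ∈ R.deg (i - t) at hx
      change x ∈ R.deg (i - 2 - s)
      rwa [show i - 2 - s = i - t by omega])

lemma hh₁RHom_bijective {s t : ℤ} (h : s + 2 = t) : Function.Bijective (Hom.lin (hh₁RHom h)) :=
  ⟨fun _ _ hxy => congrArg Subtype.val hxy, fun x => ⟨x.1, rfl⟩⟩

lemma koszul_inl_mul_yPlus (s : ℤ) (x : R) : koszul (B.shift s) (BRing.inl x * yPlus) = 0 := by
  rw [koszul_B]
  linear_combination BRing.inl x * yPlus_comm X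

/-- The map `R{s + 4} ⟶ HH₁(B{s})`. -/
def hh₁BHom {s t : ℤ} (h : s + 4 = t) : (ring Unit).shift t ⟶ hh₁ (B.shift s) :=
  ofLin (M := (ring Unit).shift t) (N := hh₁ (B.shift s))
    (LinearMap.codRestrict (LinearMap.ker (koszul (B.shift s)))
      (LinearMap.mulRight ℚ yPlus ∘ₗ BRing.inl.toLinearMap) (koszul_inl_mul_yPlus s))
    (fun _ a (x : R) => Subtype.ext (by
      change BRing.inl (a * x) * yPlus = BRing.inl a * (BRing.inl x * yPlus)
      rw [map_mul, mul_assoc]))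
    (fun i x hx => by
      have := BRing.mul_mem_gr (BRing.inl_mem hx) yPlus_mem
      change BRing.inl x * yPlus ∈ BRing.gr (i - 2 - s)
      rwa [show i - 2 - s = i - t + 2 by omega])

lemma lcoord_odd_inl_mul_yPlus (x : R) : BRing.lcoord R.odd (BRing.inl x * yPlus) = x := by
  rw [BRing.lcoord_inl_mul, ← ysum_zero, lcoord_odd_ysum, mul_one]

/-- An element `e ⊗ 1 + o ⊗ y` is killed by the Koszul differential exactly when `e = y o`, that is,
when it equals `o · (1 ⊗ y + y ⊗ 1)`. The shift by `4` is `2` for this generator plus `2` for the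
Koszul grading. -/
lemma hh₁BHom_bijective {s t : ℤ} (h : s + 4 = t) : Function.Bijective (Hom.lin (hh₁BHom h)) := by
  constructor
  · intro (x : R) (y : R) hxy
    have h1 : BRing.inl x * yPlus = BRing.inl y * yPlus := congrArg Subtype.val hxy
    have h2 := congrArg (BRing.lcoord R.odd) h1
    rwa [lcoord_odd_inl_mul_yPlus, lcoord_odd_inl_mul_yPlus] at h2
  · rintro ⟨(t : BRing), ht⟩
    refine ⟨(BRing.lcoord R.odd t : R), Subtype.ext ?_⟩
    change BRing.inl (BRing.lcoord R.odd t) * yPlus = t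
    have h1 := lcoord_odd_koszul t
    rw [show BRing.inl X * t - BRing.inr X * t = 0 from ht, map_zero] at h1
    have h2 : BRing.lcoord R.even t = X * BRing.lcoord R.odd t := by linear_combination h1
    conv_rhs => rw [BRing.eq_lcoord t, h2]
    rw [← ysum_zero, ysum, ysgn, map_mul]
    simp
    ring

lemma yPlus_eq : yPlus = BRing.inr X + BRing.inl X := rfl

lemma yMinus_eq : yMinus = BRing.inr X - BRing.inl X := rfl

lemma hh₀_mk_eq (s : ℤ) {t u : BRing} (v : BRing)
    (h : t - u = BRing.inl X * v - BRing.inr X * v) :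
    (Submodule.mkQ (LinearMap.range (koszul (B.shift s))) t) =
      Submodule.mkQ (LinearMap.range (koszul (B.shift s))) u :=
  (Submodule.Quotient.eq _).2 ⟨v, h.symm⟩

/-! ### The differentials of the minimal complex on Hochschild homology -/

section Differentials

variable {s s' t t' : ℤ}

/-- Here and in the next two lemmas the witness `-1` expresses that `1 ⊗ y - y ⊗ 1` is the Koszul
boundary of `-1`; hence `1 ⊗ y + y ⊗ 1` is congruent to `2y ⊗ 1`. -/
lemma hh₀_rb (h : s - t = 2) (hs : s = s') (ht : t = t') (hX : 2 * X ∈ R.deg (s' - t')) :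
    hh₀RHom hs ≫ HH₀.map (rb h) = mulR Unit (2 * X) hX ≫ hh₀BHom ht := by
  refine (gen_ring ()).hom_ext (M := (ring Unit).shift s') ?_
  refine hh₀_mk_eq t (t := BRing.inl 1 * yPlus) (u := BRing.inl (2 * X * 1)) (-1) ?_
  rw [yPlus_eq, two_mul, mul_one, map_one, map_add]
  ring

lemma hh₀_yPlus (h : yPlus ∈ BRing.gr (s - t)) (hs : s = s') (ht : t = t')
    (hX : 2 * X ∈ R.deg (s' - t')) :
    hh₀BHom hs ≫ HH₀.map (mulB yPlus h) = mulR Unit (2 * X) hX ≫ hh₀BHom ht := by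
  refine (gen_ring ()).hom_ext (M := (ring Unit).shift s') ?_
  refine hh₀_mk_eq t (t := yPlus * BRing.inl 1) (u := BRing.inl (2 * X * 1)) (-1) ?_
  rw [yPlus_eq, two_mul, mul_one, map_one, map_add]
  ring

lemma hh₀_yMinus (h : yMinus ∈ BRing.gr (s - t)) (hs : s = s') (ht : t = t') :
    hh₀BHom hs ≫ HH₀.map (mulB yMinus h) = 0 ≫ hh₀BHom ht := by
  refine (gen_ring ()).hom_ext (M := (ring Unit).shift s') ?_
  refine hh₀_mk_eq t (t := yMinus * BRing.inl 1) (u := BRing.inl 0) (-1) ?_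
  rw [yMinus_eq]
  simp
  ring

lemma hh₁_rb (h : s - t = 2) (hs : s + 2 = s') (ht : t + 4 = t') (h1 : 1 ∈ R.deg (s' - t')) :
    hh₁RHom hs ≫ HH₁.map (rb h) = mulR Unit 1 h1 ≫ hh₁BHom ht := by
  refine (gen_ring ()).hom_ext (M := (ring Unit).shift s') (Subtype.ext ?_)
  change BRing.inl 1 * yPlus = BRing.inl (1 * 1) * yPlus
  rw [mul_one]

/-- On `1 ⊗ y + y ⊗ 1` the left and right variables act equally, so multiplying it by itself is
multiplying it by `2y`. For the same reason `1 ⊗ y - y ⊗ 1` acts on it by zero in `hh₁_yMinus`. -/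
lemma hh₁_yPlus (h : yPlus ∈ BRing.gr (s - t)) (hs : s + 4 = s') (ht : t + 4 = t')
    (hX : 2 * X ∈ R.deg (s' - t')) :
    hh₁BHom hs ≫ HH₁.map (mulB yPlus h) = mulR Unit (2 * X) hX ≫ hh₁BHom ht := by
  refine (gen_ring ()).hom_ext (M := (ring Unit).shift s') (Subtype.ext ?_)
  change yPlus * (BRing.inl 1 * yPlus) = BRing.inl (2 * X * 1) * yPlus
  have h2 := yPlus_comm X
  rw [yPlus_eq] at h2 ⊢
  rw [two_mul, mul_one, map_one, map_add]
  linear_combination -h2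

lemma hh₁_yMinus (h : yMinus ∈ BRing.gr (s - t)) (hs : s + 4 = s') (ht : t + 4 = t') :
    hh₁BHom hs ≫ HH₁.map (mulB yMinus h) = 0 ≫ hh₁BHom ht := by
  refine (gen_ring ()).hom_ext (M := (ring Unit).shift s') (Subtype.ext ?_)
  change yMinus * (BRing.inl 1 * yPlus) = BRing.inl 0 * yPlus
  have h2 := yPlus_comm X
  rw [yMinus_eq, map_one, map_zero]
  linear_combination -h2

end Differentials

lemma inv_comm_of_hom_comm {V : Type*} [Category V] {M M' N N' : V} (a : M ≅ M') (b : N ≅ N')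
    {f : M ⟶ N} {g : M' ⟶ N'} (h : a.hom ≫ g = f ≫ b.hom) :
    g ≫ b.symm.hom = a.symm.hom ≫ f := by
  rw [Iso.symm_hom, Iso.symm_hom, Iso.comp_inv_eq, Category.assoc, Iso.eq_inv_comp, h]

/-- The Hochschild homology `HH₀` of the terms of the minimal complex. -/
def hh₀TermIso (n : ℕ) : ∀ i, hh₀Term n i ≅ HH₀.obj (minTerm n i)
  | 0 => isoOfBijective _ (hh₀RHom_bijective (s := 2 * n) (t := 2 * n - 2 * (0 : ℕ)) (by simp))
  | i + 1 => isoOfBijective _ (hh₀BHom_bijective (s := 2 * n - 2 * (i + 1))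
      (t := 2 * n - 2 * (i + 1 : ℕ)) (by push_cast; ring))

/-- The Hochschild homology `HH₁` of the terms of the minimal complex. -/
def hh₁TermIso (n : ℕ) : ∀ i, hh₁Term n i ≅ HH₁.obj (minTerm n i)
  | 0 => isoOfBijective _ (hh₁RHom_bijective (s := 2 * n) (t := 2 * n + 2) rfl)
  | i + 1 => isoOfBijective _ (hh₁BHom_bijective (s := 2 * n - 2 * (i + 1))
      (t := 2 * n + 2 - 2 * i) (by ring))

lemma hh₀TermIso_comm (n : ℕ) : ∀ i, (hh₀TermIso n i).hom ≫ HH₀.map (minD n i) =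
    hh₀D n i ≫ (hh₀TermIso n (i + 1)).hom
  | 0 => by
    have h1 : hh₀D n 0 = mulR Unit (2 * X) _ := if_pos Even.zero
    rw [h1]
    exact hh₀_rb (by push_cast; ring) (by simp) (by push_cast; ring) _
  | i + 1 => by
    by_cases h : Odd (i + 1)
    · have h1 : hh₀D n (i + 1) = 0 := if_neg (Nat.not_even_iff_odd.2 h)
      have h2 : minD n (i + 1) = mulB yMinus _ := if_pos h
      rw [h1, h2]
      exact hh₀_yMinus _ (by push_cast; ring) (by push_cast; ring)
    · have h1 : hh₀D n (i + 1) = mulR Unit (2 * X) _ := if_pos (Nat.not_odd_iff_even.1 h)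
      have h2 : minD n (i + 1) = mulB yPlus _ := if_neg h
      rw [h1, h2]
      exact hh₀_yPlus _ (by push_cast; ring) (by push_cast; ring) _

lemma hh₁TermIso_comm (n : ℕ) : ∀ i, (hh₁TermIso n i).hom ≫ HH₁.map (minD n i) =
    hh₁D n i ≫ (hh₁TermIso n (i + 1)).hom
  | 0 => hh₁_rb (by push_cast; ring) rfl (by push_cast; ring)
      (by convert R.one_mem_deg using 2; push_cast; ring)
  | i + 1 => by
    by_cases h : Odd (i + 1)
    · have h1 : hh₁D n (i + 1) = 0 := if_neg (Nat.not_even_iff_odd.2 h)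
      have h2 : minD n (i + 1) = mulB yMinus _ := if_pos h
      rw [h1, h2]
      exact hh₁_yMinus _ (by ring) (by push_cast; ring)
    · have h1 : hh₁D n (i + 1) = mulR Unit (2 * X) _ := if_pos (Nat.not_odd_iff_even.1 h)
      have h2 : minD n (i + 1) = mulB yPlus _ := if_neg h
      rw [h1, h2]
      exact hh₁_yPlus _ (by ring) (by push_cast; ring) _

lemma isFiniteComplex_hh₀ (n : ℕ) :
    IsFiniteComplex (HHComplex 0 (minK n)) (-(n : ℤ)) n (hh₀Term n) (hh₀D n) :=
  ((isFiniteComplex_minK n).map (HH 0)).congr (fun i => (hh₀TermIso n i).symm)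
    (fun i => inv_comm_of_hom_comm _ _ (hh₀TermIso_comm n i))

lemma isFiniteComplex_hh₁ (n : ℕ) :
    IsFiniteComplex (HHComplex 1 (minK n)) (-(n : ℤ)) n (hh₁Term n) (hh₁D n) :=
  ((isFiniteComplex_minK n).map (HH 1)).congr (fun i => (hh₁TermIso n i).symm)
    (fun i => inv_comm_of_hom_comm _ _ (hh₁TermIso_comm n i))

end

section

open GrMod

/-! ### Homology of finite complexes -/

section

variable {W : Type*} [Category W] [Abelian W]

lemma isZero_homology_of_mono (C : CochainComplex W ℤ) {k l : ℤ} (h : k + 1 = l)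
    (hd : Mono (C.d k l)) : IsZero (C.homology k) := by
  rw [← HomologicalComplex.exactAt_iff_isZero_homology,
    HomologicalComplex.exactAt_iff' C (k - 1) k l (by simp) (by simpa using h)]
  have h0 : C.d (k - 1) k = 0 := zero_of_comp_mono (C.d k l) (C.d_comp_d _ _ _)
  exact (ShortComplex.exact_iff_mono _ h0).2 hd

lemma isZero_homology_of_epi (C : CochainComplex W ℤ) {k l : ℤ} (h : k + 1 = l)
    (hd : Epi (C.d k l)) : IsZero (C.homology l) := by
  rw [← HomologicalComplex.exactAt_iff_isZero_homology,
    HomologicalComplex.exactAt_iff' C k l (l + 1) (by subst h; simp) (by simp)]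
  have h0 : C.d l (l + 1) = 0 := zero_of_epi_comp (C.d k l) (C.d_comp_d _ _ _)
  exact (ShortComplex.exact_iff_epi _ h0).2 hd

lemma nonempty_homology_iso (C : CochainComplex W ℤ) {k l : ℤ} (h : k + 1 = l)
    (hd : C.d k l = 0) (hd' : C.d l (l + 1) = 0) : Nonempty (C.homology l ≅ C.X l) :=
  ⟨C.homologyIsoSc' k l (l + 1) (by subst h; simp) (by simp) ≪≫
    (ShortComplex.HomologyData.ofZeros (C.sc' k l (l + 1)) hd hd').left.homologyIso⟩

namespace IsFiniteComplex

variable {K : CochainComplex W ℤ} {a : ℤ} {n : ℕ} {T : ℕ → W} {d : ∀ i, T i ⟶ T (i + 1)}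

lemma isZero_homology_of_mono (h : IsFiniteComplex K a n T d) (i : ℕ) (hi : i + 1 ≤ n)
    (hd : Mono (d i)) :
    IsZero (K.homology (a + i)) := by
  obtain ⟨-, e, he⟩ := h
  refine RouquierHHH.isZero_homology_of_mono K (l := a + (i + 1 : ℕ)) (by push_cast; ring) ?_
  have := he i hi
  rw [← Iso.eq_comp_inv] at this
  rw [this]
  infer_instance

lemma isZero_homology_of_epi (h : IsFiniteComplex K a n T d) (i : ℕ) (hi : i + 1 ≤ n)
    (hd : Epi (d i)) :
    IsZero (K.homology (a + (i + 1 : ℕ))) := by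
  obtain ⟨-, e, he⟩ := h
  refine RouquierHHH.isZero_homology_of_epi K (k := a + i) (by push_cast; ring) ?_
  have := he i hi
  rw [← Iso.eq_comp_inv] at this
  rw [this]
  infer_instance

/-- The condition on the outgoing differential is needed only inside the complex; at the right end
the next term is zero. -/
lemma nonempty_homology_iso (h : IsFiniteComplex K a n T d) (i : ℕ) (hi : i + 1 ≤ n)
    (hd : d i = 0) (hd' : i + 2 ≤ n → d (i + 1) = 0) :
    Nonempty (K.homology (a + (i + 1 : ℕ)) ≅ T (i + 1)) := by
  obtain ⟨h0, e, he⟩ := h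
  have h1 : ∀ i (hi : i + 1 ≤ n), d i = 0 → K.d (a + i) (a + (i + 1 : ℕ)) = 0 := fun i hi hd => by
    have := he i hi
    rw [← Iso.eq_comp_inv] at this
    rw [this, hd]
    simp
  have h2 : K.d (a + (i + 1 : ℕ)) (a + (i + 1 : ℕ) + 1) = 0 := by
    by_cases hi' : i + 2 ≤ n
    · have h3 := h1 (i + 1) hi' (hd' hi')
      have h4 : a + ((i + 1 + 1 : ℕ) : ℤ) = a + (i + 1 : ℕ) + 1 := by push_cast; ring
      rwa [h4] at h3
    · exact (h0 _ (Or.inr (by push_cast; omega))).eq_of_tgt _ _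
  obtain ⟨f⟩ := RouquierHHH.nonempty_homology_iso K (by push_cast; ring) (h1 i hi hd) h2
  exact ⟨f ≪≫ e (i + 1) hi⟩

end IsFiniteComplex

end

/-! ### Multiplication in `R`, degree by degree -/

section

variable {s t j : ℤ}

lemma mono_map_mulR {f : R} (hf : f ∈ R.deg (s - t)) (h0 : f ≠ 0) :
    Mono ((degreePart Unit j).map (mulR Unit f hf)) := by
  rw [ModuleCat.mono_iff_injective]
  intro x y hxy
  exact Subtype.ext (mul_left_cancel₀ h0 (congrArg Subtype.val hxy : f * (x.1 : R) = f * y.1))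

lemma epi_map_mulR_one (h : s = t) (hf : 1 ∈ R.deg (s - t)) :
    Epi ((degreePart Unit j).map (mulR Unit 1 hf)) := by
  rw [ModuleCat.epi_iff_surjective]
  rintro ⟨x, hx⟩
  exact ⟨⟨x, h ▸ hx⟩, Subtype.ext (one_mul (x : R))⟩

/-- The cokernel of `2y` is spanned by the constant `1`, which sits in degree `t`. In any other
degree an element is zero or a multiple of `y ^ k` with `k ≥ 1`. -/
lemma epi_map_mulR_two_X (h : s - t = 2) (hj : j ≠ t) (hf : 2 * X ∈ R.deg (s - t)) :
    Epi ((degreePart Unit j).map (mulR Unit (2 * X) hf)) := by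
  rw [ModuleCat.epi_iff_surjective]
  rintro ⟨x, hx⟩
  change R at x
  change x ∈ R.deg (j - t) at hx
  suffices H : ∃ y ∈ R.deg (j - s), 2 * X * y = x by
    obtain ⟨y, hy, hxy⟩ := H
    exact ⟨⟨y, hy⟩, Subtype.ext hxy⟩
  by_cases hk : ∃ k : ℕ, 2 * (k : ℤ) = j - t
  · obtain ⟨k, hk⟩ := hk
    rw [← hk, R.mem_deg_two_mul] at hx
    obtain ⟨c, rfl⟩ := hx
    obtain ⟨l, rfl⟩ : ∃ l, k = l + 1 := ⟨k - 1, by omega⟩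
    refine ⟨(c / 2) • X ^ l, ?_, ?_⟩
    · rw [show j - s = 2 * (l : ℕ) by push_cast at hk; omega]
      exact Submodule.smul_mem _ _ (R.mem_deg l)
    · rw [mul_smul_comm, mul_assoc, ← pow_succ', two_mul, ← two_smul ℚ, smul_smul,
        div_mul_cancel₀ c two_ne_zero]
  · refine ⟨0, Submodule.zero_mem _, ?_⟩
    rw [mul_zero, R.deg_eq_zero (fun k h => hk ⟨k, h⟩) hx]

lemma map_mulR_two_X_eq_zero (h : s - t = 2) (hj : j = t) (hf : 2 * X ∈ R.deg (s - t)) :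
    (degreePart Unit j).map (mulR Unit (2 * X) hf) = 0 := by
  ext ⟨x, hx⟩
  -- In the degree of the constant of the target, the source would need a polynomial of degree `-2`.
  have h0 : (x : R) = 0 := R.deg_neg (by omega : j - s < 0) hx
  refine Subtype.ext ?_
  change 2 * X * (x : R) = 0
  rw [h0, mul_zero]

lemma rank_degreePart_shift (h : j = t) :
    Module.rank ℚ ((degreePart Unit j).obj ((ring Unit).shift t)) = 1 := by
  have h1 : ((ring Unit).shift t).gr j = Submodule.span ℚ {(1 : R)} := by
    ext x
    change x ∈ R.deg (j - t) ↔ _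
    have h2 := R.mem_deg_two_mul (k := 0) (a := x)
    rw [show j - t = 2 * ((0 : ℕ) : ℤ) by simp [h], h2, Submodule.mem_span_singleton, pow_zero]
    exact ⟨fun ⟨c, hc⟩ => ⟨c, hc.symm⟩, fun ⟨c, hc⟩ => ⟨c, hc.symm⟩⟩
  change Module.rank ℚ (((ring Unit).shift t).gr j) = 1
  rw [h1, ← (LinearEquiv.toSpanNonzeroSingleton ℚ R 1 one_ne_zero).rank_eq, Module.rank_self]

end

lemma rank_of_isZero {M : ModuleCat.{0} ℚ} (h : IsZero M) : Module.rank ℚ M = 0 := by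
  have := ModuleCat.subsingleton_of_isZero h
  exact rank_subsingleton' ℚ M

/-! ### The triply graded homology of the minimal complex -/

lemma two_X_ne_zero : (2 * X : R) ≠ 0 := mul_ne_zero two_ne_zero X_ne_zero

/-- At odd `t` the incoming map is `2y` and the outgoing one is zero, so the homology is the
cokernel of `2y`, a line in degree `2n - 2t`. At even `t` the outgoing map `2y` is injective and
nothing survives. -/
lemma rank_HHH₀ {n : ℕ} (hn : Odd n) (j : ℤ) (t : ℕ) (ht : t ≤ n) :
    Module.rank ℚ (HHH (minK n) 0 j (-n + t)) =
      if Odd t ∧ j = 2 * n - 2 * t then 1 else 0 := by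
  have H := (isFiniteComplex_hh₀ n).map (degreePart Unit j)
  by_cases h : Odd t
  · obtain ⟨i, rfl⟩ : ∃ i, t = i + 1 := ⟨t - 1, by have := h.pos; omega⟩
    have hi : Even i := Nat.not_odd_iff_even.1 (Nat.odd_add_one.1 h)
    have h1 : hh₀D n i = mulR Unit (2 * X) _ := if_pos hi
    have h2 : hh₀D n (i + 1) = 0 := if_neg (Nat.not_even_iff_odd.2 h)
    by_cases hj : j = 2 * n - 2 * (i + 1 : ℕ)
    · rw [if_pos ⟨h, hj⟩]
      obtain ⟨e⟩ := H.nonempty_homology_iso i ht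
        (by rw [h1]; exact map_mulR_two_X_eq_zero (by push_cast; ring) hj _)
        (fun _ => by rw [h2]; exact Functor.map_zero _ _ _)
      exact e.toLinearEquiv.rank_eq.trans (rank_degreePart_shift hj)
    · rw [if_neg fun h' => hj h'.2]
      exact rank_of_isZero (H.isZero_homology_of_epi i ht
        (by rw [h1]; exact epi_map_mulR_two_X (by push_cast; ring) hj _))
  · rw [if_neg fun h' => h h'.1]
    have h1 : hh₀D n t = mulR Unit (2 * X) _ := if_pos (Nat.not_odd_iff_even.1 h)
    refine rank_of_isZero (H.isZero_homology_of_mono t ?_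
      (by rw [h1]; exact mono_map_mulR _ two_X_ne_zero))
    -- Since `n` is odd, an even `t` is not the right end, so there is an outgoing differential.
    rcases ht.eq_or_lt with rfl | h'
    · exact absurd hn h
    · exact h'

/-- The first map is an isomorphism and removes the positions `0` and `1`. From position `2` on the
pattern is that of `HH₀`, with the constants of position `t` in degree `2n + 2 - 2(t - 1)`. -/
lemma rank_HHH₁ {n : ℕ} (hn : Odd n) (j : ℤ) (t : ℕ) (ht : t ≤ n) :
    Module.rank ℚ (HHH (minK n) 1 j (-n + t)) =
      if Odd t ∧ 3 ≤ t ∧ j = 2 * n - 2 * t + 4 then 1 else 0 := by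
  have H := (isFiniteComplex_hh₁ n).map (degreePart Unit j)
  match t with
  | 0 =>
    rw [if_neg fun h => by omega]
    exact rank_of_isZero (H.isZero_homology_of_mono 0 hn.pos (mono_map_mulR
      (by convert R.one_mem_deg using 2; push_cast; ring) one_ne_zero))
  | 1 =>
    rw [if_neg fun h => by omega]
    exact rank_of_isZero (H.isZero_homology_of_epi 0 ht (epi_map_mulR_one (by simp)
      (by convert R.one_mem_deg using 2; push_cast; ring)))
  | i + 2 =>
    by_cases h : Odd (i + 2)
    · have hi : Even (i + 1) := Nat.not_odd_iff_even.1 (Nat.odd_add_one.1 h)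
      have h1 : hh₁D n (i + 1) = mulR Unit (2 * X) _ := if_pos hi
      have h2 : hh₁D n (i + 2) = 0 := if_neg (Nat.not_even_iff_odd.2 h)
      have hi3 : 3 ≤ i + 2 := by
        rcases i with _ | i
        · exact absurd h (by decide)
        · omega
      by_cases hj : j = 2 * n + 2 - 2 * (i + 1 : ℕ)
      · rw [if_pos ⟨h, hi3, by rw [hj]; push_cast; ring⟩]
        obtain ⟨e⟩ := H.nonempty_homology_iso (i + 1) ht
          (by rw [h1]; exact map_mulR_two_X_eq_zero (by push_cast; ring) hj _)
          (fun _ => by rw [h2]; exact Functor.map_zero _ _ _)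
        exact e.toLinearEquiv.rank_eq.trans (rank_degreePart_shift hj)
      · rw [if_neg fun h' => hj (by rw [h'.2.2]; push_cast; ring)]
        exact rank_of_isZero (H.isZero_homology_of_epi (i + 1) ht
          (by rw [h1]; exact epi_map_mulR_two_X (by push_cast; ring) hj _))
    · rw [if_neg fun h' => h h'.1]
      have h1 : hh₁D n (i + 2) = mulR Unit (2 * X) _ := if_pos (Nat.not_odd_iff_even.1 h)
      refine rank_of_isZero (H.isZero_homology_of_mono (i + 2) ?_
        (by rw [h1]; exact mono_map_mulR _ two_X_ne_zero))
      rcases ht.eq_or_lt with h' | h'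
      · exact absurd (h' ▸ hn) h
      · exact h'

-- Positions outside `0, …, n` have zero terms, and Hochschild degrees above `1` vanish because the
-- Koszul complex has length one; the rest is `rank_HHH₀` and `rank_HHH₁`.
open Classical in
lemma rank_HHH_minK {n : ℕ} (hn : Odd n) (i : ℕ) (j k : ℤ) :
    Module.rank ℚ (HHH (minK n) i j (k - n)) = if (i, j, k) ∈ tridegrees n then 1 else 0 := by
  by_cases hk : 0 ≤ k ∧ k ≤ n
  · obtain ⟨t, rfl⟩ := Int.eq_ofNat_of_zero_le hk.1
    have ht : t ≤ n := by exact_mod_cast hk.2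
    rw [show (t : ℤ) - n = -n + t by ring]
    match i with
    | 0 =>
      rw [rank_HHH₀ hn j t ht]
      refine if_congr ⟨fun h => Or.inl ⟨t, h.1, h.1.pos, ht, by rw [h.2]⟩, ?_⟩ rfl rfl
      rintro (⟨u, hu, -, -, h⟩ | ⟨u, -, -, -, h⟩)
      · simp only [Prod.mk.injEq, Nat.cast_inj] at h
        obtain ⟨-, h, rfl⟩ := h
        exact ⟨hu, h⟩
      · simp at h
    | 1 =>
      rw [rank_HHH₁ hn j t ht]
      refine if_congr ⟨fun h => Or.inr ⟨t, h.1, h.2.1, ht, by rw [h.2.2]⟩, ?_⟩ rfl rfl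
      rintro (⟨u, -, -, -, h⟩ | ⟨u, hu, hu', -, h⟩)
      · simp at h
      · simp only [Prod.mk.injEq, Nat.cast_inj] at h
        obtain ⟨-, h, rfl⟩ := h
        exact ⟨hu, hu', h⟩
    | i + 2 =>
      rw [if_neg (by rintro (⟨u, -, -, -, h⟩ | ⟨u, -, -, -, h⟩) <;> simp at h)]
      refine rank_of_isZero ((HomologicalComplex.exactAt_iff_isZero_homology _ _).1
        (ShortComplex.exact_of_isZero_X₂ _ ?_))
      exact (degreePart Unit j).map_isZero (isZero_zero GrModule)
  · have h1 : (i, j, k) ∉ tridegrees n := by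
      rintro (⟨u, -, -, hu, h⟩ | ⟨u, -, -, hu, h⟩) <;>
      · simp only [Prod.mk.injEq] at h
        omega
    rw [if_neg h1]
    refine rank_of_isZero ((HomologicalComplex.exactAt_iff_isZero_homology _ _).1
        (ShortComplex.exact_of_isZero_X₂ _ ?_))
    exact (degreePart Unit j).map_isZero ((HH i).map_isZero
      ((isFiniteComplex_minK n).1 (k - n) (by omega)))

/-- Triply graded homology is invariant under homotopy equivalence. -/
lemma rank_HHH_eq {K L : CochainComplex Bimod ℤ} (e : HomotopyEquiv K L) (i : ℕ) (j k : ℤ) :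
    Module.rank ℚ (HHH K i j k) = Module.rank ℚ (HHH L i j k) :=
  (((degreePart Unit j).mapHomotopyEquiv ((HH i).mapHomotopyEquiv e)).toHomologyIso
    k).toLinearEquiv.rank_eq

open Classical in
lemma rank_HHH_rouquier {n : ℕ} (hn : Odd n) (i : ℕ) (j k : ℤ) :
    Module.rank ℚ (HHH (rouquier n) i j (k - n)) = if (i, j, k) ∈ tridegrees n then 1 else 0 := by
  obtain ⟨e⟩ := nonempty_homotopyEquiv_minK n
  rw [rank_HHH_eq e, rank_HHH_minK hn]

/-! ### The total rank -/

/-- An enumeration of the tridegrees. -/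
def tridegreeEnum (a : ℕ) : Fin (a + 1) ⊕ Fin a → ℕ × ℤ × ℤ
  | .inl s => (0, 2 * (2 * a + 1 : ℕ) - 2 * (2 * s + 1 : ℕ), (2 * s + 1 : ℕ))
  | .inr s => (1, 2 * (2 * a + 1 : ℕ) - 2 * (2 * s + 3 : ℕ) + 4, (2 * s + 3 : ℕ))

lemma tridegreeEnum_injective (a : ℕ) : Function.Injective (tridegreeEnum a) := by
  rintro (s | s) (t | t) h <;> simp only [tridegreeEnum, Prod.mk.injEq] at h
  · obtain rfl : s = t := Fin.ext (by omega)
    rfl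
  · omega
  · omega
  · obtain rfl : s = t := Fin.ext (by omega)
    rfl

lemma range_tridegreeEnum (a : ℕ) : Set.range (tridegreeEnum a) = tridegrees (2 * a + 1) := by
  ext p
  constructor
  · rintro ⟨s | s, rfl⟩
    · exact Or.inl ⟨2 * s + 1, ⟨s, rfl⟩, by omega, by omega, rfl⟩
    · exact Or.inr ⟨2 * s + 3, ⟨s + 1, by ring⟩, by omega, by omega, rfl⟩
  · rintro (⟨_, ⟨s, rfl⟩, h1, h2, rfl⟩ | ⟨_, ⟨s, rfl⟩, h1, h2, rfl⟩)
    · exact ⟨.inl ⟨s, by omega⟩, rfl⟩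
    · obtain ⟨s, rfl⟩ : ∃ r, s = r + 1 := ⟨s - 1, by omega⟩
      exact ⟨.inr ⟨s, by omega⟩, rfl⟩

/-- For `n = 2a + 1` there are `a + 1` odd numbers from `1` to `n` and `a` from `3` to `n`. -/
lemma mk_tridegrees {n : ℕ} (hn : Odd n) : Cardinal.mk (tridegrees n) = n := by
  obtain ⟨a, rfl⟩ := hn
  rw [← range_tridegreeEnum, Cardinal.mk_range_eq _ (tridegreeEnum_injective a), Cardinal.mk_fintype]
  simp
  ring

open Classical in
lemma sum_indicator {ι : Type} (S : Set ι) :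
    (Cardinal.sum fun p : ι => if p ∈ S then (1 : Cardinal.{0}) else 0) = Cardinal.mk S := by
  have h : (fun p : ι => if p ∈ S then (1 : Cardinal.{0}) else 0) =
      fun p => Cardinal.mk (PLift (p ∈ S)) := by
    funext p
    by_cases hp : p ∈ S
    · rw [if_pos hp]
      have : Unique (PLift (p ∈ S)) := ⟨⟨⟨hp⟩⟩, fun _ => rfl⟩
      exact (Cardinal.mk_eq_one _).symm
    · rw [if_neg hp]
      have : IsEmpty (PLift (p ∈ S)) := ⟨fun h => hp h.down⟩
      exact (Cardinal.mk_eq_zero _).symm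
  rw [h, ← Cardinal.mk_sigma]
  exact Cardinal.mk_congr (Equiv.sigmaPLiftEquivSubtype _)

lemma rank_total {n : ℕ} (hn : Odd n) :
    Module.rank ℚ (DirectSum (ℕ × ℤ × ℤ) fun p => HHH (rouquier n) p.1 p.2.1 p.2.2) = n := by
  classical
  -- The listed tridegrees count from the leftmost term, which lies in cohomological degree `-n`;
  -- the total rank is unaffected by this translation.
  let σ : ℕ × ℤ × ℤ ≃ ℕ × ℤ × ℤ :=
    (Equiv.refl ℕ).prodCongr ((Equiv.refl ℤ).prodCongr (Equiv.addRight (n : ℤ)))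
  have h : ∀ p : ℕ × ℤ × ℤ, Module.rank ℚ (HHH (rouquier n) p.1 p.2.1 p.2.2) =
      if p ∈ σ ⁻¹' tridegrees n then 1 else 0 := by
    rintro ⟨i, j, k⟩
    have := rank_HHH_rouquier hn i j (k + n)
    rwa [add_sub_cancel_right] at this
  rw [rank_directSum]
  simp only [h]
  rw [sum_indicator, Cardinal.mk_preimage_equiv, mk_tridegrees hn]

end

end

end RouquierHHH

theorem mainTheorem2 (n : ℕ) :
    -- `F(σ₁ⁿ)` is the explicit minimal complex `K` plus a contractible complex
    (∃ K C : CochainComplex Bimod ℤ,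
      Nonempty (rouquier n ≅ K ⊞ C) ∧ IsContractible C ∧ IsMinimal K ∧
      (∀ i ≤ n, Indecomposable (minTerm n i)) ∧
      IsFiniteComplex K (-(n : ℤ)) n (minTerm n) (minD n) ∧
      -- Hochschild homology of the terms of the minimal complex
      IsFiniteComplex (HHComplex 0 K) (-(n : ℤ)) n (hh₀Term n) (hh₀D n) ∧
      IsFiniteComplex (HHComplex 1 K) (-(n : ℤ)) n (hh₁Term n) (hh₁D n)) ∧
    -- the triply graded homology when the closure of `σ₁ⁿ` is a knot
    (Odd n →
      (∀ (i : ℕ) (j k : ℤ),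
        ((i, j, k) ∈ tridegrees n → Module.rank ℚ (HHH (rouquier n) i j (k - n)) = 1) ∧
        ((i, j, k) ∉ tridegrees n → Module.rank ℚ (HHH (rouquier n) i j (k - n)) = 0)) ∧
      Module.rank ℚ (DirectSum (ℕ × ℤ × ℤ) fun p => HHH (rouquier n) p.1 p.2.1 p.2.2) = n) := by
  obtain ⟨C, hC, hC'⟩ := rouquier_iso_biprod n
  refine ⟨⟨minK n, C, hC, hC', isMinimal_minK n, fun i _ => indecomposable_minTerm n i,
    isFiniteComplex_minK n, isFiniteComplex_hh₀ n, isFiniteComplex_hh₁ n⟩,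
    fun hn => ⟨fun i j k => ⟨fun h => ?_, fun h => ?_⟩, rank_total hn⟩⟩
  · rw [rank_HHH_rouquier hn, if_pos h]
  · rw [rank_HHH_rouquier hn, if_neg h]
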